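/- **Setting.** Let $F$ be a field of characteristic $0$ (computable, if the operations below are to be carried out effectively; this is not used otherwise), $R=F[x_1,\dots,x_n]$ with a ranking, i.e. a total order on $\{1,x_1,\dots,x_n\}$ with $1<x_i$, and $\overline F$ the algebraic closure of $F$. The leader $\operatorname{ld}(p)$ is the largest indeterminate occurring in $p$ (and $1$ if $p\in F$); the main degree $\operatorname{mdeg}(p)$ is the degree of $p$ in its leader, and the initial $\operatorname{init}(p)$ is the coefficient of the highest power of the leader. A system $S$ is a finite set of equations $p_=$ and inequations $p_{\neq}$, $p\in R$; $\mathrm{Sol}(S)\subseteq\overline F^n$ is its solution set; $S_x$ and $S_{<x}$ are the sets of elements of $S$ with leader $x$, resp. smaller than $x$. $S$ is *simple* if (i) $|S_{x_i}|\le1$ for all $i$ and $S$ contains no $c_=,c_{\ne}$ with $c\in F$; (ii) $\operatorname{init}(p)(\mathbf a)\neq0$ and (iii) $p(\mathbf a_{<x},x)\in\overline F[x]$ is square-free, for every indeterminate $x$, every $p\in S_x$ and every $\mathbf a\in\mathrm{Sol}(S_{<x})$. A *Thomas decomposition* of $S$ is a finite family of simple systems whose solution sets are pairwise disjoint with union $\mathrm{Sol}(S)$.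 **Ingredients.** *Pseudo division:* functions $\mathsf{prem},\mathsf{pquo}$ such that for $\operatorname{ld}(p)=\operatorname{ld}(q)=x$ one has $m\,p=\mathsf{pquo}(p,q,x)\,q+\mathsf{prem}(p,q,x)$ with $\deg_x\mathsf{prem}(p,q,x)<\deg_x q$, $\operatorname{ld}(m)<x$ and $m\mid\operatorname{init}(q)^k$ for some $k\ge 0$; and such that for $c\in F\setminus\{0\}$, $\mathsf{prem}(cp,q,x)$ is a nonzero constant multiple of $\mathsf{prem}(p,q,x)$. *Selection strategy:* a map $\mathsf{Select}$ choosing from each nonempty finite set $Q$ of equations and inequations an element of $Q$; if it chooses $q_=$, then $Q$ has no equation of leader $<\operatorname{ld}(q)$, and if it chooses $q_{\ne}$, then $Q$ has no equation of leader $\le\operatorname{ld}(q)$. *Subresultants:* for $d_p=\deg_xp>d_q=\deg_xq$ let $\mathrm{PRS}_{d_p}=p$, $\mathrm{PRS}_{d_q}=q$; for $i<d_q$ let $\mathrm{PRS}_i$ be the $i$-th subresultant of $p,q$ in $x$ if it has degree exactly $i$ in $x$; and $\mathrm{PRS}_i=0$ otherwise. Let $\operatorname{res}_{d_p}=1$,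 $\operatorname{res}_0=\mathrm{PRS}_0$ and $\operatorname{res}_i=\operatorname{init}(\mathrm{PRS}_i)$ for $0<i<d_p$. **Algorithm.** A working system is a pair $S=(S_T,S_Q)$, and $(S_T)_x$ is the element of $S_T$ of leader $x$, if any. - $\mathsf{Reduce}(S,p)$: while $x=\operatorname{ld}(p)\ne1$, $(S_T)_x$ is an equation and $\operatorname{mdeg}(p)\ge\operatorname{mdeg}((S_T)_x)$, replace $p$ by $\mathsf{prem}(p,(S_T)_x,x)$. Then, if $x=\operatorname{ld}(p)\neq1$ and $\mathsf{Reduce}(S,\operatorname{init}(p))=0$, return $\mathsf{Reduce}(S,p-\operatorname{init}(p)x^{\operatorname{mdeg}(p)})$; else return $p$. - $\mathsf{Split}(S,p)=(S_1,S_2)$: add $p_{\ne}$, resp. $p_=$, to $S_Q$. - $\mathsf{InitSplit}(S,q)$: $\mathsf{Split}(S,\operatorname{init}(q))$, then add $q$ to the queue of $S_2$. - $\mathsf{ResSplit}(S,p,q)$: let $i$ be least with $\mathsf{Reduce}(S,\operatorname{res}_i(p,q,x))\neq0$; return $i$ and $\mathsf{Split}(S,\operatorname{res}_i(p,q,x))$.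 - $\mathsf{ResSplitGCD}(S,q)$: $\mathsf{ResSplit}(S,(S_T)_x,q)$, add $q_=$ to the queue of $S_2$; return $S_1,S_2,\mathrm{PRS}_i((S_T)_x,q,x)$. - $\mathsf{ResSplitDivide}(S,p,q)$: let $q'=q$ if $\deg_xp>\deg_xq$ and $q'=\mathsf{prem}(q,p,x)$ otherwise; apply $\mathsf{ResSplit}(S,p,q')$, add $q_{\neq}$ to the queue of $S_2$; return $S_1,S_2$ and $\mathsf{pquo}(p,\mathrm{PRS}_i(p,q',x),x)$ if $i>0$, $p$ if $i=0$. - $\mathsf{ResSplitSquareFree}(S,p)$: $\mathsf{ResSplit}(S,p,\partial p/\partial x)$, add the (in)equation $p$ to the queue of $S_2$; return $S_1,S_2$ and $\mathsf{pquo}(p,\mathrm{PRS}_i(p,\partial p/\partial x,x),x)$ if $i>0$, $p$ if $i=0$. - $\mathsf{Decompose}(S')$: start with $P=\{(\emptyset,S')\}$, $\mathit{Result}=\emptyset$. While $P\ne\emptyset$, choose (arbitrarily) and remove some $S\in P$. If $S_Q=\emptyset$, put $S$ into $\mathit{Result}$. Otherwise remove $q=\mathsf{Select}(S_Q)$ from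 $S_Q$, replace the polynomial of $q$ by its $\mathsf{Reduce}$ modulo $S_T$, and let $x=\operatorname{ld}(q)$. If $q$ is $0_{\ne}$, or $c_=$ with $c\in F\setminus\{0\}$, discard $S$. Otherwise put $S$ back into $P$ after the following changes (none if $x=1$); the second output system of each splitting algorithm used is put into $P$ as well, and its first output system takes the place of $S$. - $q$ and $(S_T)_x$ equations: if $\mathsf{Reduce}(S,\operatorname{res}_0((S_T)_x,q,x))=0$, apply $\mathsf{ResSplitGCD}(S,q)$ and replace $(S_T)_x$ by the equation of the returned polynomial; otherwise add $q_=$ and $\operatorname{res}_0((S_T)_x,q,x)_=$ to $S_Q$. - $q$ an equation, $(S_T)_x$ not an equation: if $(S_T)_x$ is an inequation, move it to $S_Q$; then apply $\mathsf{InitSplit}(S,q)$ and $\mathsf{ResSplitSquareFree}(S,q)$ and put the equation of the returned polynomial into $S_T$. - $q$ an inequation, $(S_T)_x$ an equation: apply $\mathsf{ResSplitDivide}(S,(S_T)_x,q)$ and replace $(S_T)_x$ by the equation of the returned polynomial. - $q$ an inequation, $(S_T)_x$ not an equation: apply $\mathsf{InitSplit}(S,q)$ and $\mathsf{ResSplitSquareFree}(S,q)$,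 with returned polynomial $p$. If $(S_T)_x$ is an inequation, apply $\mathsf{ResSplitDivide}(S,(S_T)_x,p)$, with returned polynomial $r$, and replace $(S_T)_x$ by $(r\cdot p)_{\neq}$; if $(S_T)_x$ is empty, put $p_{\ne}$ into $S_T$. **Theorem.** Let $S'$ be a finite system over $R$. For all $\mathsf{prem},\mathsf{pquo}$ and $\mathsf{Select}$ as above and all choices of $S\in P$ in the main loop, $\mathsf{Decompose}(S')$ terminates, i.e. there is no infinite run; and whenever it stops (that is, $P=\emptyset$), all systems in $\mathit{Result}$ have empty queue and $\mathit{Result}$ is a Thomas decomposition of $S'$. In particular, every finite system over $R$ has a Thomas decomposition. -/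

import Mathlib

namespace ThomasDecomposition

open MvPolynomial

universe u v

section Preliminaries

/-! ### Polynomials, leaders, initials

`F` is the ground field, `σ` the finite set of indeterminates; the ranking `1 < x` on
`{1} ∪ σ` is the linear order of `σ` extended by a bottom element `⊥ : WithBot σ`,
which plays the role of `1`. -/

variable {F : Type u} [Field F] {σ : Type v} [LinearOrder σ]

/-- The leader of `p`: the largest indeterminate occurring in `p`, and `⊥` (that is, `1`)
if `p` is a constant. -/
noncomputable def leader (p : MvPolynomial σ F) : WithBot σ := p.vars.max

/-- `p` as a univariate polynomial in `x`, with coefficients in `F[y | y ≠ x]`. -/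
noncomputable def uni (x : σ) : MvPolynomial σ F →ₐ[F] Polynomial (MvPolynomial σ F) :=
  aeval fun y => if y = x then Polynomial.X else Polynomial.C (X y)

/-- Back from univariate polynomials in `x` to multivariate polynomials. -/
noncomputable def ofUni (x : σ) (P : Polynomial (MvPolynomial σ F)) : MvPolynomial σ F :=
  P.eval (X x)

/-- The degree of `p` in `x`. -/
noncomputable def degX (x : σ) (p : MvPolynomial σ F) : ℕ := (uni x p).natDegree

/-- The main degree: the degree in the leader (`0` for constants). -/
noncomputable def mdeg (p : MvPolynomial σ F) : ℕ :=
  match leader p with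
  | none => 0
  | some x => degX x p

/-- The initial: the leading coefficient of `p` in its leader (a constant is its own
initial). -/
noncomputable def init (p : MvPolynomial σ F) : MvPolynomial σ F :=
  match leader p with
  | none => p
  | some x => (uni x p).leadingCoeff

/-- The evaluation `φ_a : F[σ] → F̄`. -/
noncomputable def evalAt (a : σ → AlgebraicClosure F) (p : MvPolynomial σ F) :
    AlgebraicClosure F :=
  aeval a p

/-- The partial evaluation `φ_{<x,a}`, for polynomials with leader at most `x`: all
indeterminates other than `x` are replaced by the coordinates of `a`, while `x` is kept. -/
noncomputable def evalBelow (x : σ) (a : σ → AlgebraicClosure F) (p : MvPolynomial σ F) :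
    Polynomial (AlgebraicClosure F) :=
  aeval (fun y => if y = x then Polynomial.X else Polynomial.C (a y)) p

/-- An equation `p = 0` or an inequation `p ≠ 0`. -/
inductive Constraint (F : Type u) [Field F] (σ : Type v) : Type (max u v)
  | eq (p : MvPolynomial σ F)
  | ne (p : MvPolynomial σ F)

namespace Constraint

/-- The underlying polynomial. -/
def poly : Constraint F σ → MvPolynomial σ F
  | eq p => p
  | ne p => p

/-- The same kind of constraint (equation or inequation) for another polynomial. -/
def withPoly : Constraint F σ → MvPolynomial σ F → Constraint F σ
  | eq _, r => eq r
  | ne _, r => ne r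

/-- `a` is a solution of the constraint. -/
def Holds (a : σ → AlgebraicClosure F) : Constraint F σ → Prop
  | eq p => evalAt a p = 0
  | ne p => evalAt a p ≠ 0

end Constraint

/-- An algebraic system: a finite set of equations and inequations. -/
abbrev AlgSystem (F : Type u) [Field F] (σ : Type v) : Type (max u v) :=
  Finset (Constraint F σ)

/-- The solution set of a system in `F̄^σ`. -/
def Sol (S : AlgSystem F σ) : Set (σ → AlgebraicClosure F) :=
  {a | ∀ c ∈ S, c.Holds a}

open Classical in
/-- `S_x`: the elements of `S` with leader `x`. -/
noncomputable def atLeader (S : AlgSystem F σ) (x : σ) : AlgSystem F σ :=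
  S.filter fun c => leader c.poly = x

open Classical in
/-- `S_{<x}`: the elements of `S` with leader smaller than `x`. -/
noncomputable def below (S : AlgSystem F σ) (x : σ) : AlgSystem F σ :=
  S.filter fun c => leader c.poly < x

/-! ### Simple systems and Thomas decompositions -/

/-- At most one element per leader, and no constant equations or inequations. -/
def IsTriangular (S : AlgSystem F σ) : Prop :=
  (∀ x : σ, (atLeader S x).card ≤ 1) ∧
    ∀ k : F, Constraint.eq (C k) ∉ S ∧ Constraint.ne (C k) ∉ S

/-- No initial vanishes on the solutions of the lower-ranking subsystem. -/
def HasNonvanishingInitials (S : AlgSystem F σ) : Prop :=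
  ∀ x : σ, ∀ c ∈ atLeader S x, ∀ a ∈ Sol (below S x), evalAt a (init c.poly) ≠ 0

/-- Every element is square-free as a univariate polynomial over each solution of the
lower-ranking subsystem. -/
def IsSquareFree (S : AlgSystem F σ) : Prop :=
  ∀ x : σ, ∀ c ∈ atLeader S x, ∀ a ∈ Sol (below S x), Squarefree (evalBelow x a c.poly)

/-- Simple systems. -/
def IsSimple (S : AlgSystem F σ) : Prop :=
  IsTriangular S ∧ HasNonvanishingInitials S ∧ IsSquareFree S

/-- The finite family `D` of systems is a Thomas decomposition of `S`: all members are
simple, and their solution sets are pairwise disjoint and have union the solution set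
of `S`. -/
def IsThomasDecomposition {ι : Type*} (D : ι → AlgSystem F σ) (S : AlgSystem F σ) : Prop :=
  Finite ι ∧ (∀ i, IsSimple (D i)) ∧ Sol S = ⋃ i, Sol (D i) ∧
    ∀ i j, i ≠ j → Sol (D i) ∩ Sol (D j) = ∅

/-! ### Pseudo division -/

/-- A pseudo remainder algorithm together with its pseudo quotient algorithm.
For `p`, `q` with leader `x` they satisfy `m * p = pquo p q x * q + prem p q x` with
`deg_x (prem p q x) < deg_x q`, where the multiplier `m` has leader smaller than `x` and
divides a power of the initial of `q`. The choice of multiplier is free, except that the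
remainder is compatible with rescaling `p` by a nonzero constant of the ground field. -/
structure PseudoDivision (F : Type u) [Field F] (σ : Type v) [LinearOrder σ] where
  prem : MvPolynomial σ F → MvPolynomial σ F → σ → MvPolynomial σ F
  pquo : MvPolynomial σ F → MvPolynomial σ F → σ → MvPolynomial σ F
  spec : ∀ (p q : MvPolynomial σ F) (x : σ), leader p = x → leader q = x →
    ∃ (m : MvPolynomial σ F) (k : ℕ), m ∣ init q ^ k ∧ leader m < x ∧
      m * p = pquo p q x * q + prem p q x ∧ degX x (prem p q x) < degX x q
  scale : ∀ (c : F) (p q : MvPolynomial σ F) (x : σ), c ≠ 0 → leader p = x → leader q = x →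
    ∃ c' : F, c' ≠ 0 ∧ prem (C c * p) q x = C c' * prem p q x

/-! ### Facts needed for the termination of `reduce` -/

theorem ofUni_uni (x : σ) (p : MvPolynomial σ F) : ofUni x (uni x p) = p := by
  unfold ofUni uni
  induction p using MvPolynomial.induction_on with
  | C a =>
    rw [← MvPolynomial.algebraMap_eq, AlgHom.commutes]
    simp [Polynomial.algebraMap_apply]
  | add p q hp hq => simp [hp, hq]
  | mul_X p y hp =>
    rw [map_mul, Polynomial.eval_mul, hp, aeval_X]
    by_cases h : y = x <;> simp [h]

theorem leader_le_iff (x : σ) (p : MvPolynomial σ F) :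
    leader p ≤ x ↔ p ∈ supported F (Set.Iic x) := by
  rw [mem_supported, leader, Finset.max_eq_sup_withBot, Finset.sup_le_iff]
  exact ⟨fun h y hy => WithBot.coe_le_coe.1 (h y hy), fun h y hy => WithBot.coe_le_coe.2 (h hy)⟩

theorem leader_lt_iff (x : σ) (p : MvPolynomial σ F) :
    leader p < x ↔ p ∈ supported F (Set.Iio x) := by
  rw [mem_supported, leader, Finset.max_eq_sup_withBot, Finset.sup_lt_iff (WithBot.bot_lt_coe x)]
  exact ⟨fun h y hy => WithBot.coe_lt_coe.1 (h y hy), fun h y hy => WithBot.coe_lt_coe.2 (h hy)⟩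

theorem coeff_uni_mem (x : σ) (p : MvPolynomial σ F) (hp : p ∈ supported F (Set.Iic x)) (k : ℕ) :
    (uni x p).coeff k ∈ supported F (Set.Iio x) := by
  revert k
  rw [supported_eq_adjoin_X] at hp
  induction hp using Algebra.adjoin_induction with
  | mem y hy =>
    obtain ⟨z, hz, rfl⟩ := hy
    intro k
    simp only [uni, aeval_X]
    by_cases h : z = x
    · simp only [h, if_true, Polynomial.coeff_X]
      split_ifs
      · exact one_mem _
      · exact zero_mem _
    · simp only [h, if_false, Polynomial.coeff_C]
      split_ifs
      · exact X_mem_supported.2 (lt_of_le_of_ne hz h)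
      · exact zero_mem _
  | algebraMap r =>
    intro k
    rw [AlgHom.commutes, Polynomial.algebraMap_apply, Polynomial.coeff_C]
    split_ifs
    · exact Subalgebra.algebraMap_mem _ _
    · exact zero_mem _
  | add p q _ _ hp hq =>
    intro k
    rw [map_add, Polynomial.coeff_add]
    exact add_mem (hp k) (hq k)
  | mul p q _ _ hp hq =>
    intro k
    rw [map_mul, Polynomial.coeff_mul]
    exact sum_mem fun i _ => mul_mem (hp _) (hq _)

theorem uni_of_mem_Iio (x : σ) (p : MvPolynomial σ F) (hp : p ∈ supported F (Set.Iio x)) :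
    uni x p = Polynomial.C p := by
  rw [supported_eq_adjoin_X] at hp
  induction hp using Algebra.adjoin_induction with
  | mem y hy =>
    obtain ⟨z, hz, rfl⟩ := hy
    simp [uni, (show z < x from hz).ne]
  | algebraMap r => rw [AlgHom.commutes, Polynomial.algebraMap_apply]
  | add p q _ _ hp hq => rw [map_add, hp, hq, map_add]
  | mul p q _ _ hp hq => rw [map_mul, hp, hq, map_mul]

theorem mdeg_eq {p : MvPolynomial σ F} {x : σ} (h : leader p = x) : mdeg p = degX x p := by
  unfold mdeg
  rw [h]

theorem init_eq {p : MvPolynomial σ F} {x : σ} (h : leader p = x) :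
    init p = (uni x p).leadingCoeff := by
  unfold init
  rw [h]

theorem leader_init_lt {p : MvPolynomial σ F} {x : σ} (h : leader p = x) :
    leader (init p) < leader p := by
  rw [h, init_eq h, leader_lt_iff]
  exact coeff_uni_mem x p ((leader_le_iff x p).1 h.le) _

/-- The substitution of `0` for all indeterminates larger than `x`. -/
noncomputable def killAbove (x : σ) : MvPolynomial σ F →ₐ[F] MvPolynomial σ F :=
  aeval fun y => if y ≤ x then X y else 0

theorem killAbove_mem (x : σ) (p : MvPolynomial σ F) :
    killAbove x p ∈ supported F (Set.Iic x) := by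
  induction p using MvPolynomial.induction_on with
  | C a =>
    rw [← MvPolynomial.algebraMap_eq, AlgHom.commutes]
    exact Subalgebra.algebraMap_mem _ _
  | add p q hp hq =>
    rw [map_add]
    exact add_mem hp hq
  | mul_X p y hp =>
    rw [map_mul]
    refine mul_mem hp ?_
    simp only [killAbove, aeval_X]
    split_ifs with h
    · exact X_mem_supported.2 h
    · exact zero_mem _

theorem killAbove_eq (x : σ) (p : MvPolynomial σ F) (hp : p ∈ supported F (Set.Iic x)) :
    killAbove x p = p := by
  rw [supported_eq_adjoin_X] at hp
  induction hp using Algebra.adjoin_induction with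
  | mem y hy =>
    obtain ⟨z, hz, rfl⟩ := hy
    simp [killAbove, show z ≤ x from hz]
  | algebraMap r => rw [AlgHom.commutes]
  | add p q _ _ hp hq => rw [map_add, hp, hq]
  | mul p q _ _ hp hq => rw [map_mul, hp, hq]

theorem uni_killAbove (x : σ) (p : MvPolynomial σ F) :
    uni x (killAbove x p) = (uni x p).map (killAbove x).toRingHom := by
  induction p using MvPolynomial.induction_on with
  | C a =>
    rw [← MvPolynomial.algebraMap_eq, AlgHom.commutes, AlgHom.commutes,
      Polynomial.algebraMap_apply, Polynomial.map_C]
    simp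
  | add p q hp hq => rw [map_add, map_add, map_add, Polynomial.map_add, hp, hq]
  | mul_X p y hp =>
    have hX : uni x (killAbove x (X y : MvPolynomial σ F)) =
        (uni x (X y)).map (killAbove x).toRingHom := by
      by_cases h : y = x
      · simp [killAbove, uni, h]
      · by_cases h' : y ≤ x <;> simp [killAbove, uni, h, h']
    rw [map_mul, map_mul, map_mul, Polynomial.map_mul, hp, hX]

theorem degX_killAbove_le (x : σ) (p : MvPolynomial σ F) :
    degX x (killAbove x p) ≤ degX x p := by
  unfold degX
  rw [uni_killAbove]
  exact Polynomial.natDegree_map_le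

theorem leader_prem_le (pd : PseudoDivision F σ) {p q : MvPolynomial σ F} {x : σ}
    (hp : leader p = x) (hq : leader q = x) : leader (pd.prem p q x) ≤ x := by
  obtain ⟨m, k, -, hm, he, hd⟩ := pd.spec p q x hp hq
  set A := pd.pquo p q x
  set B := pd.prem p q x
  have h1 := congrArg (killAbove x) he
  rw [map_mul, map_add, map_mul, killAbove_eq x m ((leader_le_iff x m).1 hm.le),
    killAbove_eq x p ((leader_le_iff x p).1 hp.le),
    killAbove_eq x q ((leader_le_iff x q).1 hq.le), he] at h1
  have h2 : (A - killAbove x A) * q = killAbove x B - B := by linear_combination h1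
  have h3 : A - killAbove x A = 0 := by
    by_contra hne
    have hinj : Function.Injective (uni (F := F) x) :=
      Function.LeftInverse.injective (ofUni_uni x)
    have hq0 : q ≠ 0 := by
      rintro rfl
      simp [leader] at hq
    have h4 := congrArg (fun f => (uni x f).natDegree) h2
    unfold degX at hd
    beta_reduce at h4
    rw [map_mul, Polynomial.natDegree_mul ((map_ne_zero_iff _ hinj).2 hne)
      ((map_ne_zero_iff _ hinj).2 hq0),
      map_sub (uni x) (killAbove x B) B] at h4
    have h5 := Polynomial.natDegree_sub_le (uni x (killAbove x B)) (uni x B)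
    have h6 := degX_killAbove_le x B
    unfold degX at h6
    rw [max_eq_right h6] at h5
    omega
  rw [h3, zero_mul, eq_comm, sub_eq_zero] at h2
  rw [leader_le_iff, ← h2]
  exact killAbove_mem x B

theorem prem_lex (pd : PseudoDivision F σ) {p q : MvPolynomial σ F} {x : σ}
    (hp : leader p = x) (hq : leader q = x) (hd : mdeg q ≤ mdeg p) :
    Prod.Lex (· < ·) (· < ·) (leader (pd.prem p q x), mdeg (pd.prem p q x))
      (leader p, mdeg p) := by
  rcases (leader_prem_le pd hp hq).lt_or_eq with h | h
  · exact Prod.Lex.left _ _ (hp ▸ h)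
  · obtain ⟨-, -, -, -, -, hlt⟩ := pd.spec p q x hp hq
    rw [hp, h]
    refine Prod.Lex.right _ ?_
    rw [mdeg_eq h]
    rw [mdeg_eq hq] at hd
    omega

theorem tail_lex {p : MvPolynomial σ F} {x : σ} (hp : leader p = x) :
    Prod.Lex (· < ·) (· < ·)
      (leader (p - init p * X x ^ mdeg p), mdeg (p - init p * X x ^ mdeg p))
      (leader p, mdeg p) := by
  have hle : leader (p - init p * X x ^ mdeg p) ≤ x := by
    rw [leader_le_iff]
    refine sub_mem ((leader_le_iff x p).1 hp.le) (mul_mem ?_ (pow_mem ?_ _))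
    · exact (leader_le_iff x _).1 ((leader_init_lt hp).le.trans hp.le)
    · exact X_mem_supported.2 le_rfl
  rcases hle.lt_or_eq with h | h
  · exact Prod.Lex.left _ _ (hp ▸ h)
  · rw [hp, h]
    refine Prod.Lex.right _ ?_
    have hinit : init p ∈ supported F (Set.Iio x) := by
      rw [← leader_lt_iff, ← hp]
      exact leader_init_lt hp
    have hu : uni x (p - init p * X x ^ mdeg p) = (uni x p).eraseLead := by
      rw [map_sub, map_mul, map_pow, uni_of_mem_Iio x _ hinit, mdeg_eq hp, init_eq hp]
      have : uni (F := F) x (X x) = Polynomial.X := by simp [uni]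
      rw [this]
      unfold degX
      rw [← Polynomial.self_sub_C_mul_X_pow]
    rw [mdeg_eq h]
    unfold degX
    rw [hu, mdeg_eq hp]
    unfold degX
    have hpos : 0 < (uni x p).natDegree := by
      rcases Nat.eq_zero_or_pos (uni x p).natDegree with h0 | h0
      · exfalso
        have h1 := ofUni_uni x p
        rw [Polynomial.eq_C_of_natDegree_eq_zero h0] at h1
        simp only [ofUni, Polynomial.eval_C] at h1
        have h2 := coeff_uni_mem x p ((leader_le_iff x p).1 hp.le) 0
        rw [h1, ← leader_lt_iff, hp] at h2
        exact lt_irrefl _ h2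
      · exact h0
    have := Polynomial.eraseLead_natDegree_le (uni x p)
    omega

/-! ### Subresultants -/

/-- The `i`-th subresultant of univariate polynomials `P`, `Q`: the determinant polynomial of
`X^(d_Q-i-1) P, …, P, X^(d_P-i-1) Q, …, Q`, for `i < min d_P d_Q`. -/
noncomputable def subresultant {A : Type*} [CommRing A] (P Q : Polynomial A) (i : ℕ) :
    Polynomial A :=
  let N := (Q.natDegree - i) + (P.natDegree - i)
  let row : ℕ → Polynomial A := fun r =>
    if r < Q.natDegree - i then Polynomial.X ^ (Q.natDegree - i - 1 - r) * P
    else Polynomial.X ^ (P.natDegree - i - 1 - (r - (Q.natDegree - i))) * Q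
  ∑ j ∈ Finset.range (i + 1),
    Polynomial.C (Matrix.det (Matrix.of fun r c : Fin N =>
      (row r).coeff (if (c : ℕ) + 1 = N then j else N - 1 - c + i))) * Polynomial.X ^ j

open Classical in
/-- `PRS_i(p, q, x)` for `deg_x q < deg_x p`: the polynomial `p` for `i = deg_x p`, the
polynomial `q` for `i = deg_x q`, the `i`-th subresultant for `i < deg_x q` provided that it
is regular (of degree exactly `i` in `x`), and `0` otherwise. -/
noncomputable def PRS (p q : MvPolynomial σ F) (x : σ) (i : ℕ) : MvPolynomial σ F :=
  if i = degX x p then p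
  else if i = degX x q then q
  else if i < degX x q ∧ (subresultant (uni x p) (uni x q) i).coeff i ≠ 0 then
    ofUni x (subresultant (uni x p) (uni x q) i)
  else 0

/-- `res_i(p, q, x)`. -/
noncomputable def res (p q : MvPolynomial σ F) (x : σ) (i : ℕ) : MvPolynomial σ F :=
  if i = degX x p then 1
  else if i = 0 then PRS p q x 0
  else init (PRS p q x i)

end Preliminaries

section Algorithm

variable {F : Type u} [Field F] {σ : Type v} [LinearOrder σ]

/-- A pair `(S_T, S_Q)` of a candidate simple system and a queue. -/
structure PairSystem (F : Type u) [Field F] (σ : Type v) : Type (max u v) where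
  T : AlgSystem F σ
  Q : AlgSystem F σ

open Classical in
/-- The pair viewed as one system. -/
noncomputable def PairSystem.toAlgSystem (S : PairSystem F σ) : AlgSystem F σ := S.T ∪ S.Q

open Classical in
/-- `(S_T)_x`: the element of `S_T` with leader `x`, if any (`S_T` has at most one). -/
noncomputable def slot (T : AlgSystem F σ) (x : σ) : Option (Constraint F σ) :=
  if h : ∃ c ∈ T, leader c.poly = x then some h.choose else none

theorem leader_of_slot {T : AlgSystem F σ} {x : σ} {c : Constraint F σ}
    (h : slot T x = some c) : leader c.poly = x := by
  unfold slot at h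
  split_ifs at h with h'
  obtain rfl := Option.some.inj h
  exact h'.choose_spec.2

noncomputable instance [Finite σ] : WellFoundedRelation (WithBot σ) := ⟨(· < ·), wellFounded_lt⟩

open Classical in
/-- `Reduce(S, p)`: pseudo-reduce `p` modulo the equation of `S_T` with the leader of `p`, as
long as the main degree is not smaller than that of the equation; afterwards, drop the leading
term if the initial reduces to `0`, and start again with the remaining terms. -/
noncomputable def reduce [Finite σ] (pd : PseudoDivision F σ) (T : AlgSystem F σ)
    (p : MvPolynomial σ F) : MvPolynomial σ F :=
  match hp : leader p with
  | none => p
  | some x =>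
    if h : ∃ t, slot T x = some (Constraint.eq t) ∧ mdeg t ≤ mdeg p then
      reduce pd T (pd.prem p h.choose x)
    else if reduce pd T (init p) = 0 then
      reduce pd T (p - init p * X x ^ mdeg p)
    else p
termination_by (leader p, mdeg p)
decreasing_by
  · exact prem_lex pd hp (leader_of_slot h.choose_spec.1) h.choose_spec.2
  · exact Prod.Lex.left _ _ (leader_init_lt hp)
  · exact tail_lex hp

open Classical in
/-- `Split(S, p)`. -/
noncomputable def split (S : PairSystem F σ) (p : MvPolynomial σ F) :
    PairSystem F σ × PairSystem F σ :=
  (⟨S.T, S.Q ∪ {Constraint.ne p}⟩, ⟨S.T, S.Q ∪ {Constraint.eq p}⟩)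

open Classical in
/-- Insertion of a constraint into the queue. -/
noncomputable def enqueue (S : PairSystem F σ) (c : Constraint F σ) : PairSystem F σ :=
  ⟨S.T, S.Q ∪ {c}⟩

open Classical in
/-- Removal of `(S_T)_x` from `S_T`. -/
noncomputable def clearSlot (S : PairSystem F σ) (x : σ) : PairSystem F σ :=
  ⟨S.T.filter fun c => leader c.poly ≠ x, S.Q⟩

open Classical in
/-- `(S_T)_x ← c`. -/
noncomputable def setSlot (S : PairSystem F σ) (x : σ) (c : Constraint F σ) :
    PairSystem F σ :=
  ⟨(clearSlot S x).T ∪ {c}, S.Q⟩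

/-- `InsertEquation(S, r_=)`, for `r` with leader `x`. -/
noncomputable def insertEquation (S : PairSystem F σ) (x : σ) (r : MvPolynomial σ F) :
    PairSystem F σ :=
  setSlot S x (Constraint.eq r)

/-- `InitSplit(S, q)`. -/
noncomputable def initSplit (S : PairSystem F σ) (q : Constraint F σ) :
    PairSystem F σ × PairSystem F σ :=
  let S₁₂ := split S (init q.poly)
  (S₁₂.1, enqueue S₁₂.2 q)

/-- The quasi fiber cardinality of `p` and `q`: the least `i` such that `res_i` does not reduce
to `0`. -/
noncomputable def quasiFiberCard [Finite σ] (pd : PseudoDivision F σ) (T : AlgSystem F σ)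
    (p q : MvPolynomial σ F) (x : σ) : ℕ :=
  sInf {i : ℕ | (∀ j < i, reduce pd T (res p q x j) = 0) ∧ reduce pd T (res p q x i) ≠ 0}

/-- `ResSplit(S, p, q)`. -/
noncomputable def resSplit [Finite σ] (pd : PseudoDivision F σ) (S : PairSystem F σ)
    (p q : MvPolynomial σ F) (x : σ) : ℕ × PairSystem F σ × PairSystem F σ :=
  let i := quasiFiberCard pd S.T p q x
  (i, split S (res p q x i))

/-- `ResSplitGCD(S, q)`, where `t` is the polynomial of the equation `(S_T)_x`. -/
noncomputable def resSplitGCD [Finite σ] (pd : PseudoDivision F σ) (S : PairSystem F σ)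
    (t q : MvPolynomial σ F) (x : σ) :
    PairSystem F σ × PairSystem F σ × MvPolynomial σ F :=
  let r := resSplit pd S t q x
  (r.2.1, enqueue r.2.2 (Constraint.eq q), PRS t q x r.1)

/-- `ResSplitDivide(S, p, q)`, where `q` is the polynomial of an inequation. If
`deg_x p ≤ deg_x q`, the fibration split is computed with the pseudo remainder of `q` by `p`
in place of `q`; in either case the inequation for `q` itself goes back into the queue of the
second system. -/
noncomputable def resSplitDivide [Finite σ] (pd : PseudoDivision F σ) (S : PairSystem F σ)
    (p q : MvPolynomial σ F) (x : σ) :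
    PairSystem F σ × PairSystem F σ × MvPolynomial σ F :=
  let q' := if degX x p ≤ degX x q then pd.prem q p x else q
  let r := resSplit pd S p q' x
  (r.2.1, enqueue r.2.2 (Constraint.ne q),
    if 0 < r.1 then pd.pquo p (PRS p q' x r.1) x else p)

/-- `ResSplitSquareFree(S, p)`, for an equation or inequation `p`. -/
noncomputable def resSplitSquareFree [Finite σ] (pd : PseudoDivision F σ) (S : PairSystem F σ)
    (p : Constraint F σ) (x : σ) :
    PairSystem F σ × PairSystem F σ × MvPolynomial σ F :=
  let p' := pderiv x p.poly
  let r := resSplit pd S p.poly p' x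
  (r.2.1, enqueue r.2.2 p,
    if 0 < r.1 then pd.pquo p.poly (PRS p.poly p' x r.1) x else p.poly)

/-- A selection strategy picks an element of every nonempty finite set of constraints, an
equation only if there is no equation of smaller leader, an inequation only if there is no
equation of smaller or equal leader. -/
def IsSelectionStrategy (sel : AlgSystem F σ → Constraint F σ) : Prop :=
  ∀ Q : AlgSystem F σ, Q.Nonempty → sel Q ∈ Q ∧
    (∀ p, sel Q = Constraint.eq p → ∀ r, Constraint.eq r ∈ Q → ¬ leader r < leader p) ∧
    (∀ p, sel Q = Constraint.ne p → ∀ r, Constraint.eq r ∈ Q → ¬ leader r ≤ leader p)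

open Classical in
/-- The treatment of a reduced equation `q_=` with leader `x`, for a system from whose queue
the selected constraint has been removed. The value is the set of systems put back into `P`. -/
noncomputable def treatEquation [Finite σ] (pd : PseudoDivision F σ) (S : PairSystem F σ)
    (q : MvPolynomial σ F) (x : σ) : Finset (PairSystem F σ) :=
  match slot S.T x with
  | some (Constraint.eq t) =>
    if reduce pd S.T (res t q x 0) = 0 then
      let g := resSplitGCD pd S t q x
      {insertEquation g.1 x g.2.2, g.2.1}
    else
      {enqueue (enqueue S (Constraint.eq q)) (Constraint.eq (res t q x 0))}
  | some (Constraint.ne t) =>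
    let s := initSplit (enqueue (clearSlot S x) (Constraint.ne t)) (Constraint.eq q)
    let f := resSplitSquareFree pd s.1 (Constraint.eq q) x
    {insertEquation f.1 x f.2.2, s.2, f.2.1}
  | none =>
    let s := initSplit S (Constraint.eq q)
    let f := resSplitSquareFree pd s.1 (Constraint.eq q) x
    {insertEquation f.1 x f.2.2, s.2, f.2.1}

open Classical in
/-- The treatment of a reduced inequation `q_≠` with leader `x`. -/
noncomputable def treatInequation [Finite σ] (pd : PseudoDivision F σ) (S : PairSystem F σ)
    (q : MvPolynomial σ F) (x : σ) : Finset (PairSystem F σ) :=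
  match slot S.T x with
  | some (Constraint.eq t) =>
    let d := resSplitDivide pd S t q x
    {insertEquation d.1 x d.2.2, d.2.1}
  | some (Constraint.ne t) =>
    let s := initSplit S (Constraint.ne q)
    let f := resSplitSquareFree pd s.1 (Constraint.ne q) x
    let d := resSplitDivide pd f.1 t f.2.2 x
    {setSlot d.1 x (Constraint.ne (d.2.2 * f.2.2)), s.2, f.2.1, d.2.1}
  | none =>
    let s := initSplit S (Constraint.ne q)
    let f := resSplitSquareFree pd s.1 (Constraint.ne q) x
    {setSlot f.1 x (Constraint.ne f.2.2), s.2, f.2.1}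

open Classical in
/-- One pass through the main loop for a system `S` with nonempty queue: the set of systems by
which `S` is replaced in `P`. -/
noncomputable def processSystem [Finite σ] (pd : PseudoDivision F σ)
    (sel : AlgSystem F σ → Constraint F σ) (S : PairSystem F σ) : Finset (PairSystem F σ) :=
  let q₀ := sel S.Q
  let S₀ : PairSystem F σ := ⟨S.T, S.Q.erase q₀⟩
  let q := q₀.withPoly (reduce pd S.T q₀.poly)
  if q = Constraint.ne 0 ∨ ∃ c : F, c ≠ 0 ∧ q = Constraint.eq (C c) then ∅
  else
    match leader q.poly with
    | none => {S₀}
    | some x =>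
      match q with
      | Constraint.eq p => treatEquation pd S₀ p x
      | Constraint.ne p => treatInequation pd S₀ p x

/-- The state of the main loop: the set `P` of unfinished systems and the set `Result`. -/
structure LoopState (F : Type u) [Field F] (σ : Type v) : Type (max u v) where
  P : Finset (PairSystem F σ)
  Result : Finset (PairSystem F σ)

open Classical in
/-- One iteration of the main loop of `Decompose`, in which an arbitrary `S ∈ P` is chosen. -/
inductive Step [Finite σ] (pd : PseudoDivision F σ) (sel : AlgSystem F σ → Constraint F σ) :
    LoopState F σ → LoopState F σ → Prop
  | finish (st : LoopState F σ) (S : PairSystem F σ) (hS : S ∈ st.P) (hQ : S.Q = ∅) :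
      Step pd sel st ⟨st.P.erase S, st.Result ∪ {S}⟩
  | process (st : LoopState F σ) (S : PairSystem F σ) (hS : S ∈ st.P) (hQ : S.Q ≠ ∅) :
      Step pd sel st ⟨st.P.erase S ∪ processSystem pd sel S, st.Result⟩

/-- The initial state of `Decompose` on the input `(∅, S)`. -/
def initialState (S : AlgSystem F σ) : LoopState F σ := ⟨{⟨∅, S⟩}, ∅⟩

/-- The loop stops exactly when `P` is empty. -/
theorem exists_step_iff [Finite σ] (pd : PseudoDivision F σ) (sel : AlgSystem F σ → Constraint F σ)
    (st : LoopState F σ) : (∃ st', Step pd sel st st') ↔ st.P ≠ ∅ := by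
  constructor
  · rintro ⟨st', h⟩ h0
    cases h with
    | finish S hS hQ => simp [h0] at hS
    | process S hS hQ => simp [h0] at hS
  · intro h
    obtain ⟨S, hS⟩ := Finset.nonempty_iff_ne_empty.2 h
    by_cases hQ : S.Q = ∅
    · exact ⟨_, Step.finish st S hS hQ⟩
    · exact ⟨_, Step.process st S hS hQ⟩

end Algorithm

end ThomasDecomposition

/-!
The algorithm always treats a polynomial `q` of leader `x` against the part of the system with
smaller leaders, which plays the role of the base of a fibration: over a base point `a`, every
polynomial of leader `x` becomes univariate (`evalBelow`). The proof therefore separates three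
questions: what happens in a single fibre, how this gives a case distinction for the whole
system, and why the case distinctions come to an end.

*Fibres.* If the initial of `p` does not vanish at `a`, then subresultants, taken with formal
degrees, commute with specialization to `a`; this holds although the degree of the other
polynomial may drop. Over a field the first subresultant with nonvanishing principal coefficient is
a greatest common divisor (`isGcd_formalSubresultant`). So, where `res_j` vanishes for `j < i` and
`res_i` does not, `PRS_i` specializes to a greatest common divisor of degree `i`
(`isGcd_evalBelow_PRS`), and the pseudo quotient by `PRS_i` specializes to the exact quotient
(`evalBelow_splitQuotient`). In characteristic zero the quotient by the greatest common divisor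
with the derivative is square-free with the same roots, and for a square-free polynomial the
quotient removes exactly the common roots.

*Case distinctions.* For each system in the loop, initials do not vanish and specializations
are square-free over all solutions of the constraints of smaller leader, where the constraints in
the queue are included (`IsRegular`). Under this invariant a polynomial that reduces to zero
vanishes on the solutions (`evalAt_reduce_eq_zero_iff`); hence the least `i` for which `res_i`
does not reduce to zero satisfies the hypothesis of the fibre statement on the branch
`res_i ≠ 0`, while the other branches keep the treated constraint in the queue. The outcome of
a pass is a list of branches at `x`, and `IsSplitting` states what has to be known about
it: it is sound, complete, disjoint, regular, and it makes progress. These local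
properties give the global ones: the new systems are regular, and their solution sets partition
that of the old system (`isRegular_replaceAt`, `mem_sol_iff_exists_branch`,
`disjoint_branchSystems`). A regular system with empty queue is simple.

*Termination.* Each new system is smaller than the old one in the lexicographic order
`SystemLT`. Its first component consists of the degrees of the equations of the triangular part,
with `⊤` where there is none; its second component is the smallest leader of an equation in the
queue that does not reduce to zero; its third component is a weight of the queue. A branch
that leaves the first component unchanged either adds an equation of smaller leader than all those
in the queue that do not reduce to zero (here the selection strategy enters), or replaces one
inequation by at most three of smaller leader; dropping a constraint that reduces to a constant
lowers the weight. A step of the main loop replaces one system by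
finitely many smaller ones, and the induced order on finite multisets is well-founded
(`LoopInvariant.cutExpand`).

The existence of a Thomas decomposition follows by running the algorithm with the classical
pseudo division and with the selection of a constraint of minimal leader.
-/

namespace ThomasDecomposition

universe u v

/-! ### Leaders, degrees and evaluation -/

section Evaluation

open MvPolynomial

variable {F : Type u} [Field F] {σ : Type v}

theorem evalAt_mul (a : σ → AlgebraicClosure F) (p q : MvPolynomial σ F) :
    evalAt a (p * q) = evalAt a p * evalAt a q := map_mul _ _ _

theorem evalAt_add (a : σ → AlgebraicClosure F) (p q : MvPolynomial σ F) :
    evalAt a (p + q) = evalAt a p + evalAt a q := map_add _ _ _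

theorem evalAt_zero (a : σ → AlgebraicClosure F) : evalAt a (0 : MvPolynomial σ F) = 0 :=
  map_zero _

theorem evalAt_C (a : σ → AlgebraicClosure F) (c : F) :
    evalAt a (C c) = algebraMap F (AlgebraicClosure F) c := by
  simp [evalAt]

theorem evalAt_ne_zero_of_dvd_pow {m r : MvPolynomial σ F} {k : ℕ} (h : m ∣ r ^ k)
    {a : σ → AlgebraicClosure F} (hr : evalAt a r ≠ 0) : evalAt a m ≠ 0 := by
  obtain ⟨s, hs⟩ := h
  intro h0
  have h1 := congrArg (evalAt a) hs
  rw [evalAt_mul, h0, zero_mul] at h1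
  exact pow_ne_zero k hr ((map_pow (aeval a) r k).symm.trans h1)

end Evaluation

section Basics

open MvPolynomial

variable {F : Type u} [Field F] {σ : Type v} [LinearOrder σ]

theorem uni_injective (x : σ) : Function.Injective (uni (F := F) x) :=
  Function.LeftInverse.injective (ofUni_uni x)

theorem uni_ne_zero {x : σ} {p : MvPolynomial σ F} (hp : p ≠ 0) : uni x p ≠ 0 :=
  (map_ne_zero_iff _ (uni_injective x)).2 hp

/-- The partial evaluation evaluates the coefficients of `p`, viewed as a polynomial in `x`. -/
theorem evalBelow_eq_map (x : σ) (a : σ → AlgebraicClosure F) (p : MvPolynomial σ F) :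
    evalBelow x a p =
      (uni x p).map (aeval a : MvPolynomial σ F →ₐ[F] AlgebraicClosure F).toRingHom := by
  unfold evalBelow
  induction p using MvPolynomial.induction_on with
  | C c =>
    rw [← MvPolynomial.algebraMap_eq, AlgHom.commutes, AlgHom.commutes]
    simp [Polynomial.algebraMap_apply]
  | add p q hp hq => rw [map_add, map_add, Polynomial.map_add, hp, hq]
  | mul_X p y hp =>
    rw [map_mul, map_mul, Polynomial.map_mul, hp]
    by_cases h : y = x <;> simp [uni, h]

theorem coeff_evalBelow (x : σ) (a : σ → AlgebraicClosure F) (p : MvPolynomial σ F) (k : ℕ) :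
    (evalBelow x a p).coeff k = evalAt a ((uni x p).coeff k) := by
  rw [evalBelow_eq_map, Polynomial.coeff_map]
  rfl

theorem eval_evalBelow (x : σ) (a : σ → AlgebraicClosure F) (p : MvPolynomial σ F) :
    (evalBelow x a p).eval (a x) = evalAt a p := by
  unfold evalBelow evalAt
  induction p using MvPolynomial.induction_on with
  | C c =>
    rw [← MvPolynomial.algebraMap_eq, AlgHom.commutes, AlgHom.commutes,
      Polynomial.algebraMap_apply, Polynomial.eval_C]
  | add p q hp hq => rw [map_add, map_add, Polynomial.eval_add, hp, hq]
  | mul_X p y hp =>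
    rw [map_mul, map_mul, Polynomial.eval_mul, hp]
    by_cases h : y = x <;> simp [h]

theorem evalBelow_mul (x : σ) (a : σ → AlgebraicClosure F) (p q : MvPolynomial σ F) :
    evalBelow x a (p * q) = evalBelow x a p * evalBelow x a q := map_mul _ _ _

theorem evalBelow_add (x : σ) (a : σ → AlgebraicClosure F) (p q : MvPolynomial σ F) :
    evalBelow x a (p + q) = evalBelow x a p + evalBelow x a q := map_add _ _ _

theorem uni_X_self (x : σ) : uni x (X x : MvPolynomial σ F) = Polynomial.X := by simp [uni]

theorem uni_C (x : σ) (c : F) : uni x (C c : MvPolynomial σ F) = Polynomial.C (C c) := by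
  simp [uni, Polynomial.algebraMap_apply]

theorem evalBelow_of_leader_lt {x : σ} {p : MvPolynomial σ F} (h : leader p < x)
    (a : σ → AlgebraicClosure F) : evalBelow x a p = Polynomial.C (evalAt a p) := by
  rw [evalBelow_eq_map, uni_of_mem_Iio x p ((leader_lt_iff x p).1 h), Polynomial.map_C]
  rfl

theorem natDegree_evalBelow_le (x : σ) (a : σ → AlgebraicClosure F) (p : MvPolynomial σ F) :
    (evalBelow x a p).natDegree ≤ degX x p := by
  rw [evalBelow_eq_map]
  exact Polynomial.natDegree_map_le

theorem uni_ofUni (x : σ) (P : Polynomial (MvPolynomial σ F))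
    (hP : ∀ k, P.coeff k ∈ supported F (Set.Iio x)) : uni x (ofUni x P) = P := by
  unfold ofUni
  rw [Polynomial.eval_eq_sum_range, map_sum]
  conv_rhs => rw [P.as_sum_range_C_mul_X_pow]
  refine Finset.sum_congr rfl fun k _ => ?_
  rw [map_mul, map_pow, uni_X_self, uni_of_mem_Iio x _ (hP k)]

theorem leader_ofUni_le (x : σ) (P : Polynomial (MvPolynomial σ F))
    (hP : ∀ k, P.coeff k ∈ supported F (Set.Iio x)) : leader (ofUni x P) ≤ x := by
  rw [leader_le_iff]
  unfold ofUni
  rw [Polynomial.eval_eq_sum_range]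
  refine sum_mem fun k _ => ?_
  have h1 : P.coeff k ∈ supported F (Set.Iic x) := by
    rw [← leader_le_iff]
    exact ((leader_lt_iff x _).2 (hP k)).le
  have h2 : (X x : MvPolynomial σ F) ∈ supported F (Set.Iic x) :=
    X_mem_supported.2 (Set.mem_Iic.2 (le_refl x))
  exact Subalgebra.mul_mem _ h1 (Subalgebra.pow_mem _ h2 k)

theorem degX_eq_zero_iff {x : σ} {p : MvPolynomial σ F} (h : leader p ≤ x) :
    degX x p = 0 ↔ leader p < x := by
  constructor
  · intro h0
    have h1 := ofUni_uni x p
    unfold degX at h0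
    rw [Polynomial.eq_C_of_natDegree_eq_zero h0] at h1
    simp only [ofUni, Polynomial.eval_C] at h1
    have h2 := coeff_uni_mem x p ((leader_le_iff x p).1 h) 0
    rwa [h1, ← leader_lt_iff] at h2
  · intro h0
    unfold degX
    rw [uni_of_mem_Iio x p ((leader_lt_iff x p).1 h0), Polynomial.natDegree_C]

theorem leader_eq_iff {x : σ} {p : MvPolynomial σ F} (h : leader p ≤ x) :
    leader p = x ↔ 0 < degX x p := by
  rw [Nat.pos_iff_ne_zero, Ne, degX_eq_zero_iff h]
  exact ⟨fun h' => h'.not_lt, fun h' => h.lt_or_eq.resolve_left h'⟩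

theorem degX_pos {x : σ} {p : MvPolynomial σ F} (h : leader p = x) : 0 < degX x p :=
  (leader_eq_iff h.le).1 h

theorem leader_zero : leader (0 : MvPolynomial σ F) = ⊥ := by simp [leader]

theorem leader_C (c : F) : leader (C c : MvPolynomial σ F) = ⊥ := by simp [leader]

theorem leader_one : leader (1 : MvPolynomial σ F) = ⊥ := by
  rw [← C_1]
  exact leader_C 1

theorem eq_C_of_leader_eq_bot {p : MvPolynomial σ F} (h : leader p = ⊥) : ∃ c, p = C c := by
  have h1 : p.vars = ∅ := Finset.max_eq_bot.1 h
  exact ⟨_, vars_eq_empty_iff_eq_C.1 h1⟩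

theorem ne_zero_of_leader {x : σ} {p : MvPolynomial σ F} (h : leader p = x) : p ≠ 0 := by
  rintro rfl
  rw [leader_zero] at h
  exact WithBot.bot_ne_coe h

theorem degX_mul {x : σ} {p q : MvPolynomial σ F} (hp : p ≠ 0) (hq : q ≠ 0) :
    degX x (p * q) = degX x p + degX x q := by
  unfold degX
  rw [map_mul, Polynomial.natDegree_mul (uni_ne_zero hp) (uni_ne_zero hq)]

theorem leader_mul_le {x : σ} {p q : MvPolynomial σ F} (hp : leader p ≤ x) (hq : leader q ≤ x) :
    leader (p * q) ≤ x := by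
  rw [leader_le_iff] at *
  exact mul_mem hp hq

theorem init_ne_zero {p : MvPolynomial σ F} (hp : p ≠ 0) : init p ≠ 0 := by
  unfold init
  split
  · exact hp
  · exact Polynomial.leadingCoeff_ne_zero.2 (uni_ne_zero hp)

theorem evalAt_init {x : σ} {p : MvPolynomial σ F} (h : leader p = x)
    (a : σ → AlgebraicClosure F) :
    evalAt a (init p) = (evalBelow x a p).coeff (degX x p) := by
  rw [init_eq h, coeff_evalBelow]
  rfl

/-- The initial of `p` vanishes at `a` exactly if the degree drops in the fibre over `a`. -/
theorem evalAt_init_ne_zero_iff {x : σ} {p : MvPolynomial σ F} (h : leader p = x)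
    (a : σ → AlgebraicClosure F) :
    evalAt a (init p) ≠ 0 ↔ (evalBelow x a p).natDegree = degX x p := by
  rw [evalAt_init h]
  constructor
  · intro h0
    exact le_antisymm (natDegree_evalBelow_le x a p) (Polynomial.le_natDegree_of_ne_zero h0)
  · intro h0 h1
    rw [← h0, Polynomial.coeff_natDegree, Polynomial.leadingCoeff_eq_zero] at h1
    have := degX_pos h
    rw [h1, Polynomial.natDegree_zero] at h0
    omega

theorem leader_C_mul {c : F} (hc : c ≠ 0) (p : MvPolynomial σ F) :
    leader (C c * p) = leader p := by
  unfold leader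
  rw [vars_C_mul _ hc]

theorem degX_C_mul {c : F} (hc : c ≠ 0) (x : σ) (p : MvPolynomial σ F) :
    degX x (C c * p) = degX x p := by
  unfold degX
  rw [map_mul, uni_C, Polynomial.natDegree_C_mul]
  simpa using hc

theorem mdeg_C_mul {c : F} (hc : c ≠ 0) (p : MvPolynomial σ F) :
    mdeg (C c * p) = mdeg p := by
  rcases h : leader p with _ | x
  · have h' := (leader_C_mul hc p).trans h
    unfold mdeg
    rw [h, h']
  · rw [mdeg_eq h, mdeg_eq ((leader_C_mul hc p).trans h), degX_C_mul hc]

theorem init_C_mul {c : F} (hc : c ≠ 0) (p : MvPolynomial σ F) :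
    init (C c * p) = C c * init p := by
  rcases h : leader p with _ | x
  · have h' := (leader_C_mul hc p).trans h
    unfold init
    rw [h, h']
  · rw [init_eq h, init_eq ((leader_C_mul hc p).trans h), map_mul, uni_C,
      Polynomial.leadingCoeff_mul, Polynomial.leadingCoeff_C]

theorem uni_pderiv (x : σ) (p : MvPolynomial σ F) :
    uni x (pderiv x p) = Polynomial.derivative (uni x p) := by
  induction p using MvPolynomial.induction_on with
  | C c => simp
  | add p q hp hq => simp [hp, hq]
  | mul_X p y hp =>
    rw [Derivation.leibniz, map_add, smul_eq_mul, smul_eq_mul, map_mul, map_mul, hp, map_mul,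
      Polynomial.derivative_mul, pderiv_X]
    by_cases h : y = x
    · subst h
      simp [uni]
      ring
    · simp [uni, h]
      ring

theorem evalBelow_pderiv (x : σ) (a : σ → AlgebraicClosure F) (p : MvPolynomial σ F) :
    evalBelow x a (pderiv x p) = Polynomial.derivative (evalBelow x a p) := by
  rw [evalBelow_eq_map, evalBelow_eq_map, uni_pderiv, Polynomial.derivative_map]

theorem leader_pderiv_le {x : σ} {p : MvPolynomial σ F} (h : leader p ≤ x) :
    leader (pderiv x p) ≤ x := by
  rw [← ofUni_uni x (pderiv x p), uni_pderiv]
  refine leader_ofUni_le x _ fun k => ?_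
  rw [Polynomial.coeff_derivative]
  refine mul_mem (coeff_uni_mem x p ((leader_le_iff x p).1 h) _) ?_
  exact add_mem (natCast_mem _ _) (one_mem _)

theorem degX_pderiv [CharZero F] (x : σ) (p : MvPolynomial σ F) :
    degX x (pderiv x p) = degX x p - 1 := by
  unfold degX
  rw [uni_pderiv, Polynomial.natDegree_derivative]

theorem init_pderiv [CharZero F] {x : σ} {p : MvPolynomial σ F} (hp : leader p = x)
    (hd : 1 < degX x p) :
    leader (pderiv x p) = x ∧ init (pderiv x p) = C (degX x p : F) * init p := by
  have h1 : leader (pderiv x p) = x := by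
    rw [leader_eq_iff (leader_pderiv_le hp.le), degX_pderiv]
    omega
  refine ⟨h1, ?_⟩
  rw [init_eq h1, init_eq hp, uni_pderiv, Polynomial.leadingCoeff,
    Polynomial.natDegree_derivative, Polynomial.coeff_derivative, mul_comm]
  unfold degX at hd ⊢
  rw [Nat.sub_add_cancel hd.le, Polynomial.coeff_natDegree]
  congr 1
  rw [← Nat.cast_one (R := MvPolynomial σ F), ← Nat.cast_add, Nat.sub_add_cancel hd.le,
    map_natCast]

end Basics

/-! ### Subresultants with formal degrees -/

section Subresultants

open Polynomial

variable {A : Type*} [CommRing A]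

/-- The rows of the matrix that defines the `i`-th subresultant of `P` and `Q`, for formal
degrees `m` of `P` and `n` of `Q`. -/
noncomputable def subresultantRow (m n : ℕ) (P Q : A[X]) (i r : ℕ) : A[X] :=
  if r < n - i then X ^ (n - i - 1 - r) * P else X ^ (m - i - 1 - (r - (n - i))) * Q

/-- The matrix whose determinant is the `j`-th coefficient of the `i`-th subresultant. -/
noncomputable def subresultantMatrix (m n : ℕ) (P Q : A[X]) (i j : ℕ) :
    Matrix (Fin (n - i + (m - i))) (Fin (n - i + (m - i))) A :=
  Matrix.of fun r c => (subresultantRow m n P Q i r).coeff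
    (if (c : ℕ) + 1 = n - i + (m - i) then j else n - i + (m - i) - 1 - c + i)

/-- The `i`-th subresultant of `P` and `Q` for prescribed formal degrees `m` and `n`, which may
exceed the actual ones. Formal degrees make subresultants compatible with ring
homomorphisms. -/
noncomputable def formalSubresultant (m n : ℕ) (P Q : A[X]) (i : ℕ) : A[X] :=
  ∑ j ∈ Finset.range (i + 1), C (subresultantMatrix m n P Q i j).det * X ^ j

theorem subresultant_eq_formalSubresultant (P Q : A[X]) (i : ℕ) :
    subresultant P Q i = formalSubresultant P.natDegree Q.natDegree P Q i := rfl

theorem coeff_formalSubresultant (m n : ℕ) (P Q : A[X]) (i k : ℕ) :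
    (formalSubresultant m n P Q i).coeff k =
      if k ≤ i then (subresultantMatrix m n P Q i k).det else 0 := by
  unfold formalSubresultant
  simp only [finsetSum_coeff, coeff_C_mul_X_pow]
  simp

theorem subresultantRow_map {B : Type*} [CommRing B] (φ : A →+* B) (m n : ℕ) (P Q : A[X])
    (i r : ℕ) :
    (subresultantRow m n P Q i r).map φ = subresultantRow m n (P.map φ) (Q.map φ) i r := by
  unfold subresultantRow
  split_ifs <;> simp

theorem formalSubresultant_map {B : Type*} [CommRing B] (φ : A →+* B) (m n : ℕ) (P Q : A[X])
    (i : ℕ) :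
    (formalSubresultant m n P Q i).map φ = formalSubresultant m n (P.map φ) (Q.map φ) i := by
  unfold formalSubresultant
  rw [Polynomial.map_sum]
  refine Finset.sum_congr rfl fun j _ => ?_
  rw [Polynomial.map_mul, Polynomial.map_C, Polynomial.map_pow, Polynomial.map_X, RingHom.map_det]
  congr 4
  ext r c
  simp [subresultantMatrix, ← subresultantRow_map]

theorem natDegree_subresultantRow_le {m n i : ℕ} (hi : i < n) (hnm : n < m) {P Q : A[X]}
    (hP : P.natDegree ≤ m) (hQ : Q.natDegree ≤ n) {r : ℕ} (hr : r < n - i + (m - i)) :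
    (subresultantRow m n P Q i r).natDegree ≤ n - i + (m - i) - 1 + i := by
  unfold subresultantRow
  split_ifs with h
  · have h1 := natDegree_mul_le (p := (X ^ (n - i - 1 - r) : A[X])) (q := P)
    have h2 := natDegree_X_pow_le (R := A) (n - i - 1 - r)
    omega
  · have h1 := natDegree_mul_le (p := (X ^ (m - i - 1 - (r - (n - i))) : A[X])) (q := Q)
    have h2 := natDegree_X_pow_le (R := A) (m - i - 1 - (r - (n - i)))
    omega

/-- Expanding the determinants along the last column exhibits the subresultant as a linear
combination of the rows: the coefficients of degree above `i` of this combination are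
determinants with two equal columns. -/
theorem formalSubresultant_eq_sum {m n i : ℕ} (hi : i < n) (hnm : n < m) {P Q : A[X]}
    (hP : P.natDegree ≤ m) (hQ : Q.natDegree ≤ n) :
    ∃ w : Fin (n - i + (m - i)) → A,
      formalSubresultant m n P Q i = ∑ r, C (w r) * subresultantRow m n P Q i r := by
  set M := subresultantMatrix m n P Q i 0 with hM
  let l : Fin (n - i + (m - i)) := ⟨n - i + (m - i) - 1, by omega⟩
  have key : ∀ b : Fin (n - i + (m - i)) → A,
      (M.updateCol l b).det = ∑ r, M.cramer (Pi.single r 1) l * b r := by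
    intro b
    rw [← Matrix.cramer_apply]
    conv_lhs => rw [← Finset.univ_sum_single b]
    rw [map_sum, Finset.sum_apply]
    refine Finset.sum_congr rfl fun r _ => ?_
    have : (Pi.single r (b r) : Fin (n - i + (m - i)) → A) = b r • Pi.single r 1 := by
      rw [← Pi.single_smul, smul_eq_mul, mul_one]
    rw [this, map_smul, Pi.smul_apply, smul_eq_mul, mul_comm]
  refine ⟨fun r => M.cramer (Pi.single r 1) l, ?_⟩
  ext k
  rw [coeff_formalSubresultant, finsetSum_coeff]
  simp only [coeff_C_mul]
  rw [← key fun r => (subresultantRow m n P Q i r).coeff k]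
  split_ifs with hk
  · congr 1
    ext r c
    by_cases hc : c = l
    · subst hc
      rw [Matrix.updateCol_self]
      simp only [subresultantMatrix, Matrix.of_apply]
      rw [if_pos]
      show n - i + (m - i) - 1 + 1 = _
      omega
    · rw [Matrix.updateCol_ne hc]
      have hc' : (c : ℕ) + 1 ≠ n - i + (m - i) := by
        intro h
        exact hc (Fin.ext (by show (c : ℕ) = n - i + (m - i) - 1; omega))
      simp only [hM, subresultantMatrix, Matrix.of_apply, if_neg hc']
  · symm
    by_cases hk' : k ≤ n - i + (m - i) - 1 + i
    · let c : Fin (n - i + (m - i)) := ⟨n - i + (m - i) - 1 + i - k, by omega⟩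
      have hcl : c ≠ l := by
        intro h
        have : n - i + (m - i) - 1 + i - k = n - i + (m - i) - 1 := congrArg Fin.val h
        omega
      refine Matrix.det_zero_of_column_eq hcl fun r => ?_
      rw [Matrix.updateCol_self, Matrix.updateCol_ne hcl]
      simp only [hM, subresultantMatrix, Matrix.of_apply]
      have hc1 : ¬ ((c : ℕ) + 1 = n - i + (m - i)) := by
        show ¬ (n - i + (m - i) - 1 + i - k + 1 = n - i + (m - i))
        omega
      rw [if_neg hc1]
      congr 1
      show n - i + (m - i) - 1 - (n - i + (m - i) - 1 + i - k) + i = k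
      omega
    · have hz : (fun r : Fin (n - i + (m - i)) => (subresultantRow m n P Q i r).coeff k) = 0 := by
        ext r
        refine coeff_eq_zero_of_natDegree_lt ?_
        exact (natDegree_subresultantRow_le hi hnm hP hQ r.2).trans_lt (not_le.1 hk')
      rw [hz]
      refine Matrix.det_eq_zero_of_column_eq_zero l fun r => ?_
      rw [Matrix.updateCol_self]
      rfl

theorem dvd_formalSubresultant {m n i : ℕ} (hi : i < n) (hnm : n < m) {P Q D : A[X]}
    (hP : P.natDegree ≤ m) (hQ : Q.natDegree ≤ n) (hDP : D ∣ P) (hDQ : D ∣ Q) :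
    D ∣ formalSubresultant m n P Q i := by
  obtain ⟨w, hw⟩ := formalSubresultant_eq_sum hi hnm hP hQ
  rw [hw]
  refine Finset.dvd_sum fun r _ => Dvd.dvd.mul_left ?_ _
  unfold subresultantRow
  split_ifs
  · exact hDP.mul_left _
  · exact hDQ.mul_left _

/-- At the degree `d` of a greatest common divisor the principal subresultant coefficient does
not vanish: a relation between the rows of its matrix would be a combination `U * P + V * Q`
divisible by the greatest common divisor and of degree less than `d`, hence a syzygy of `P` and
`Q` with `V` of too small degree. -/
theorem coeff_formalSubresultant_gcd_ne_zero {K : Type*} [Field K] [DecidableEq K] {m n : ℕ}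
    (hnm : n < m) {P Q : K[X]} (hP : P.natDegree = m) (hQ : Q.natDegree ≤ n)
    (hd : (EuclideanDomain.gcd P Q).natDegree < n) :
    (formalSubresultant m n P Q (EuclideanDomain.gcd P Q).natDegree).coeff
      (EuclideanDomain.gcd P Q).natDegree ≠ 0 := by
  set g := EuclideanDomain.gcd P Q with hg
  set d := g.natDegree with hdd
  rw [coeff_formalSubresultant, if_pos le_rfl]
  intro hdet
  obtain ⟨v, hv0, hv⟩ := Matrix.exists_vecMul_eq_zero_iff.2 hdet
  have hP0 : P ≠ 0 := by
    rintro rfl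
    rw [natDegree_zero] at hP
    omega
  have hg0 : g ≠ 0 := fun h => hP0 ((EuclideanDomain.gcd_eq_zero_iff.1 h).1)
  let N := n - d + (m - d)
  let W : K[X] := ∑ r : Fin N, C (v r) * subresultantRow m n P Q d r
  let U : K[X] := ∑ r : Fin N, if (r : ℕ) < n - d then C (v r) * X ^ (n - d - 1 - r) else 0
  let V : K[X] := ∑ r : Fin N, if (r : ℕ) < n - d then 0
    else C (v r) * X ^ (m - d - 1 - (r - (n - d)))
  have hW : W = U * P + V * Q := by
    simp only [W, U, V, Finset.sum_mul, ← Finset.sum_add_distrib]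
    refine Finset.sum_congr rfl fun r _ => ?_
    unfold subresultantRow
    split_ifs <;> ring
  have hWdeg : W.natDegree ≤ N - 1 + d := by
    refine natDegree_sum_le_of_forall_le _ _ fun r _ => ?_
    have h1 := natDegree_C_mul_le (v r) (subresultantRow m n P Q d r)
    have h2 := natDegree_subresultantRow_le hd hnm hP.le hQ r.2
    exact h1.trans h2
  have hWc : ∀ k, d ≤ k → W.coeff k = 0 := by
    intro k hk
    by_cases hk' : k ≤ N - 1 + d
    · have h1 := congrFun hv ⟨N - 1 + d - k, by omega⟩
      rw [Matrix.vecMul, dotProduct, Pi.zero_apply] at h1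
      rw [← h1, finsetSum_coeff]
      refine Finset.sum_congr rfl fun r _ => ?_
      rw [coeff_C_mul]
      simp only [subresultantMatrix, Matrix.of_apply]
      congr 2
      change k = if N - 1 + d - k + 1 = N then d else N - 1 - (N - 1 + d - k) + d
      split_ifs <;> omega
    · exact coeff_eq_zero_of_natDegree_lt (by omega)
  have hW0 : W = 0 := by
    by_contra hne
    have h1 : g ∣ W := by
      rw [hW]
      exact dvd_add ((EuclideanDomain.gcd_dvd_left P Q).mul_left _)
        ((EuclideanDomain.gcd_dvd_right P Q).mul_left _)
    have h2 := natDegree_le_of_dvd h1 hne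
    exact hne (leadingCoeff_eq_zero.1 (hWc _ h2))
  obtain ⟨P', hP'⟩ := EuclideanDomain.gcd_dvd_left P Q
  obtain ⟨Q', hQ'⟩ := EuclideanDomain.gcd_dvd_right P Q
  rw [← hg] at hP' hQ'
  have hP'0 : P' ≠ 0 := by
    rintro rfl
    exact hP0 (by rw [hP', mul_zero])
  have hcop : IsCoprime P' Q' := by
    have h1 := EuclideanDomain.gcd_eq_gcd_ab P Q
    rw [← hg] at h1
    refine ⟨EuclideanDomain.gcdA P Q, EuclideanDomain.gcdB P Q, mul_left_cancel₀ hg0 ?_⟩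
    calc g * (EuclideanDomain.gcdA P Q * P' + EuclideanDomain.gcdB P Q * Q')
        = (g * P') * EuclideanDomain.gcdA P Q + (g * Q') * EuclideanDomain.gcdB P Q := by ring
      _ = g * 1 := by rw [← hP', ← hQ', ← h1, mul_one]
  have hrel : U * P' + V * Q' = 0 := by
    refine mul_left_cancel₀ hg0 ?_
    calc g * (U * P' + V * Q') = U * (g * P') + V * (g * Q') := by ring
      _ = g * 0 := by rw [← hP', ← hQ', ← hW, hW0, mul_zero]
  have hdP' : P'.natDegree = m - d := by
    have h1 := congrArg natDegree hP'
    rw [natDegree_mul hg0 hP'0, hP] at h1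
    omega
  have hV0 : V = 0 := by
    by_contra hne
    have h1 : P' ∣ V * Q' := ⟨-U, by linear_combination hrel⟩
    have h2 := natDegree_le_of_dvd (hcop.dvd_of_dvd_mul_right h1) hne
    have h3 : V.natDegree ≤ m - d - 1 := by
      refine natDegree_sum_le_of_forall_le _ _ fun r _ => ?_
      split_ifs
      · simp
      · have h4 := natDegree_C_mul_X_pow_le (v r) (m - d - 1 - (r - (n - d)))
        omega
    omega
  have hU0 : U = 0 := by
    rw [hV0, zero_mul, add_zero] at hrel
    exact (mul_eq_zero.1 hrel).resolve_right hP'0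
  apply hv0
  ext r
  by_cases hr : (r : ℕ) < n - d
  · have h1 := congrArg (fun f => coeff f (n - d - 1 - r)) hU0
    simp only [U, finsetSum_coeff, coeff_zero] at h1
    rw [Finset.sum_eq_single r] at h1
    · simpa [hr] using h1
    · intro s _ hs
      have hs' : (s : ℕ) ≠ r := fun h => hs (Fin.ext h)
      split_ifs with h
      · rw [coeff_C_mul_X_pow, if_neg]
        omega
      · exact coeff_zero _
    · simp
  · have h1 := congrArg (fun f => coeff f (m - d - 1 - (r - (n - d)))) hV0
    simp only [V, finsetSum_coeff, coeff_zero] at h1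
    rw [Finset.sum_eq_single r] at h1
    · simpa [hr] using h1
    · intro s _ hs
      have hs' : (s : ℕ) ≠ r := fun h => hs (Fin.ext h)
      have := s.2
      have := r.2
      split_ifs with h
      · exact coeff_zero _
      · rw [coeff_C_mul_X_pow, if_neg]
        omega
    · simp

end Subresultants

/-! ### Greatest common divisors and square-free quotients over a field -/

section Gcd

open Polynomial

/-- `G` is a greatest common divisor of `P` and `Q`. -/
structure IsGcd {K : Type*} [CommRing K] (G P Q : K[X]) : Prop where
  dvd_left : G ∣ P
  dvd_right : G ∣ Q
  dvd : ∀ D, D ∣ P → D ∣ Q → D ∣ G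

/-- If the principal subresultant coefficients below `i` vanish, then the greatest common divisor
has degree at least `i`. -/
theorem le_natDegree_gcd {K : Type*} [Field K] [DecidableEq K] {m n i : ℕ} (hnm : n < m)
    (hin : i ≤ n) {P Q : K[X]} (hP : P.natDegree = m) (hQ : Q.natDegree ≤ n)
    (h : ∀ j < i, (formalSubresultant m n P Q j).coeff j = 0) :
    i ≤ (EuclideanDomain.gcd P Q).natDegree := by
  by_contra hlt
  rw [not_le] at hlt
  exact coeff_formalSubresultant_gcd_ne_zero hnm hP hQ (hlt.trans_le hin) (h _ hlt)

/-- The first subresultant whose principal coefficient does not vanish is a greatest common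
divisor. -/
theorem isGcd_formalSubresultant {K : Type*} [Field K] {m n i : ℕ} (hnm : n < m)
    (hin : i < n) {P Q : K[X]} (hP : P.natDegree = m) (hQ : Q.natDegree ≤ n)
    (h : ∀ j < i, (formalSubresultant m n P Q j).coeff j = 0)
    (hi : (formalSubresultant m n P Q i).coeff i ≠ 0) :
    IsGcd (formalSubresultant m n P Q i) P Q ∧ (formalSubresultant m n P Q i).natDegree = i := by
  classical
  set S := formalSubresultant m n P Q i with hS
  have hdeg : S.natDegree = i := by
    refine le_antisymm (natDegree_le_iff_coeff_eq_zero.2 fun k hk => ?_)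
      (le_natDegree_of_ne_zero hi)
    rw [hS, coeff_formalSubresultant, if_neg (not_le.2 hk)]
  have hS0 : S ≠ 0 := by
    intro h0
    rw [h0, coeff_zero] at hi
    exact hi rfl
  have h1 : EuclideanDomain.gcd P Q ∣ S :=
    dvd_formalSubresultant hin hnm hP.le hQ (EuclideanDomain.gcd_dvd_left P Q)
      (EuclideanDomain.gcd_dvd_right P Q)
  have h2 := le_natDegree_gcd hnm hin.le hP hQ h
  have h3 : S ∣ EuclideanDomain.gcd P Q := by
    obtain ⟨c, hc⟩ := h1
    have hg0 : EuclideanDomain.gcd P Q ≠ 0 := by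
      intro h0
      rw [h0, zero_mul] at hc
      exact hS0 hc
    have hc0 : c ≠ 0 := by
      rintro rfl
      rw [mul_zero] at hc
      exact hS0 hc
    have h4 := congrArg natDegree hc
    rw [natDegree_mul hg0 hc0] at h4
    have h5 : c.natDegree = 0 := by omega
    have h6 : IsUnit c := by
      rw [eq_C_of_natDegree_eq_zero h5] at hc0 ⊢
      exact isUnit_C.2 (isUnit_iff_ne_zero.2 fun h => hc0 (by rw [h, C_0]))
    rw [hc]
    exact h6.mul_right_dvd.2 dvd_rfl
  exact ⟨⟨h3.trans (EuclideanDomain.gcd_dvd_left P Q), h3.trans (EuclideanDomain.gcd_dvd_right P Q),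
    fun D hD1 hD2 => (EuclideanDomain.dvd_gcd hD1 hD2).trans h1⟩, hdeg⟩

variable {K : Type*} [Field K]

theorem squarefree_of_forall_root [IsAlgClosed K] {P : K[X]} (hP : ∀ α, ¬ (X - C α) ^ 2 ∣ P) :
    Squarefree P := by
  intro h hh
  by_contra hu
  have hd : h.degree ≠ 0 := fun h0 => hu (isUnit_iff_degree_eq_zero.2 h0)
  obtain ⟨α, hα⟩ := IsAlgClosed.exists_root h hd
  refine hP α ?_
  rw [sq]
  exact (mul_dvd_mul (dvd_iff_isRoot.2 hα) (dvd_iff_isRoot.2 hα)).trans hh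

theorem IsGcd.eval_eq_zero_iff {G P Q : K[X]} (hG : IsGcd G P Q) (α : K) :
    G.eval α = 0 ↔ P.eval α = 0 ∧ Q.eval α = 0 := by
  constructor
  · exact fun h => ⟨eval_eq_zero_of_dvd_of_eval_eq_zero hG.dvd_left h,
      eval_eq_zero_of_dvd_of_eval_eq_zero hG.dvd_right h⟩
  · rintro ⟨h1, h2⟩
    exact dvd_iff_isRoot.1 (hG.dvd _ (dvd_iff_isRoot.2 h1) (dvd_iff_isRoot.2 h2))

/-- The quotient of a square-free polynomial by its greatest common divisor with `Q` has the
roots that are not roots of `Q`. -/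
theorem eval_quotient_eq_zero_iff {μ : K} (hμ : μ ≠ 0) {A G P Q : K[X]} (hP : Squarefree P)
    (hG : IsGcd G P Q) (hA : C μ * P = A * G) (α : K) :
    A.eval α = 0 ↔ P.eval α = 0 ∧ Q.eval α ≠ 0 := by
  have he : μ * P.eval α = A.eval α * G.eval α := by
    have := congrArg (eval α) hA
    simpa using this
  constructor
  · intro h
    have hPα : P.eval α = 0 := by
      rw [h, zero_mul] at he
      exact (mul_eq_zero.1 he).resolve_left hμ
    refine ⟨hPα, fun hQ => ?_⟩
    have h1 : X - C α ∣ A := dvd_iff_isRoot.2 h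
    have h2 : X - C α ∣ G := dvd_iff_isRoot.2 ((hG.eval_eq_zero_iff α).2 ⟨hPα, hQ⟩)
    have h3 : (X - C α) * (X - C α) ∣ P := by
      have h4 := mul_dvd_mul h1 h2
      rw [← hA] at h4
      exact ((isUnit_C.2 (isUnit_iff_ne_zero.2 hμ)).dvd_mul_left).1 h4
    exact (irreducible_X_sub_C α).not_isUnit (hP _ h3)
  · rintro ⟨h1, h2⟩
    rw [h1, mul_zero] at he
    refine (mul_eq_zero.1 he.symm).resolve_right fun h => h2 ?_
    exact ((hG.eval_eq_zero_iff α).1 h).2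

theorem squarefree_quotient {μ : K} (hμ : μ ≠ 0) {A G P : K[X]} (hP : Squarefree P)
    (hA : C μ * P = A * G) : Squarefree A := by
  refine hP.squarefree_of_dvd ?_
  refine ((isUnit_C.2 (isUnit_iff_ne_zero.2 hμ)).dvd_mul_left).1 ?_
  rw [hA]
  exact dvd_mul_right _ _

/-- The quotient of `P` by the greatest common divisor of `P` and its derivative is
square-free. -/
theorem squarefree_quotient_derivative [IsAlgClosed K] {μ : K} (hμ : μ ≠ 0) {A G P : K[X]}
    (hP : P ≠ 0) (hG : IsGcd G P (derivative P)) (hA : C μ * P = A * G) : Squarefree A := by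
  refine squarefree_of_forall_root fun α h => ?_
  have h1 : (X - C α) ^ P.rootMultiplicity α ∣ P := pow_rootMultiplicity_dvd P α
  have h2 : (X - C α) ^ (P.rootMultiplicity α - 1) ∣ G :=
    hG.dvd _ ((pow_dvd_pow _ (Nat.sub_le _ _)).trans h1)
      (pow_sub_one_dvd_derivative_of_pow_dvd h1)
  have h3 := mul_dvd_mul h h2
  rw [← hA, (isUnit_C.2 (isUnit_iff_ne_zero.2 hμ)).dvd_mul_left, ← pow_add] at h3
  have h4 := (le_rootMultiplicity_iff hP).2 h3
  omega

/-- In characteristic zero, dividing `P` by the greatest common divisor of `P` and its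
derivative does not lose roots, as the derivative has every root with smaller multiplicity. -/
theorem eval_quotient_derivative_eq_zero_iff [CharZero K] {μ : K} (hμ : μ ≠ 0) {A G P : K[X]}
    (hP : P ≠ 0) (hG : IsGcd G P (derivative P)) (hA : C μ * P = A * G) (α : K) :
    A.eval α = 0 ↔ P.eval α = 0 := by
  have he : μ * P.eval α = A.eval α * G.eval α := by
    have := congrArg (eval α) hA
    simpa using this
  constructor
  · intro h
    rw [h, zero_mul] at he
    exact (mul_eq_zero.1 he).resolve_left hμ
  · intro h
    by_contra hne
    have hμP : C μ * P ≠ 0 := mul_ne_zero (by simpa using hμ) hP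
    have hAG : A * G ≠ 0 := hA ▸ hμP
    have hA0 : A ≠ 0 := left_ne_zero_of_mul hAG
    have hG0 : G ≠ 0 := right_ne_zero_of_mul hAG
    have hmA : A.rootMultiplicity α = 0 := rootMultiplicity_eq_zero hne
    have h1 := rootMultiplicity_mul (x := α) hAG
    have h2 := rootMultiplicity_mul (x := α) hμP
    rw [rootMultiplicity_C, zero_add, hA, h1, hmA, zero_add] at h2
    have h3 := derivative_rootMultiplicity_of_root h
    have h4 : 0 < P.rootMultiplicity α := (rootMultiplicity_pos hP).2 h
    have hP' : derivative P ≠ 0 := by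
      intro h0
      have h5 := natDegree_derivative P
      rw [h0, natDegree_zero] at h5
      have h6 : (X - C α) ^ P.rootMultiplicity α ∣ P := pow_rootMultiplicity_dvd P α
      have h7 : P.natDegree ≠ 0 := by
        intro h8
        rw [eq_C_of_natDegree_eq_zero h8, eval_C] at h
        apply hP
        rw [eq_C_of_natDegree_eq_zero h8, h, C_0]
      have h9 : P.natDegree = 1 := by omega
      have h10 := congrArg (fun f => coeff f 0) h0
      simp only [coeff_derivative, coeff_zero, zero_add, Nat.cast_zero, mul_one] at h10
      rw [← h9, coeff_natDegree] at h10
      exact hP (leadingCoeff_eq_zero.1 h10)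
    have h5 : P.rootMultiplicity α ≤ (derivative P).rootMultiplicity α := by
      rw [← h2, le_rootMultiplicity_iff hP']
      exact (pow_rootMultiplicity_dvd G α).trans hG.dvd_right
    omega

theorem squarefree_mul_of_no_common_root [IsAlgClosed K] {P Q : K[X]} (hP : Squarefree P)
    (hQ : Squarefree Q) (h : ∀ α, P.eval α = 0 → Q.eval α ≠ 0) : Squarefree (P * Q) := by
  have hcop : IsCoprime P Q := by
    rw [isCoprime_iff_aeval_ne_zero_of_isAlgClosed K K]
    intro α
    by_contra! hα
    simp only [coe_aeval_eq_eval] at hα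
    exact h α hα.1 hα.2
  exact (squarefree_mul_iff).2 ⟨hcop.isRelPrime, hP, hQ⟩

end Gcd

/-! ### The polynomial remainder sequence and its specialization -/

section Fibres

open MvPolynomial

variable {F : Type u} [Field F] {σ : Type v} [LinearOrder σ]

theorem det_mem_subalgebra {R A ι : Type*} [CommRing R] [CommRing A] [Algebra R A] [Fintype ι]
    [DecidableEq ι] (S : Subalgebra R A) (M : Matrix ι ι A) (h : ∀ i j, M i j ∈ S) :
    M.det ∈ S := by
  rw [Matrix.det_apply]
  refine sum_mem fun τ _ => ?_
  rw [Units.smul_def]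
  exact zsmul_mem (prod_mem fun i _ => h _ _) _

theorem coeff_subresultant_mem {x : σ} {p q : MvPolynomial σ F} (hp : leader p ≤ x)
    (hq : leader q ≤ x) (i k : ℕ) :
    (subresultant (uni x p) (uni x q) i).coeff k ∈ supported F (Set.Iio x) := by
  rw [subresultant_eq_formalSubresultant, coeff_formalSubresultant]
  split_ifs
  · refine det_mem_subalgebra _ _ fun r c => ?_
    simp only [subresultantMatrix, Matrix.of_apply, subresultantRow]
    split_ifs
    all_goals
      rw [Polynomial.coeff_X_pow_mul']
      split_ifs
      · first
          | exact coeff_uni_mem x p ((leader_le_iff x p).1 hp) _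
          | exact coeff_uni_mem x q ((leader_le_iff x q).1 hq) _
      · exact zero_mem _
  · exact zero_mem _

theorem natDegree_subresultant {A : Type*} [CommRing A] {P Q : Polynomial A} {i : ℕ}
    (h : (subresultant P Q i).coeff i ≠ 0) : (subresultant P Q i).natDegree = i := by
  refine le_antisymm (Polynomial.natDegree_le_iff_coeff_eq_zero.2 fun k hk => ?_)
    (Polynomial.le_natDegree_of_ne_zero h)
  rw [subresultant_eq_formalSubresultant, coeff_formalSubresultant, if_neg (not_le.2 hk)]

variable {x : σ} {p q : MvPolynomial σ F} {i : ℕ}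

theorem PRS_top : PRS p q x (degX x p) = p := if_pos rfl

theorem PRS_degX_right (hd : degX x q < degX x p) : PRS p q x (degX x q) = q := by
  unfold PRS
  rw [if_neg hd.ne, if_pos rfl]

theorem PRS_of_lt (hd : degX x q < degX x p) (hi : i < degX x q)
    (h : (subresultant (uni x p) (uni x q) i).coeff i ≠ 0) :
    PRS p q x i = ofUni x (subresultant (uni x p) (uni x q) i) := by
  unfold PRS
  rw [if_neg (by omega), if_neg (by omega), if_pos ⟨hi, h⟩]

theorem PRS_of_coeff_eq_zero (hd : degX x q < degX x p) (hi : i < degX x q)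
    (h : (subresultant (uni x p) (uni x q) i).coeff i = 0) : PRS p q x i = 0 := by
  unfold PRS
  rw [if_neg (by omega), if_neg (by omega), if_neg (by tauto)]

theorem res_top : res p q x (degX x p) = 1 := if_pos rfl

/-- Below the degree of `q`, `res` is the principal subresultant coefficient. -/
theorem res_of_lt (hp : leader p ≤ x) (hq : leader q ≤ x) (hd : degX x q < degX x p)
    (hi : i < degX x q) :
    res p q x i = (subresultant (uni x p) (uni x q) i).coeff i := by
  have hmem := coeff_subresultant_mem hp hq i
  unfold res
  rw [if_neg (by omega)]
  by_cases h : (subresultant (uni x p) (uni x q) i).coeff i = 0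
  · split_ifs with h0
    · subst h0
      rw [PRS_of_coeff_eq_zero hd hi h, h]
    · rw [PRS_of_coeff_eq_zero hd hi h, h, init, leader_zero]
  · split_ifs with h0
    · subst h0
      rw [PRS_of_lt hd hi h]
      conv_lhs => rw [Polynomial.eq_C_of_natDegree_eq_zero (natDegree_subresultant h)]
      simp [ofUni]
    · rw [PRS_of_lt hd hi h]
      have hu := uni_ofUni x _ hmem
      have hle := leader_ofUni_le x _ hmem
      have hl : leader (ofUni x (subresultant (uni x p) (uni x q) i)) = x := by
        rw [leader_eq_iff hle, degX, hu, natDegree_subresultant h]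
        omega
      rw [init_eq hl, hu, Polynomial.leadingCoeff, natDegree_subresultant h]

theorem res_degX_right_of_pos (hd : degX x q < degX x p) (h0 : 0 < degX x q) :
    res p q x (degX x q) = init q := by
  unfold res
  rw [if_neg hd.ne, if_neg h0.ne', PRS_degX_right hd]

theorem res_zero_of_degX_eq_zero (hd : degX x q < degX x p) (h0 : degX x q = 0) :
    res p q x 0 = q := by
  unfold res
  rw [if_neg (by omega), if_pos rfl, ← h0, PRS_degX_right hd]

theorem res_of_gt (h1 : degX x q < i) (h2 : i < degX x p) : res p q x i = 0 := by
  unfold res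
  rw [if_neg h2.ne, if_neg (by omega), PRS, if_neg h2.ne, if_neg h1.ne',
    if_neg (by omega), init, leader_zero]

/-- `res_i` does not involve `x`: it constrains the base point only. -/
theorem leader_res_lt (hp : leader p = x) (hq : leader q ≤ x) (hd : degX x q < degX x p)
    (hi : i ≤ degX x p) : leader (res p q x i) < x := by
  rcases hi.lt_or_eq with hi | rfl
  · rcases lt_trichotomy i (degX x q) with h | rfl | h
    · rw [res_of_lt hp.le hq hd h, leader_lt_iff]
      exact coeff_subresultant_mem hp.le hq i i
    · rcases Nat.eq_zero_or_pos (degX x q) with h0 | h0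
      · rw [h0, res_zero_of_degX_eq_zero hd h0]
        exact (degX_eq_zero_iff hq).1 h0
      · rw [res_degX_right_of_pos hd h0]
        have := (leader_eq_iff hq).2 h0
        exact (leader_init_lt this).trans_eq this
    · rw [res_of_gt h hi, leader_zero]
      exact WithBot.bot_lt_coe x
  · rw [res_top, leader_one]
    exact WithBot.bot_lt_coe x

/-- The regular elements of the polynomial remainder sequence: leader, degree and initial. -/
theorem PRS_of_res_ne_zero (hp : leader p = x) (hq : leader q ≤ x) (hd : degX x q < degX x p)
    (hi0 : 0 < i) (hi : i ≤ degX x p) (hr : res p q x i ≠ 0) :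
    leader (PRS p q x i) = x ∧ degX x (PRS p q x i) = i ∧
      (i < degX x p → init (PRS p q x i) = res p q x i) := by
  rcases hi.lt_or_eq with hi | rfl
  · rcases lt_trichotomy i (degX x q) with h | rfl | h
    · have hmem := coeff_subresultant_mem hp.le hq i
      have hu := uni_ofUni x _ hmem
      have hle := leader_ofUni_le x _ hmem
      have hr' := hr
      rw [res_of_lt hp.le hq hd h] at hr'
      have hdeg : degX x (ofUni x (subresultant (uni x p) (uni x q) i)) = i := by
        rw [degX, hu, natDegree_subresultant hr']
      rw [PRS_of_lt hd h hr']
      refine ⟨(leader_eq_iff hle).2 (by omega), hdeg, fun _ => ?_⟩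
      rw [res, if_neg hi.ne, if_neg hi0.ne', PRS_of_lt hd h hr']
    · rw [PRS_degX_right hd, res_degX_right_of_pos hd hi0]
      exact ⟨(leader_eq_iff hq).2 hi0, rfl, fun _ => rfl⟩
    · exact absurd (res_of_gt h hi) hr
  · rw [PRS_top]
    exact ⟨hp, rfl, fun h => absurd h (lt_irrefl _)⟩

theorem map_subresultant_uni (a : σ → AlgebraicClosure F) :
    (subresultant (uni x p) (uni x q) i).map
      (aeval a : MvPolynomial σ F →ₐ[F] AlgebraicClosure F).toRingHom =
    formalSubresultant (degX x p) (degX x q) (evalBelow x a p) (evalBelow x a q) i := by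
  rw [subresultant_eq_formalSubresultant, formalSubresultant_map, ← evalBelow_eq_map,
    ← evalBelow_eq_map]
  rfl

theorem evalAt_res_of_lt (hp : leader p ≤ x) (hq : leader q ≤ x) (hd : degX x q < degX x p)
    (hi : i < degX x q) (a : σ → AlgebraicClosure F) :
    evalAt a (res p q x i) =
      (formalSubresultant (degX x p) (degX x q) (evalBelow x a p) (evalBelow x a q) i).coeff i := by
  rw [← map_subresultant_uni, Polynomial.coeff_map, res_of_lt hp hq hd hi]
  rfl

/-- Over a point at which the initial of `p` and `res_i` do not vanish, but all `res_j` with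
`j < i` do, `PRS_i` specializes to a greatest common divisor of `p` and `q`, of degree `i`. -/
theorem isGcd_evalBelow_PRS (hp : leader p = x) (hq : leader q ≤ x) (hd : degX x q < degX x p)
    (hi : i ≤ degX x p) {a : σ → AlgebraicClosure F} (ha : evalAt a (init p) ≠ 0)
    (h0 : ∀ j < i, evalAt a (res p q x j) = 0) (hr : evalAt a (res p q x i) ≠ 0) :
    IsGcd (evalBelow x a (PRS p q x i)) (evalBelow x a p) (evalBelow x a q) ∧
      (evalBelow x a (PRS p q x i)).natDegree = i := by
  classical
  have hP : (evalBelow x a p).natDegree = degX x p := (evalAt_init_ne_zero_iff hp a).1 ha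
  have hQ := natDegree_evalBelow_le x a q
  have hc : ∀ j < i, j < degX x q → (formalSubresultant (degX x p) (degX x q) (evalBelow x a p)
      (evalBelow x a q) j).coeff j = 0 := fun j hj hj' => by
    rw [← evalAt_res_of_lt hp.le hq hd hj', h0 j hj]
  rcases lt_or_ge i (degX x q) with h | h
  · have hr0 : res p q x i ≠ 0 := by
      intro h1
      rw [h1, evalAt_zero] at hr
      exact hr rfl
    rw [res_of_lt hp.le hq hd h] at hr0
    have hPRS : evalBelow x a (PRS p q x i) = formalSubresultant (degX x p) (degX x q)
        (evalBelow x a p) (evalBelow x a q) i := by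
      rw [PRS_of_lt hd h hr0, evalBelow_eq_map,
        uni_ofUni x _ (coeff_subresultant_mem hp.le hq i), map_subresultant_uni]
    rw [hPRS]
    rw [evalAt_res_of_lt hp.le hq hd h] at hr
    exact isGcd_formalSubresultant hd h hP hQ (fun j hj => hc j hj (hj.trans h)) hr
  · have hge := le_natDegree_gcd hd le_rfl hP hQ fun j hj => hc j (hj.trans_le h) hj
    set g := EuclideanDomain.gcd (evalBelow x a p) (evalBelow x a q) with hg
    rcases h.eq_or_lt with rfl | h
    · have hQd : (evalBelow x a q).natDegree = degX x q ∧ evalBelow x a q ≠ 0 := by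
        rcases Nat.eq_zero_or_pos (degX x q) with h0 | h0
        · rw [h0, res_zero_of_degX_eq_zero hd h0] at hr
          have hl := (degX_eq_zero_iff hq).1 h0
          rw [evalBelow_of_leader_lt hl, Polynomial.natDegree_C, h0]
          exact ⟨rfl, fun h1 => hr (Polynomial.C_eq_zero.1 h1)⟩
        · rw [res_degX_right_of_pos hd h0, evalAt_init_ne_zero_iff ((leader_eq_iff hq).2 h0)] at hr
          refine ⟨hr, fun h1 => ?_⟩
          rw [h1, Polynomial.natDegree_zero] at hr
          omega
      rw [PRS_degX_right hd]
      refine ⟨⟨?_, dvd_rfl, fun D _ h2 => h2⟩, hQd.1⟩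
      have h1 : g ∣ evalBelow x a q := EuclideanDomain.gcd_dvd_right _ _
      have h2 := Polynomial.associated_of_dvd_of_natDegree_le h1 hQd.2 (by omega)
      exact h2.symm.dvd.trans (EuclideanDomain.gcd_dvd_left _ _)
    · rcases hi.lt_or_eq with hi | rfl
      · rw [res_of_gt h hi, evalAt_zero] at hr
        exact absurd rfl hr
      · rw [PRS_top]
        refine ⟨⟨dvd_rfl, ?_, fun D h1 _ => h1⟩, hP⟩
        have hQ0 : evalBelow x a q = 0 := by
          by_contra hne
          have h1 : g ∣ evalBelow x a q := EuclideanDomain.gcd_dvd_right _ _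
          have h2 := Polynomial.natDegree_le_of_dvd h1 hne
          have h3 : (evalBelow x a q).natDegree = degX x q := by omega
          have h4 := h0 _ h
          rcases Nat.eq_zero_or_pos (degX x q) with h5 | h5
          · rw [h5, res_zero_of_degX_eq_zero hd h5] at h4
            rw [evalBelow_of_leader_lt ((degX_eq_zero_iff hq).1 h5), h4, Polynomial.C_0] at hne
            exact hne rfl
          · rw [res_degX_right_of_pos hd h5] at h4
            exact (evalAt_init_ne_zero_iff ((leader_eq_iff hq).2 h5) a).2 h3 h4
        rw [hQ0]
        exact dvd_zero _

end Fibres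

/-! ### Pseudo quotients -/

section PseudoQuotients

open MvPolynomial

variable {F : Type u} [Field F] {σ : Type v} [LinearOrder σ]

/-- Applying `killAbove` to the pseudo division identity and comparing degrees shows that the
pseudo quotient does not involve indeterminates above `x`. -/
theorem leader_pquo_le (pd : PseudoDivision F σ) {p q : MvPolynomial σ F} {x : σ}
    (hp : leader p = x) (hq : leader q = x) : leader (pd.pquo p q x) ≤ x := by
  obtain ⟨m, k, -, hm, he, hd⟩ := pd.spec p q x hp hq
  have hB := leader_prem_le pd hp hq
  set A := pd.pquo p q x
  set B := pd.prem p q x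
  have h1 := congrArg (killAbove x) he
  rw [map_mul, map_add, map_mul, killAbove_eq x m ((leader_le_iff x m).1 hm.le),
    killAbove_eq x p ((leader_le_iff x p).1 hp.le),
    killAbove_eq x q ((leader_le_iff x q).1 hq.le),
    killAbove_eq x B ((leader_le_iff x B).1 hB), he] at h1
  have h2 : A = killAbove x A :=
    mul_right_cancel₀ (ne_zero_of_leader hq) (add_right_cancel h1)
  rw [leader_le_iff, h2]
  exact killAbove_mem x A

theorem degX_eq_zero_of_leader_lt {x : σ} {m : MvPolynomial σ F} (h : leader m < x) :
    degX x m = 0 := (degX_eq_zero_iff h.le).2 h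

/-- Comparison of degrees in the pseudo division identity. -/
theorem pquo_spec (pd : PseudoDivision F σ) {p q : MvPolynomial σ F} {x : σ}
    (hp : leader p = x) (hq : leader q = x) (hpq : degX x q ≤ degX x p) :
    pd.pquo p q x ≠ 0 ∧ degX x (pd.pquo p q x) = degX x p - degX x q := by
  obtain ⟨m, k, hmk, hm, he, hd⟩ := pd.spec p q x hp hq
  have hq0 := ne_zero_of_leader hq
  have hp0 := ne_zero_of_leader hp
  have hm0 : m ≠ 0 := by
    rintro rfl
    exact pow_ne_zero k (init_ne_zero hq0) (zero_dvd_iff.1 hmk)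
  have h1 : degX x (m * p) = degX x p := by
    rw [degX_mul hm0 hp0, degX_eq_zero_of_leader_lt hm, zero_add]
  have hA0 : pd.pquo p q x ≠ 0 := by
    intro h0
    rw [h0, zero_mul, zero_add] at he
    rw [he] at h1
    omega
  refine ⟨hA0, ?_⟩
  have h2 : degX x (pd.pquo p q x * q) = degX x p := by
    rw [← h1, he]
    unfold degX
    rw [map_add]
    refine (Polynomial.natDegree_add_eq_left_of_natDegree_lt ?_).symm
    have h3 := degX_mul (x := x) hA0 hq0
    unfold degX at h3 hd
    omega
  rw [degX_mul hA0 hq0] at h2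
  omega

/-- In a fibre in which `q` divides `p`, the pseudo quotient is the quotient up to a nonzero
constant: the pseudo remainder is divisible by `q` and of smaller degree. -/
theorem evalBelow_pquo (pd : PseudoDivision F σ) {p q : MvPolynomial σ F} {x : σ}
    (hp : leader p = x) (hq : leader q = x) {a : σ → AlgebraicClosure F}
    (ha : evalAt a (init q) ≠ 0) (hdvd : evalBelow x a q ∣ evalBelow x a p) :
    ∃ μ : AlgebraicClosure F, μ ≠ 0 ∧
      Polynomial.C μ * evalBelow x a p = evalBelow x a (pd.pquo p q x) * evalBelow x a q := by
  obtain ⟨m, k, hmk, hm, he, hd⟩ := pd.spec p q x hp hq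
  refine ⟨evalAt a m, evalAt_ne_zero_of_dvd_pow hmk ha, ?_⟩
  have h1 := congrArg (evalBelow x a) he
  rw [evalBelow_mul, evalBelow_add, evalBelow_mul, evalBelow_of_leader_lt hm] at h1
  have h2 : evalBelow x a q ∣ evalBelow x a (pd.prem p q x) := by
    have h3 : evalBelow x a (pd.prem p q x) = Polynomial.C (evalAt a m) * evalBelow x a p -
        evalBelow x a (pd.pquo p q x) * evalBelow x a q := by
      rw [h1]
      ring
    rw [h3]
    exact dvd_sub (hdvd.mul_left _) (dvd_mul_left _ _)
  have h4 : evalBelow x a (pd.prem p q x) = 0 := by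
    by_contra hne
    have h5 := Polynomial.natDegree_le_of_dvd h2 hne
    rw [(evalAt_init_ne_zero_iff hq a).1 ha] at h5
    have := natDegree_evalBelow_le x a (pd.prem p q x)
    omega
  rw [h1, h4, add_zero]

/-- The polynomial returned by a splitting algorithm: the quotient of `p` by the `i`-th element
of the polynomial remainder sequence of `p` and `q`. -/
noncomputable def splitQuotient (pd : PseudoDivision F σ) (p q : MvPolynomial σ F) (x : σ)
    (i : ℕ) : MvPolynomial σ F :=
  if 0 < i then pd.pquo p (PRS p q x i) x else p

variable {x : σ} {p q : MvPolynomial σ F} {i : ℕ}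

/-- Leader and degree of the quotient, as formal polynomials. If `i` is the degree of `p`, the
quotient does not involve `x`, so only a bound holds for its leader. -/
theorem splitQuotient_spec (pd : PseudoDivision F σ) (hp : leader p = x) (hq : leader q ≤ x)
    (hd : degX x q < degX x p) (hi : i ≤ degX x p) (hr : res p q x i ≠ 0) :
    leader (splitQuotient pd p q x i) ≤ x ∧ splitQuotient pd p q x i ≠ 0 ∧
      degX x (splitQuotient pd p q x i) = degX x p - i := by
  unfold splitQuotient
  split_ifs with h0
  · obtain ⟨h1, h2, -⟩ := PRS_of_res_ne_zero hp hq hd h0 hi hr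
    obtain ⟨h3, h4⟩ := pquo_spec pd hp h1 (h2.trans_le hi)
    exact ⟨leader_pquo_le pd hp h1, h3, by rw [h4, h2]⟩
  · refine ⟨hp.le, ne_zero_of_leader hp, ?_⟩
    omega

/-- In a fibre where `res_i` is the first of the `res_j` that does not vanish, the returned
polynomial is, up to a nonzero constant, the quotient of `p` by a greatest common divisor of `p`
and `q`, and its degree does not drop. -/
theorem evalBelow_splitQuotient (pd : PseudoDivision F σ) (hp : leader p = x)
    (hq : leader q ≤ x) (hd : degX x q < degX x p) (hi : i ≤ degX x p)
    {a : σ → AlgebraicClosure F} (ha : evalAt a (init p) ≠ 0)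
    (h0 : ∀ j < i, evalAt a (res p q x j) = 0) (hr : evalAt a (res p q x i) ≠ 0) :
    ∃ (μ : AlgebraicClosure F) (G : Polynomial (AlgebraicClosure F)), μ ≠ 0 ∧
      IsGcd G (evalBelow x a p) (evalBelow x a q) ∧
      Polynomial.C μ * evalBelow x a p = evalBelow x a (splitQuotient pd p q x i) * G ∧
      (evalBelow x a (splitQuotient pd p q x i)).natDegree =
        degX x (splitQuotient pd p q x i) := by
  obtain ⟨hG, hdeg⟩ := isGcd_evalBelow_PRS hp hq hd hi ha h0 hr
  have hP := (evalAt_init_ne_zero_iff hp a).1 ha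
  have hP0 : evalBelow x a p ≠ 0 := by
    intro h
    rw [h, Polynomial.natDegree_zero] at hP
    omega
  have hr0 : res p q x i ≠ 0 := by
    intro h
    rw [h, evalAt_zero] at hr
    exact hr rfl
  have hdA := (splitQuotient_spec pd hp hq hd hi hr0).2.2
  have main : ∃ μ : AlgebraicClosure F, μ ≠ 0 ∧ Polynomial.C μ * evalBelow x a p =
      evalBelow x a (splitQuotient pd p q x i) * evalBelow x a (PRS p q x i) := by
    rcases Nat.eq_zero_or_pos i with h | h
    · subst h
      obtain ⟨c, hc⟩ : ∃ c, evalBelow x a (PRS p q x 0) = Polynomial.C c :=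
        ⟨_, Polynomial.eq_C_of_natDegree_eq_zero hdeg⟩
      refine ⟨c, ?_, ?_⟩
      · rintro rfl
        rw [hc, Polynomial.C_0] at hG
        exact hP0 (zero_dvd_iff.1 hG.dvd_left)
      · rw [hc, splitQuotient, if_neg (lt_irrefl 0), mul_comm]
    · obtain ⟨h1, h2, h3⟩ := PRS_of_res_ne_zero hp hq hd h hi hr0
      rw [splitQuotient, if_pos h]
      refine evalBelow_pquo pd hp h1 ?_ hG.dvd_left
      rw [evalAt_init_ne_zero_iff h1, hdeg, h2]
  obtain ⟨μ, hμ, he⟩ := main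
  refine ⟨μ, _, hμ, hG, he, ?_⟩
  have h1 : Polynomial.C μ * evalBelow x a p ≠ 0 := mul_ne_zero (by simpa using hμ) hP0
  have h2 := congrArg Polynomial.natDegree he
  rw [Polynomial.natDegree_C_mul hμ,
    Polynomial.natDegree_mul (left_ne_zero_of_mul (he ▸ h1)) (right_ne_zero_of_mul (he ▸ h1)),
    hP, hdeg] at h2
  omega

end PseudoQuotients

/-! ### Reduction modulo a triangular system -/

section Reduction

open MvPolynomial

variable {F : Type u} [Field F] {σ : Type v} [LinearOrder σ]

theorem IsTriangular.eq_of_leader {T : AlgSystem F σ} (hT : IsTriangular T) {x : σ}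
    {c d : Constraint F σ} (hc : c ∈ T) (hd : d ∈ T) (hcx : leader c.poly = x)
    (hdx : leader d.poly = x) : c = d := by
  classical
  refine Finset.card_le_one.1 (hT.1 x) c ?_ d ?_ <;> simp [atLeader, *]

theorem IsTriangular.mono {T T' : AlgSystem F σ} (hT : IsTriangular T) (h : T' ⊆ T) :
    IsTriangular T' := by
  classical
  refine ⟨fun y => (Finset.card_le_card ?_).trans (hT.1 y),
    fun k => ⟨fun h' => (hT.2 k).1 (h h'), fun h' => (hT.2 k).2 (h h')⟩⟩
  exact Finset.filter_subset_filter _ h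

theorem mem_of_slot {T : AlgSystem F σ} {x : σ} {c : Constraint F σ}
    (h : slot T x = some c) : c ∈ T := by
  unfold slot at h
  split_ifs at h with h'
  obtain rfl := Option.some.inj h
  exact h'.choose_spec.1

theorem slot_eq_some_iff {T : AlgSystem F σ} (hT : IsTriangular T) {x : σ}
    {c : Constraint F σ} : slot T x = some c ↔ c ∈ T ∧ leader c.poly = x := by
  refine ⟨fun h => ⟨mem_of_slot h, leader_of_slot h⟩, fun h => ?_⟩
  have h' : ∃ c ∈ T, leader c.poly = x := ⟨c, h⟩
  unfold slot
  rw [dif_pos h']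
  exact congrArg some (hT.eq_of_leader h'.choose_spec.1 h.1 h'.choose_spec.2 h.2)

theorem slot_clearSlot_eq_iff {S : PairSystem F σ} {x : σ} (hT : IsTriangular S.T)
    (h : ∀ t, slot S.T x ≠ some (Constraint.eq t)) (y : σ) (t : MvPolynomial σ F) :
    slot (clearSlot S x).T y = some (Constraint.eq t) ↔ slot S.T y = some (Constraint.eq t) := by
  have h' : IsTriangular (clearSlot S x).T := hT.mono (Finset.filter_subset _ _)
  rw [slot_eq_some_iff h', slot_eq_some_iff hT]
  refine ⟨fun h1 => ⟨(Finset.mem_filter.1 h1.1).1, h1.2⟩, fun h1 => ⟨?_, h1.2⟩⟩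
  refine Finset.mem_filter.2 ⟨h1.1, fun h2 => h t ?_⟩
  exact (slot_eq_some_iff hT).2 ⟨h1.1, h2⟩

variable [Finite σ] (pd : PseudoDivision F σ) (T : AlgSystem F σ)

theorem reduce_of_leader_eq_bot {p : MvPolynomial σ F} (hp : leader p = ⊥) :
    reduce pd T p = p := by
  rw [reduce]
  split
  · rfl
  · next x hx =>
    rw [hp] at hx
    exact absurd hx WithBot.bot_ne_coe

theorem reduce_of_slot {p t : MvPolynomial σ F} {x : σ} (hp : leader p = x)
    (ht : slot T x = some (Constraint.eq t)) (hd : mdeg t ≤ mdeg p) :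
    reduce pd T p = reduce pd T (pd.prem p t x) := by
  rw [reduce]
  split
  · next hx =>
    rw [hp] at hx
    exact absurd hx WithBot.coe_ne_bot
  · next y hy =>
    obtain rfl : y = x := WithBot.coe_injective (hy.symm.trans hp)
    have h : ∃ t, slot T y = some (Constraint.eq t) ∧ mdeg t ≤ mdeg p := ⟨t, ht, hd⟩
    rw [dif_pos h]
    have h1 : t = h.choose := Constraint.eq.inj (Option.some.inj (ht.symm.trans h.choose_spec.1))
    rw [← h1]

theorem reduce_of_init {p : MvPolynomial σ F} {x : σ} (hp : leader p = x)
    (ht : ∀ t, slot T x = some (Constraint.eq t) → mdeg p < mdeg t)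
    (hi : reduce pd T (init p) = 0) :
    reduce pd T p = reduce pd T (p - init p * X x ^ mdeg p) := by
  rw [reduce]
  split
  · next hx =>
    rw [hp] at hx
    exact absurd hx WithBot.coe_ne_bot
  · next y hy =>
    obtain rfl : y = x := WithBot.coe_injective (hy.symm.trans hp)
    rw [dif_neg, if_pos hi]
    rintro ⟨t, h1, h2⟩
    exact absurd h2 (not_le.2 (ht t h1))

theorem reduce_eq_self {p : MvPolynomial σ F} {x : σ} (hp : leader p = x)
    (ht : ∀ t, slot T x = some (Constraint.eq t) → mdeg p < mdeg t)
    (hi : reduce pd T (init p) ≠ 0) : reduce pd T p = p := by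
  rw [reduce]
  split
  · rfl
  · next y hy =>
    obtain rfl : y = x := WithBot.coe_injective (hy.symm.trans hp)
    rw [dif_neg, if_neg hi]
    rintro ⟨t, h1, h2⟩
    exact absurd h2 (not_le.2 (ht t h1))

/-- Induction along the recursion of `reduce`. -/
theorem reduce_induction {motive : MvPolynomial σ F → Prop}
    (bot : ∀ p, leader p = ⊥ → motive p)
    (prem : ∀ p t (x : σ), leader p = x → slot T x = some (Constraint.eq t) → mdeg t ≤ mdeg p →
      motive (pd.prem p t x) → motive p)
    (drop : ∀ p (x : σ), leader p = x →
      (∀ t, slot T x = some (Constraint.eq t) → mdeg p < mdeg t) →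
      reduce pd T (init p) = 0 → motive (init p) → motive (p - init p * X x ^ mdeg p) → motive p)
    (self : ∀ p (x : σ), leader p = x →
      (∀ t, slot T x = some (Constraint.eq t) → mdeg p < mdeg t) →
      reduce pd T (init p) ≠ 0 → motive (init p) → motive p) (p : MvPolynomial σ F) :
    motive p := by
  have wf : WellFounded (Prod.Lex ((· < ·) : WithBot σ → WithBot σ → Prop)
    ((· < ·) : ℕ → ℕ → Prop)) := WellFounded.prod_lex wellFounded_lt wellFounded_lt
  suffices H : ∀ (z : WithBot σ × ℕ) (p : MvPolynomial σ F), (leader p, mdeg p) = z → motive p from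
    H _ p rfl
  intro z
  induction z using wf.induction with
  | _ z ih =>
    rintro p rfl
    rcases hp : leader p with _ | x
    · exact bot p hp
    · by_cases h : ∃ t, slot T x = some (Constraint.eq t) ∧ mdeg t ≤ mdeg p
      · obtain ⟨t, h1, h2⟩ := h
        exact prem p t x hp h1 h2 (ih _ (prem_lex pd hp (leader_of_slot h1) h2) _ rfl)
      · push Not at h
        have hinit := ih _ (Prod.Lex.left _ _ (leader_init_lt hp)) (init p) rfl
        by_cases hi : reduce pd T (init p) = 0
        · exact drop p x hp h hi hinit (ih _ (tail_lex hp) _ rfl)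
        · exact self p x hp h hi hinit

/-- Reduction only depends on the equations of the triangular system. -/
theorem reduce_congr {T' : AlgSystem F σ}
    (h : ∀ x t, slot T x = some (Constraint.eq t) ↔ slot T' x = some (Constraint.eq t))
    (p : MvPolynomial σ F) : reduce pd T p = reduce pd T' p := by
  induction p using reduce_induction pd T with
  | bot p hp => rw [reduce_of_leader_eq_bot pd T hp, reduce_of_leader_eq_bot pd T' hp]
  | prem p t x hp ht hd ih =>
    rw [reduce_of_slot pd T hp ht hd, reduce_of_slot pd T' hp ((h x t).1 ht) hd, ih]
  | drop p x hp ht hi ih1 ih2 =>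
    rw [reduce_of_init pd T hp ht hi,
      reduce_of_init pd T' hp (fun t h' => ht t ((h x t).2 h')) (ih1 ▸ hi), ih2]
  | self p x hp ht hi ih1 =>
    rw [reduce_eq_self pd T hp ht hi,
      reduce_eq_self pd T' hp (fun t h' => ht t ((h x t).2 h')) (ih1 ▸ hi)]

theorem leader_reduce_le (p : MvPolynomial σ F) : leader (reduce pd T p) ≤ leader p := by
  induction p using reduce_induction pd T with
  | bot p hp => rw [reduce_of_leader_eq_bot pd T hp]
  | prem p t x hp ht hd ih =>
    rw [reduce_of_slot pd T hp ht hd]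
    refine ih.trans ?_
    rw [hp]
    exact leader_prem_le pd hp (leader_of_slot ht)
  | drop p x hp ht hi ih1 ih2 =>
    rw [reduce_of_init pd T hp ht hi]
    refine ih2.trans ?_
    have h := tail_lex hp
    rw [Prod.lex_def] at h
    rcases h with h | h
    · exact h.le
    · exact h.1.le
  | self p x hp ht hi ih1 => rw [reduce_eq_self pd T hp ht hi]

theorem reduce_zero : reduce pd T 0 = 0 := reduce_of_leader_eq_bot pd T leader_zero

theorem reduce_one : reduce pd T 1 = 1 := reduce_of_leader_eq_bot pd T leader_one

/-- Properties of a reduced polynomial with leader `x`. -/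
theorem reduce_reduced {p q : MvPolynomial σ F} {x : σ} (hq : reduce pd T p = q)
    (hx : leader q = x) :
    (∀ t, slot T x = some (Constraint.eq t) → mdeg q < mdeg t) ∧ reduce pd T (init q) ≠ 0 := by
  induction p using reduce_induction pd T with
  | bot p hp =>
    rw [reduce_of_leader_eq_bot pd T hp] at hq
    rw [← hq, hp] at hx
    exact absurd hx WithBot.bot_ne_coe
  | prem p t y hp ht hd ih =>
    rw [reduce_of_slot pd T hp ht hd] at hq
    exact ih hq
  | drop p y hp ht hi ih1 ih2 =>
    rw [reduce_of_init pd T hp ht hi] at hq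
    exact ih2 hq
  | self p y hp ht hi ih1 =>
    rw [reduce_eq_self pd T hp ht hi] at hq
    subst hq
    obtain rfl : y = x := WithBot.coe_injective (hp.symm.trans hx)
    exact ⟨ht, hi⟩

/-- On points where the equations of the triangular system hold and their initials do not
vanish, a polynomial vanishes if and only if its reduction does. -/
theorem evalAt_reduce_eq_zero_iff {a : σ → AlgebraicClosure F} (p : MvPolynomial σ F)
    (ha : ∀ (x : σ) t, (x : WithBot σ) ≤ leader p → slot T x = some (Constraint.eq t) →
      evalAt a t = 0 ∧ evalAt a (init t) ≠ 0) :
    evalAt a (reduce pd T p) = 0 ↔ evalAt a p = 0 := by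
  induction p using reduce_induction pd T with
  | bot p hp => rw [reduce_of_leader_eq_bot pd T hp]
  | prem p t x hp ht hd ih =>
    have htx := leader_of_slot ht
    rw [reduce_of_slot pd T hp ht hd,
      ih fun y t h => ha y t (h.trans ((leader_prem_le pd hp htx).trans_eq hp.symm))]
    obtain ⟨h1, h2⟩ := ha x t hp.ge ht
    obtain ⟨m, k, hmk, -, he, -⟩ := pd.spec p t x hp htx
    have h3 := congrArg (evalAt a) he
    rw [evalAt_mul, evalAt_add, evalAt_mul, h1, mul_zero, zero_add] at h3
    rw [← h3, mul_eq_zero, or_iff_right (evalAt_ne_zero_of_dvd_pow hmk h2)]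
  | drop p x hp ht hi ih1 ih2 =>
    have h := tail_lex hp
    have hle : leader (p - init p * X x ^ mdeg p) ≤ leader p := by
      rw [Prod.lex_def] at h
      rcases h with h | h
      · exact h.le
      · exact h.1.le
    rw [reduce_of_init pd T hp ht hi, ih2 fun y t h => ha y t (h.trans hle)]
    have h1 : evalAt a (init p) = 0 := by
      rw [← ih1 fun y t h => ha y t (h.trans (leader_init_lt hp).le), hi, evalAt_zero]
    have h2 : evalAt a p = evalAt a (p - init p * X x ^ mdeg p) +
        evalAt a (init p * X x ^ mdeg p) := by
      rw [← evalAt_add, sub_add_cancel]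
    rw [h2, evalAt_mul, h1, zero_mul, add_zero]
  | self p x hp ht hi ih1 => rw [reduce_eq_self pd T hp ht hi]

/-- Rescaling a polynomial by a nonzero constant rescales its reduction. -/
theorem reduce_C_mul {c : F} (hc : c ≠ 0) (p : MvPolynomial σ F) :
    ∃ c' : F, c' ≠ 0 ∧ reduce pd T (C c * p) = C c' * reduce pd T p := by
  induction p using reduce_induction pd T generalizing c with
  | bot p hp =>
    refine ⟨c, hc, ?_⟩
    rw [reduce_of_leader_eq_bot pd T hp, reduce_of_leader_eq_bot pd T]
    rw [leader_C_mul hc, hp]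
  | prem p t x hp ht hd ih =>
    obtain ⟨c₁, hc₁, h1⟩ := pd.scale c p t x hc hp (leader_of_slot ht)
    obtain ⟨c₂, hc₂, h2⟩ := ih hc₁
    refine ⟨c₂, hc₂, ?_⟩
    rw [reduce_of_slot pd T hp ht hd, reduce_of_slot pd T ((leader_C_mul hc p).trans hp) ht
      (by rwa [mdeg_C_mul hc]), h1, h2]
  | drop p x hp ht hi ih1 ih2 =>
    obtain ⟨c₁, hc₁, h1⟩ := ih1 hc
    obtain ⟨c₂, hc₂, h2⟩ := ih2 hc
    refine ⟨c₂, hc₂, ?_⟩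
    rw [reduce_of_init pd T hp ht hi, reduce_of_init pd T ((leader_C_mul hc p).trans hp)
      (by rwa [mdeg_C_mul hc]) (by rw [init_C_mul hc, h1, hi, mul_zero]), ← h2, mdeg_C_mul hc,
      init_C_mul hc]
    congr 1
    ring
  | self p x hp ht hi ih1 =>
    obtain ⟨c₁, hc₁, h1⟩ := ih1 hc
    refine ⟨c, hc, ?_⟩
    rw [reduce_eq_self pd T hp ht hi, reduce_eq_self pd T ((leader_C_mul hc p).trans hp)
      (by rwa [mdeg_C_mul hc])]
    rw [init_C_mul hc, h1]
    exact mul_ne_zero (by simpa using hc₁) hi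

/-! ### The quasi fibre cardinality -/

variable {p q : MvPolynomial σ F} {x : σ}

/-- The defining property of the quasi fibre cardinality. The index exists, since `res` is `1` at
the degree of `p`. -/
theorem quasiFiberCard_spec :
    (∀ j < quasiFiberCard pd T p q x, reduce pd T (res p q x j) = 0) ∧
      reduce pd T (res p q x (quasiFiberCard pd T p q x)) ≠ 0 := by
  classical
  have h : ∃ i, reduce pd T (res p q x i) ≠ 0 := by
    refine ⟨degX x p, ?_⟩
    rw [res_top, reduce_one]
    exact one_ne_zero
  exact Nat.sInf_mem (s := {i : ℕ | (∀ j < i, reduce pd T (res p q x j) = 0) ∧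
    reduce pd T (res p q x i) ≠ 0})
    ⟨Nat.find h, fun j hj => not_not.1 (Nat.find_min h hj), Nat.find_spec h⟩

theorem quasiFiberCard_le {k : ℕ} (hk : reduce pd T (res p q x k) ≠ 0) :
    quasiFiberCard pd T p q x ≤ k := by
  by_contra h
  exact hk ((quasiFiberCard_spec pd T).1 k (not_le.1 h))

theorem quasiFiberCard_le_degX : quasiFiberCard pd T p q x ≤ degX x p := by
  refine quasiFiberCard_le pd T ?_
  rw [res_top, reduce_one]
  exact one_ne_zero

theorem quasiFiberCard_congr {T' : AlgSystem F σ}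
    (h : ∀ x t, slot T x = some (Constraint.eq t) ↔ slot T' x = some (Constraint.eq t)) :
    quasiFiberCard pd T p q x = quasiFiberCard pd T' p q x := by
  unfold quasiFiberCard
  simp only [reduce_congr pd T h]

theorem res_quasiFiberCard_ne_zero : res p q x (quasiFiberCard pd T p q x) ≠ 0 := by
  intro h
  have := (quasiFiberCard_spec pd T (p := p) (q := q) (x := x)).2
  rw [h, reduce_zero] at this
  exact this rfl

/-- If the initial of `q` does not reduce to zero, then the quasi fibre cardinality is at most
the degree of `q`. -/
theorem quasiFiberCard_le_degX_right (hq : leader q = x) (hd : degX x q < degX x p)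
    (hi : reduce pd T (init q) ≠ 0) : quasiFiberCard pd T p q x ≤ degX x q := by
  refine quasiFiberCard_le pd T ?_
  rwa [res_degX_right_of_pos hd (degX_pos hq)]

/-- For the derivative, the quasi fibre cardinality is less than the degree, so that the
square-free part still has leader `x`: the initial of the derivative is a nonzero rational multiple
of the initial of `p`. -/
theorem quasiFiberCard_pderiv_lt [CharZero F] (hp : leader p = x)
    (hi : reduce pd T (init p) ≠ 0) :
    quasiFiberCard pd T p (pderiv x p) x < degX x p := by
  have h0 := degX_pos hp
  have hd : degX x (pderiv x p) < degX x p := by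
    rw [degX_pderiv]
    omega
  rcases Nat.lt_or_ge 1 (degX x p) with h1 | h1
  · obtain ⟨h2, h3⟩ := init_pderiv hp h1
    refine (quasiFiberCard_le_degX_right pd T h2 hd ?_).trans_lt hd
    obtain ⟨c', hc', h4⟩ := reduce_C_mul pd T
      (c := (degX x p : F)) (Nat.cast_ne_zero.2 h0.ne') (init p)
    rw [h3, h4]
    exact mul_ne_zero (by simpa using hc') hi
  · have h2 : degX x p = 1 := by omega
    have h3 : degX x (pderiv x p) = 0 := by rw [degX_pderiv, h2]
    refine (quasiFiberCard_le pd T (k := 0) ?_).trans_lt h0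
    rw [res_zero_of_degX_eq_zero hd h3]
    have h4 : pderiv x p = init p := by
      rw [init_eq hp]
      apply uni_injective x
      rw [Polynomial.leadingCoeff,
        uni_of_mem_Iio x _ (coeff_uni_mem x p ((leader_le_iff x p).1 hp.le) _), uni_pderiv]
      unfold degX at h2
      have h5 : (uni x p).derivative.natDegree = 0 := by
        rw [Polynomial.natDegree_derivative, h2]
      rw [Polynomial.eq_C_of_natDegree_eq_zero h5, Polynomial.coeff_derivative, h2]
      simp
    rwa [h4]

end Reduction

/-! ### The polynomials returned by the splitting algorithms -/

section LocalAlgebra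

open MvPolynomial

variable {F : Type u} [Field F] {σ : Type v} [LinearOrder σ]
variable {x : σ} {p q t : MvPolynomial σ F} {i : ℕ}

theorem evalBelow_ne_zero_of_init (hp : leader p = x) {a : σ → AlgebraicClosure F}
    (ha : evalAt a (init p) ≠ 0) : evalBelow x a p ≠ 0 := by
  intro h
  rw [evalAt_init hp, h, Polynomial.coeff_zero] at ha
  exact ha rfl

/-- The quotient of `p` by the greatest common divisor with its derivative: square-free, with
the same zeros in the fibre. -/
theorem splitQuotient_pderiv [CharZero F] (pd : PseudoDivision F σ) (hp : leader p = x)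
    (hi : i < degX x p) {a : σ → AlgebraicClosure F} (ha : evalAt a (init p) ≠ 0)
    (h0 : ∀ j < i, evalAt a (res p (pderiv x p) x j) = 0)
    (hr : evalAt a (res p (pderiv x p) x i) ≠ 0) :
    evalAt a (init (splitQuotient pd p (pderiv x p) x i)) ≠ 0 ∧
      Squarefree (evalBelow x a (splitQuotient pd p (pderiv x p) x i)) ∧
      (evalAt a (splitQuotient pd p (pderiv x p) x i) = 0 ↔ evalAt a p = 0) := by
  have hd : degX x (pderiv x p) < degX x p := by
    rw [degX_pderiv]
    have := degX_pos hp
    omega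
  have hq := leader_pderiv_le hp.le
  have hr0 : res p (pderiv x p) x i ≠ 0 := by
    intro h
    rw [h, evalAt_zero] at hr
    exact hr rfl
  obtain ⟨h1, h2, h3⟩ := splitQuotient_spec pd hp hq hd hi.le hr0
  obtain ⟨μ, G, hμ, hG, he, hdeg⟩ := evalBelow_splitQuotient pd hp hq hd hi.le ha h0 hr
  have hP0 := evalBelow_ne_zero_of_init hp ha
  rw [evalBelow_pderiv] at hG
  refine ⟨?_, squarefree_quotient_derivative hμ hP0 hG he, ?_⟩
  · rw [evalAt_init_ne_zero_iff ((leader_eq_iff h1).2 (by omega)), hdeg]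
  · rw [← eval_evalBelow x, ← eval_evalBelow x]
    exact eval_quotient_derivative_eq_zero_iff hμ hP0 hG he _

/-- The quotient of a square-free polynomial `p` by the greatest common divisor with `q`: it has
the zeros of `p` that are no zeros of `q`. -/
theorem splitQuotient_of_squarefree (pd : PseudoDivision F σ) (hp : leader p = x)
    (hq : leader q ≤ x) (hd : degX x q < degX x p) (hi : i ≤ degX x p)
    {a : σ → AlgebraicClosure F} (ha : evalAt a (init p) ≠ 0)
    (hs : Squarefree (evalBelow x a p))
    (h0 : ∀ j < i, evalAt a (res p q x j) = 0) (hr : evalAt a (res p q x i) ≠ 0) :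
    (evalBelow x a (splitQuotient pd p q x i)).natDegree = degX x (splitQuotient pd p q x i) ∧
      Squarefree (evalBelow x a (splitQuotient pd p q x i)) ∧
      ∀ α, (evalBelow x a (splitQuotient pd p q x i)).eval α = 0 ↔
        (evalBelow x a p).eval α = 0 ∧ (evalBelow x a q).eval α ≠ 0 := by
  obtain ⟨μ, G, hμ, hG, he, hdeg⟩ := evalBelow_splitQuotient pd hp hq hd hi ha h0 hr
  exact ⟨hdeg, squarefree_quotient hμ hs he, eval_quotient_eq_zero_iff hμ hs hG he⟩

/-- The regular element of the polynomial remainder sequence of a square-free polynomial `p`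
and `q`: square-free, with the common zeros of `p` and `q`. -/
theorem PRS_of_squarefree (hp : leader p = x) (hq : leader q ≤ x) (hd : degX x q < degX x p)
    (hi0 : 0 < i) (hi : i ≤ degX x p) {a : σ → AlgebraicClosure F}
    (ha : evalAt a (init p) ≠ 0) (hs : Squarefree (evalBelow x a p))
    (h0 : ∀ j < i, evalAt a (res p q x j) = 0) (hr : evalAt a (res p q x i) ≠ 0) :
    evalAt a (init (PRS p q x i)) ≠ 0 ∧ Squarefree (evalBelow x a (PRS p q x i)) ∧
      (evalAt a (PRS p q x i) = 0 ↔ evalAt a p = 0 ∧ evalAt a q = 0) := by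
  obtain ⟨hG, hdeg⟩ := isGcd_evalBelow_PRS hp hq hd hi ha h0 hr
  have hr0 : res p q x i ≠ 0 := by
    intro h
    rw [h, evalAt_zero] at hr
    exact hr rfl
  obtain ⟨h1, h2, -⟩ := PRS_of_res_ne_zero hp hq hd hi0 hi hr0
  refine ⟨?_, hs.squarefree_of_dvd hG.dvd_left, ?_⟩
  · rw [evalAt_init_ne_zero_iff h1, hdeg, h2]
  · rw [← eval_evalBelow x, ← eval_evalBelow x, ← eval_evalBelow x]
    exact hG.eval_eq_zero_iff _

/-- The resultant vanishes at common zeros. -/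
theorem evalAt_res_zero (hp : leader p = x) (hq : leader q ≤ x) (hd : degX x q < degX x p)
    {a : σ → AlgebraicClosure F} (ha : evalAt a (init p) ≠ 0) (hpa : evalAt a p = 0)
    (hqa : evalAt a q = 0) : evalAt a (res p q x 0) = 0 := by
  by_contra hr
  obtain ⟨hG, hdeg⟩ := isGcd_evalBelow_PRS hp hq hd (Nat.zero_le _) ha
    (fun j hj => absurd hj (Nat.not_lt_zero j)) hr
  rw [← eval_evalBelow x] at hpa hqa
  have h1 := (hG.eval_eq_zero_iff _).2 ⟨hpa, hqa⟩
  rw [Polynomial.eq_C_of_natDegree_eq_zero hdeg, Polynomial.eval_C] at h1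
  have h2 := hG.dvd_left
  rw [Polynomial.eq_C_of_natDegree_eq_zero hdeg, h1, Polynomial.C_0, zero_dvd_iff] at h2
  exact evalBelow_ne_zero_of_init hp ha h2

/-- The polynomial of which the fibration split is computed in `resSplitDivide`. -/
noncomputable def divideArgument (pd : PseudoDivision F σ) (t p : MvPolynomial σ F) (x : σ) :
    MvPolynomial σ F :=
  if degX x t ≤ degX x p then pd.prem p t x else p

theorem leader_divideArgument_le (pd : PseudoDivision F σ) (ht : leader t = x)
    (hp : leader p = x) : leader (divideArgument pd t p x) ≤ x := by
  unfold divideArgument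
  split_ifs
  · exact leader_prem_le pd hp ht
  · exact hp.le

theorem degX_divideArgument_lt (pd : PseudoDivision F σ) (ht : leader t = x)
    (hp : leader p = x) : degX x (divideArgument pd t p x) < degX x t := by
  unfold divideArgument
  split_ifs with h
  · obtain ⟨-, -, -, -, -, hd⟩ := pd.spec p t x hp ht
    exact hd
  · exact not_le.1 h

theorem eval_divideArgument (pd : PseudoDivision F σ) (ht : leader t = x) (hp : leader p = x)
    {a : σ → AlgebraicClosure F} (ha : evalAt a (init t) ≠ 0) {α : AlgebraicClosure F}
    (hα : (evalBelow x a t).eval α = 0) :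
    (evalBelow x a (divideArgument pd t p x)).eval α = 0 ↔ (evalBelow x a p).eval α = 0 := by
  unfold divideArgument
  split_ifs with h
  · obtain ⟨m, k, hmk, hm, he, -⟩ := pd.spec p t x hp ht
    have h1 := congrArg (fun f => (evalBelow x a f).eval α) he
    simp only [evalBelow_mul, evalBelow_add, evalBelow_of_leader_lt hm, Polynomial.eval_mul,
      Polynomial.eval_add, Polynomial.eval_C, hα, mul_zero, zero_add] at h1
    rw [← h1, mul_eq_zero, or_iff_right (evalAt_ne_zero_of_dvd_pow hmk ha)]
  · rfl

/-- The product formed when an inequation `p` meets an inequation `t` with the same leader, at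
a point of the base: `r` is the quotient of `t` by its greatest common divisor with `p`. -/
theorem mul_splitQuotient_of_squarefree (pd : PseudoDivision F σ) (ht : leader t = x)
    (hp : leader p = x) (hi : i ≤ degX x t) {a : σ → AlgebraicClosure F}
    (hat : evalAt a (init t) ≠ 0) (hst : Squarefree (evalBelow x a t))
    (hap : evalAt a (init p) ≠ 0) (hsp : Squarefree (evalBelow x a p))
    (h0 : ∀ j < i, evalAt a (res t (divideArgument pd t p x) x j) = 0)
    (hr : evalAt a (res t (divideArgument pd t p x) x i) ≠ 0) :
    let r := splitQuotient pd t (divideArgument pd t p x) x i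
    leader (r * p) = x ∧ evalAt a (init (r * p)) ≠ 0 ∧ Squarefree (evalBelow x a (r * p)) ∧
      (evalAt a (r * p) = 0 ↔ evalAt a t = 0 ∨ evalAt a p = 0) := by
  intro r
  have hq := leader_divideArgument_le pd ht hp
  have hd := degX_divideArgument_lt pd ht hp
  have hr0 : res t (divideArgument pd t p x) x i ≠ 0 := by
    intro h
    rw [h, evalAt_zero] at hr
    exact hr rfl
  obtain ⟨h1, h2, -⟩ := splitQuotient_spec pd ht hq hd hi hr0
  obtain ⟨h3, h4, h5⟩ := splitQuotient_of_squarefree pd ht hq hd hi hat hst h0 hr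
  have h6 : ∀ α, (evalBelow x a r).eval α = 0 ↔
      (evalBelow x a t).eval α = 0 ∧ (evalBelow x a p).eval α ≠ 0 := by
    intro α
    rw [h5]
    refine and_congr_right fun h => ?_
    rw [Ne, eval_divideArgument pd ht hp hat h]
  have hdeg : degX x (r * p) = degX x r + degX x p := degX_mul h2 (ne_zero_of_leader hp)
  have hl : leader (r * p) = x := by
    rw [leader_eq_iff (leader_mul_le h1 hp.le), hdeg]
    have := degX_pos hp
    omega
  refine ⟨hl, ?_, ?_, ?_⟩
  · rw [evalAt_init_ne_zero_iff hl, evalBelow_mul,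
      Polynomial.natDegree_mul h4.ne_zero (evalBelow_ne_zero_of_init hp hap), h3, hdeg,
      (evalAt_init_ne_zero_iff hp a).1 hap]
  · rw [evalBelow_mul]
    exact squarefree_mul_of_no_common_root h4 hsp fun α h => ((h6 α).1 h).2
  · rw [evalAt_mul, mul_eq_zero, ← eval_evalBelow x, ← eval_evalBelow x, ← eval_evalBelow x, h6]
    tauto

end LocalAlgebra

/-! ### Case distinctions at a leader -/

section LocalSplitting

open MvPolynomial

variable {F : Type u} [Field F] {σ : Type v} [LinearOrder σ]

open Classical in
/-- The system obtained from `S` by replacing the elements of the triangular part with leader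
`x` by `o`, and by adding `E` to the queue. -/
noncomputable def replaceAt (S : PairSystem F σ) (x : σ) (o : Option (Constraint F σ))
    (E : AlgSystem F σ) : PairSystem F σ :=
  ⟨(S.T.filter fun c => leader c.poly ≠ x) ∪ o.toFinset, S.Q ∪ E⟩

/-- A branch of a case distinction at the leader `x`: the new element of leader `x` of the
triangular part, and the constraints to be added to the queue. -/
abbrev Branch (F : Type u) [Field F] (σ : Type v) : Type (max u v) :=
  Option (Constraint F σ) × AlgSystem F σ

/-- All constraints of a branch hold at `a`. -/
def Branch.Holds (a : σ → AlgebraicClosure F) (d : Branch F σ) : Prop :=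
  (∀ c ∈ d.1, c.Holds a) ∧ ∀ e ∈ d.2, e.Holds a

open Classical in
/-- The systems that arise from `S` by a list of branches at the leader `x`. -/
noncomputable def branchSystems (S : PairSystem F σ) (x : σ) (L : List (Branch F σ)) :
    Finset (PairSystem F σ) :=
  (L.map fun d => replaceAt S x d.1 d.2).toFinset

/-- What is known at the leader `x` about a system `S` from whose queue a constraint with this
leader has been taken. All statements concern points `a` that satisfy the constraints of `S`
with leader smaller than `x`. -/
structure IsRegularAt [Finite σ] (pd : PseudoDivision F σ) (S : PairSystem F σ) (x : σ) : Prop where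
  triangular : IsTriangular S.T
  init_ne_zero : ∀ c ∈ slot S.T x, ∀ a ∈ Sol (below S.toAlgSystem x), evalAt a (init c.poly) ≠ 0
  squarefree : ∀ c ∈ slot S.T x, ∀ a ∈ Sol (below S.toAlgSystem x),
    Squarefree (evalBelow x a c.poly)
  evalAt_eq_zero : ∀ p, leader p < x → reduce pd S.T p = 0 →
    ∀ a ∈ Sol (below S.toAlgSystem x), evalAt a p = 0

/-- The local correctness and progress of a case distinction at the leader `x` that treats the
constraint `q`, for points `a` that satisfy the constraints of `S` with leader smaller than `x`.
The field `regular` uses only those new constraints whose leader is smaller than `x`, as the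
definition of a simple system does. The last field says that a branch lowers the degree of the
equation with leader `x`, or creates such an equation, or it leaves the equation of leader `x` as
it is and either adds a new effective equation of smaller leader or replaces the inequation `q` by
at most three inequations of smaller leader. -/
structure IsSplitting [Finite σ] (pd : PseudoDivision F σ) (S : PairSystem F σ) (x : σ)
    (q : Constraint F σ) (L : List (Branch F σ)) : Prop where
  leader_slot : ∀ d ∈ L, ∀ c ∈ d.1, leader c.poly = x
  leader_queue : ∀ d ∈ L, ∀ e ∈ d.2, leader e.poly ≤ x
  sound : ∀ a ∈ Sol (below S.toAlgSystem x), ∀ d ∈ L, d.Holds a →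
    (∀ c ∈ slot S.T x, c.Holds a) ∧ q.Holds a
  complete : ∀ a ∈ Sol (below S.toAlgSystem x), (∀ c ∈ slot S.T x, c.Holds a) → q.Holds a →
    ∃ d ∈ L, d.Holds a
  disjoint : L.Pairwise fun d d' => ∀ a, d.Holds a → ¬ d'.Holds a
  regular : ∀ a ∈ Sol (below S.toAlgSystem x), ∀ d ∈ L, ∀ c ∈ d.1,
    (∀ e ∈ d.2, leader e.poly < x → e.Holds a) →
      evalAt a (init c.poly) ≠ 0 ∧ Squarefree (evalBelow x a c.poly)
  progress : ∀ d ∈ L,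
    (∃ r, d.1 = some (Constraint.eq r) ∧
      ∀ t, slot S.T x = some (Constraint.eq t) → degX x r < degX x t) ∨
    (∀ r, d.1 = some (Constraint.eq r) ↔ slot S.T x = some (Constraint.eq r)) ∧
      ((∃ h, Constraint.eq h ∈ d.2 ∧ reduce pd S.T h ≠ 0 ∧ leader h < x) ∨
        (∃ p, q = Constraint.ne p) ∧ (∀ e ∈ d.2, ∃ h, e = Constraint.ne h ∧ leader h < x) ∧
          d.2.card ≤ 3)

theorem filter_union_slot {T : AlgSystem F σ} (hT : IsTriangular T) (x : σ)
    [DecidableEq (Constraint F σ)] [DecidablePred fun c : Constraint F σ => leader c.poly ≠ x] :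
    (T.filter fun c => leader c.poly ≠ x) ∪ (slot T x).toFinset = T := by
  ext c
  rw [Finset.mem_union, Finset.mem_filter, Option.mem_toFinset, Option.mem_def,
    slot_eq_some_iff hT]
  tauto

open Classical in
theorem replaceAt_slot {S : PairSystem F σ} (hT : IsTriangular S.T) (x : σ)
    (E : AlgSystem F σ) :
    replaceAt S x (slot S.T x) E = ⟨S.T, S.Q ∪ E⟩ := by
  unfold replaceAt
  rw [filter_union_slot hT]

end LocalSplitting

/-! ### The branches of the main loop -/

section Treat

open MvPolynomial

variable {F : Type u} [Field F] {σ : Type v} [LinearOrder σ] [Finite σ]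
variable {pd : PseudoDivision F σ} {S : PairSystem F σ} {x : σ} {p q t : MvPolynomial σ F}

open Classical in
theorem treatEquation_of_eq_of_reduce_eq_zero (hT : IsTriangular S.T)
    (ht : slot S.T x = some (Constraint.eq t)) (h0 : reduce pd S.T (res t q x 0) = 0) :
    treatEquation pd S q x = branchSystems S x
      [(some (Constraint.eq (PRS t q x (quasiFiberCard pd S.T t q x))),
        {Constraint.ne (res t q x (quasiFiberCard pd S.T t q x))}),
      (some (Constraint.eq t),
        {Constraint.eq (res t q x (quasiFiberCard pd S.T t q x))} ∪ {Constraint.eq q})] := by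
  unfold treatEquation branchSystems
  rw [ht]
  simp only [if_pos h0, List.map, ← ht, replaceAt_slot hT, List.toFinset_cons, List.toFinset_nil]
  rw [← Finset.union_assoc]
  rfl

open Classical in
theorem treatEquation_of_eq_of_reduce_ne_zero (hT : IsTriangular S.T)
    (ht : slot S.T x = some (Constraint.eq t)) (h0 : reduce pd S.T (res t q x 0) ≠ 0) :
    treatEquation pd S q x = branchSystems S x
      [(some (Constraint.eq t), {Constraint.eq q} ∪ {Constraint.eq (res t q x 0)})] := by
  unfold treatEquation branchSystems
  rw [ht]
  simp only [if_neg h0, List.map, ← ht, replaceAt_slot hT, List.toFinset_cons, List.toFinset_nil]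
  rw [← Finset.union_assoc]
  rfl

open Classical in
/-- The inequation `t` returns to the queue in all branches. The first branch is the generic one;
in the others the initial of `q` vanishes, or the number of distinct roots of `q` in the fibre
drops. -/
theorem treatEquation_of_ne (hT : IsTriangular S.T)
    (ht : slot S.T x = some (Constraint.ne t)) :
    treatEquation pd S q x =
    let i := quasiFiberCard pd S.T q (pderiv x q) x
    branchSystems S x
      [(some (Constraint.eq (splitQuotient pd q (pderiv x q) x i)),
        {Constraint.ne t} ∪ {Constraint.ne (init q)} ∪
          {Constraint.ne (res q (pderiv x q) x i)}),
      (none, {Constraint.ne t} ∪ {Constraint.eq (init q)} ∪ {Constraint.eq q}),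
      (none, {Constraint.ne t} ∪ {Constraint.ne (init q)} ∪
        {Constraint.eq (res q (pderiv x q) x i)} ∪ {Constraint.eq q})] := by
  have hi : quasiFiberCard pd S.T q (pderiv x q) x =
      quasiFiberCard pd (clearSlot S x).T q (pderiv x q) x :=
    quasiFiberCard_congr pd S.T fun y s => (slot_clearSlot_eq_iff hT (by simp [ht]) y s).symm
  unfold treatEquation branchSystems
  rw [ht, hi]
  simp only [List.map, List.toFinset_cons, List.toFinset_nil, replaceAt, ← Finset.union_assoc,
    Option.toFinset_none, Finset.union_empty]
  unfold insertEquation setSlot clearSlot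
  simp only [resSplitSquareFree, resSplit, initSplit, split, enqueue, Finset.filter_filter,
    and_self]
  rfl

open Classical in
theorem treatEquation_of_none (hT : IsTriangular S.T) (ht : slot S.T x = none) :
    treatEquation pd S q x =
    let i := quasiFiberCard pd S.T q (pderiv x q) x
    branchSystems S x
      [(some (Constraint.eq (splitQuotient pd q (pderiv x q) x i)),
        {Constraint.ne (init q)} ∪ {Constraint.ne (res q (pderiv x q) x i)}),
      (none, {Constraint.eq (init q)} ∪ {Constraint.eq q}),
      (none, {Constraint.ne (init q)} ∪ {Constraint.eq (res q (pderiv x q) x i)} ∪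
        {Constraint.eq q})] := by
  unfold treatEquation branchSystems
  rw [ht]
  simp only [List.map, List.toFinset_cons, List.toFinset_nil]
  rw [← ht]
  simp only [replaceAt_slot hT, ← Finset.union_assoc]
  simp only [replaceAt, ← Finset.union_assoc]
  rfl

open Classical in
theorem treatInequation_of_eq (hT : IsTriangular S.T)
    (ht : slot S.T x = some (Constraint.eq t)) (hd : degX x q < degX x t) :
    treatInequation pd S q x =
    let i := quasiFiberCard pd S.T t q x
    branchSystems S x
      [(some (Constraint.eq (splitQuotient pd t q x i)), {Constraint.ne (res t q x i)}),
      (some (Constraint.eq t), {Constraint.eq (res t q x i)} ∪ {Constraint.ne q})] := by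
  unfold treatInequation branchSystems
  rw [ht]
  simp only [List.map, List.toFinset_cons, List.toFinset_nil, ← ht, replaceAt_slot hT,
    ← Finset.union_assoc, resSplitDivide, if_neg (not_le.2 hd)]
  rfl

open Classical in
theorem treatInequation_of_none (hT : IsTriangular S.T) (ht : slot S.T x = none) :
    treatInequation pd S q x =
    let i := quasiFiberCard pd S.T q (pderiv x q) x
    branchSystems S x
      [(some (Constraint.ne (splitQuotient pd q (pderiv x q) x i)),
        {Constraint.ne (init q)} ∪ {Constraint.ne (res q (pderiv x q) x i)}),
      (none, {Constraint.eq (init q)} ∪ {Constraint.ne q}),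
      (none, {Constraint.ne (init q)} ∪ {Constraint.eq (res q (pderiv x q) x i)} ∪
        {Constraint.ne q})] := by
  unfold treatInequation branchSystems
  rw [ht]
  simp only [List.map, List.toFinset_cons, List.toFinset_nil]
  rw [← ht]
  simp only [replaceAt_slot hT, ← Finset.union_assoc]
  simp only [replaceAt, ← Finset.union_assoc]
  rfl

open Classical in
/-- In the generic branch the product of `p` with the part of `t` prime to `p` takes the place of
`t`; in the last branch the inequation that returns to the queue is the square-free `p`, not `q`. -/
theorem treatInequation_of_ne (hT : IsTriangular S.T)
    (ht : slot S.T x = some (Constraint.ne t)) :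
    treatInequation pd S q x =
    let i := quasiFiberCard pd S.T q (pderiv x q) x
    let p := splitQuotient pd q (pderiv x q) x i
    let j := quasiFiberCard pd S.T t (divideArgument pd t p x) x
    branchSystems S x
      [(some (Constraint.ne (splitQuotient pd t (divideArgument pd t p x) x j * p)),
        {Constraint.ne (init q)} ∪ {Constraint.ne (res q (pderiv x q) x i)} ∪
          {Constraint.ne (res t (divideArgument pd t p x) x j)}),
      (some (Constraint.ne t), {Constraint.eq (init q)} ∪ {Constraint.ne q}),
      (some (Constraint.ne t), {Constraint.ne (init q)} ∪
        {Constraint.eq (res q (pderiv x q) x i)} ∪ {Constraint.ne q}),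
      (some (Constraint.ne t), {Constraint.ne (init q)} ∪
        {Constraint.ne (res q (pderiv x q) x i)} ∪
        {Constraint.eq (res t (divideArgument pd t p x) x j)} ∪ {Constraint.ne p})] := by
  unfold treatInequation branchSystems
  rw [ht]
  simp only [List.map, List.toFinset_cons, List.toFinset_nil, ← ht, replaceAt_slot hT,
    ← Finset.union_assoc]
  simp only [replaceAt, ← Finset.union_assoc]
  rfl

end Treat

/-! ### Correctness and progress of the branches -/

section TreatSpec

open MvPolynomial

variable {F : Type u} [Field F] {σ : Type v} [LinearOrder σ] [Finite σ]
variable {pd : PseudoDivision F σ} {S : PairSystem F σ} {x : σ} {p q t : MvPolynomial σ F}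

theorem forall_mem_singleton_finset {α : Type*} {p : α → Prop} {b : α} :
    (∀ a ∈ ({b} : Finset α), p a) ↔ p b := by
  simp

/-- What reduces to zero vanishes on the base: hence the quasi fibre cardinality bounds the degree
of the greatest common divisor in each fibre from below. -/
theorem IsRegularAt.evalAt_res_of_lt_quasiFiberCard (hS : IsRegularAt pd S x) (hp : leader p = x)
    (hq : leader q ≤ x) (hd : degX x q < degX x p) {a : σ → AlgebraicClosure F}
    (ha : a ∈ Sol (below S.toAlgSystem x)) :
    ∀ j < quasiFiberCard pd S.T p q x, evalAt a (res p q x j) = 0 := fun j hj =>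
  hS.evalAt_eq_zero _ (leader_res_lt hp hq hd (hj.le.trans (quasiFiberCard_le_degX pd S.T)))
    ((quasiFiberCard_spec pd S.T).1 j hj) a ha

/-- Two equations of leader `x`: in the generic branch the greatest common divisor replaces
both, unless the resultant does not reduce to zero and is itself an effective equation of smaller
leader. -/
theorem exists_isSplitting_treatEquation_of_eq (hS : IsRegularAt pd S x)
    (ht : slot S.T x = some (Constraint.eq t)) (hq : leader q = x) (hd : degX x q < degX x t)
    (hi : reduce pd S.T (init q) ≠ 0) :
    ∃ L, treatEquation pd S q x = branchSystems S x L ∧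
      IsSplitting pd S x (Constraint.eq q) L := by
  classical
  have htx : leader t = x := leader_of_slot ht
  have hat : ∀ a ∈ Sol (below S.toAlgSystem x), evalAt a (init t) ≠ 0 :=
    hS.init_ne_zero (Constraint.eq t) ht
  have hst : ∀ a ∈ Sol (below S.toAlgSystem x), Squarefree (evalBelow x a t) :=
    hS.squarefree (Constraint.eq t) ht
  have hilt := fun {i : ℕ} => leader_res_lt (i := i) htx hq.le hd
  by_cases h0 : reduce pd S.T (res t q x 0) = 0
  · refine ⟨_, treatEquation_of_eq_of_reduce_eq_zero hS.triangular ht h0, ?_⟩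
    have hspec := quasiFiberCard_spec pd S.T (p := t) (q := q) (x := x)
    have hle := quasiFiberCard_le_degX pd S.T (p := t) (q := q) (x := x)
    have hleq := quasiFiberCard_le_degX_right pd S.T hq hd hi
    have hr0 := res_quasiFiberCard_ne_zero pd S.T (p := t) (q := q) (x := x)
    have hz := fun a (ha : a ∈ Sol (below S.toAlgSystem x)) =>
      hS.evalAt_res_of_lt_quasiFiberCard htx hq.le hd ha
    set i := quasiFiberCard pd S.T t q x
    have hi0 : 0 < i := by
      rcases Nat.eq_zero_or_pos i with h | h
      · rw [h] at hspec
        exact absurd h0 hspec.2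
      · exact h
    obtain ⟨hg1, hg2, -⟩ := PRS_of_res_ne_zero htx hq.le hd hi0 hle hr0
    have key := fun a (ha : a ∈ Sol (below S.toAlgSystem x)) hr =>
      PRS_of_squarefree htx hq.le hd hi0 hle (hat a ha) (hst a ha) (hz a ha) hr
    refine ⟨?_, ?_, ?_, ?_, ?_, ?_, ?_⟩
    · simp [Constraint.poly, hg1, htx]
    · simp [Constraint.poly, hq.le, (hilt hle).le]
    · intro a ha
      simp only [ht, Branch.Holds, List.forall_mem_cons]
      simp only [Option.mem_def, Option.some.injEq, forall_eq', Finset.mem_singleton, forall_eq,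
        Finset.mem_union, forall_eq_or_imp, Constraint.Holds, List.not_mem_nil]
      refine ⟨fun h => ((key a ha h.2).2.2).1 h.1, fun h => ⟨h.1, h.2.2⟩, by simp⟩
    · intro a ha h1 h2
      simp only [Branch.Holds, List.exists_mem_cons_iff]
      simp only [ht, Option.mem_def, Option.some.injEq, forall_eq', Finset.mem_singleton,
        forall_eq, Finset.mem_union, forall_eq_or_imp, Constraint.Holds] at h1 h2 ⊢
      by_cases hr : evalAt a (res t q x i) = 0
      · exact Or.inr (Or.inl ⟨h1, hr, h2⟩)
      · exact Or.inl ⟨(key a ha hr).2.2.2 ⟨h1, h2⟩, hr⟩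
    · simp +contextual [Branch.Holds, Constraint.Holds]
    · intro a ha
      simp only [List.forall_mem_cons]
      simp only [Option.mem_def, Option.some.injEq, forall_eq', Finset.mem_singleton, forall_eq,
        Finset.mem_union, forall_eq_or_imp, Constraint.Holds, Constraint.poly, List.not_mem_nil]
      refine ⟨fun h => ⟨(key a ha (h (hilt hle))).1, (key a ha (h (hilt hle))).2.1⟩,
        fun _ => ⟨hat a ha, hst a ha⟩, by simp⟩
    · simp only [List.forall_mem_cons]
      refine ⟨Or.inl ⟨_, rfl, fun s hs => ?_⟩, Or.inr ⟨fun r => by rw [ht], Or.inl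
        ⟨_, Finset.mem_union_left _ (Finset.mem_singleton_self _), hspec.2, hilt hle⟩⟩, by simp⟩
      obtain rfl := Constraint.eq.inj (Option.some.inj (ht.symm.trans hs))
      omega
  · refine ⟨_, treatEquation_of_eq_of_reduce_ne_zero hS.triangular ht h0, ?_⟩
    refine ⟨?_, ?_, ?_, ?_, ?_, ?_, ?_⟩
    · simp [Constraint.poly, htx]
    · simp [Constraint.poly, hq.le, (hilt (Nat.zero_le _)).le]
    · intro a ha
      simp +contextual [ht, Branch.Holds, Constraint.Holds]
    · intro a ha h1 h2
      simp only [Branch.Holds, List.exists_mem_cons_iff]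
      simp only [ht, Option.mem_def, Option.some.injEq, forall_eq', Finset.mem_singleton,
        forall_eq, Finset.mem_union, forall_eq_or_imp, Constraint.Holds] at h1 h2 ⊢
      exact Or.inl ⟨h1, h2, evalAt_res_zero htx hq.le hd (hat a ha) h1 h2⟩
    · simp
    · intro a ha
      simp only [List.forall_mem_cons]
      simp only [Option.mem_def, Option.some.injEq, forall_eq', Finset.mem_singleton, forall_eq,
        Finset.mem_union, forall_eq_or_imp, Constraint.Holds, Constraint.poly, List.not_mem_nil]
      exact ⟨fun _ => ⟨hat a ha, hst a ha⟩, by simp⟩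
    · simp only [List.forall_mem_cons]
      exact ⟨Or.inr ⟨fun r => by rw [ht], Or.inl ⟨_, Finset.mem_union_right _
        (Finset.mem_singleton_self _), h0, hilt (Nat.zero_le _)⟩⟩, by simp⟩

/-- The square-free part computed at the quasi fibre cardinality. -/
theorem IsRegularAt.splitQuotient_pderiv [CharZero F] (hS : IsRegularAt pd S x)
    (hq : leader q = x) (hi : reduce pd S.T (init q) ≠ 0) :
    let i := quasiFiberCard pd S.T q (pderiv x q) x
    leader (splitQuotient pd q (pderiv x q) x i) = x ∧ leader (res q (pderiv x q) x i) < x ∧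
      reduce pd S.T (res q (pderiv x q) x i) ≠ 0 ∧
      ∀ a ∈ Sol (below S.toAlgSystem x), evalAt a (init q) ≠ 0 →
        evalAt a (res q (pderiv x q) x i) ≠ 0 →
        evalAt a (init (splitQuotient pd q (pderiv x q) x i)) ≠ 0 ∧
        Squarefree (evalBelow x a (splitQuotient pd q (pderiv x q) x i)) ∧
        (evalAt a (splitQuotient pd q (pderiv x q) x i) = 0 ↔ evalAt a q = 0) := by
  intro i
  have hlt : i < degX x q := quasiFiberCard_pderiv_lt pd S.T hq hi
  have hd : degX x (pderiv x q) < degX x q := by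
    rw [degX_pderiv]
    omega
  have hle := leader_pderiv_le hq.le
  obtain ⟨h1, -, h3⟩ := splitQuotient_spec pd hq hle hd hlt.le
    (res_quasiFiberCard_ne_zero pd S.T (p := q) (q := pderiv x q) (x := x))
  refine ⟨(leader_eq_iff h1).2 ?_, leader_res_lt hq hle hd hlt.le,
    (quasiFiberCard_spec pd S.T).2, fun a ha h4 h5 => ?_⟩
  · change degX x (splitQuotient pd q (pderiv x q) x i) = degX x q - i at h3
    omega
  · exact ThomasDecomposition.splitQuotient_pderiv pd hq hlt h4
      (hS.evalAt_res_of_lt_quasiFiberCard hq hle hd ha) h5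

/-- An equation replaces an inequation, which returns to the queue. The slot acquires an equation,
or else an effective equation of smaller leader is added. -/
theorem exists_isSplitting_treatEquation_of_ne [CharZero F] (hS : IsRegularAt pd S x)
    (ht : slot S.T x = some (Constraint.ne t)) (hq : leader q = x)
    (hi : reduce pd S.T (init q) ≠ 0) :
    ∃ L, treatEquation pd S q x = branchSystems S x L ∧
      IsSplitting pd S x (Constraint.eq q) L := by
  classical
  have htx : leader t = x := leader_of_slot ht
  have hql : leader (init q) < x := (leader_init_lt hq).trans_eq hq
  obtain ⟨hA, hr, hr0, key⟩ := hS.splitQuotient_pderiv hq hi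
  refine ⟨_, treatEquation_of_ne hS.triangular ht, ?_⟩
  set r := res q (pderiv x q) x (quasiFiberCard pd S.T q (pderiv x q) x)
  set A := splitQuotient pd q (pderiv x q) x (quasiFiberCard pd S.T q (pderiv x q) x)
  refine ⟨?_, ?_, ?_, ?_, ?_, ?_, ?_⟩
  · simp [Constraint.poly, hA]
  · simp [Constraint.poly, or_imp, forall_and, hq.le, htx.le, hql.le, hr.le]
  · intro a ha
    simp only [List.forall_mem_cons, ht, Branch.Holds, Option.mem_def, Option.some.injEq,
      forall_eq', Finset.forall_mem_union, forall_mem_singleton_finset, Constraint.Holds]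
    exact ⟨fun h => ⟨h.2.1.1, (key a ha h.2.1.2 h.2.2).2.2.1 h.1⟩,
      fun h => ⟨h.2.1.1, h.2.2⟩, fun h => ⟨h.2.1.1.1, h.2.2⟩, by simp⟩
  · intro a ha h1 h2
    simp only [List.exists_mem_cons_iff, ht, Branch.Holds, Option.mem_def, Option.some.injEq,
      forall_eq', Finset.forall_mem_union, forall_mem_singleton_finset,
      Constraint.Holds, reduceCtorEq, false_imp_iff,
      implies_true, true_and] at h1 h2 ⊢
    by_cases h3 : evalAt a (init q) = 0
    · exact Or.inr (Or.inl ⟨⟨h1, h3⟩, h2⟩)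
    by_cases h4 : evalAt a r = 0
    · exact Or.inr (Or.inr (Or.inl ⟨⟨⟨h1, h3⟩, h4⟩, h2⟩))
    · exact Or.inl ⟨(key a ha h3 h4).2.2.2 h2, ⟨h1, h3⟩, h4⟩
  · simp +contextual [Branch.Holds, Constraint.Holds, or_imp, forall_and]
  · intro a ha
    simp only [List.forall_mem_cons, Option.mem_def, Option.some.injEq,
      forall_eq', Finset.forall_mem_union, forall_mem_singleton_finset, Constraint.Holds,
      Constraint.poly, reduceCtorEq, false_imp_iff, implies_true, true_and]
    exact ⟨fun h => ⟨(key a ha (h.1.2 hql) (h.2 hr)).1, (key a ha (h.1.2 hql) (h.2 hr)).2.1⟩,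
      by simp⟩
  · simp only [List.forall_mem_cons, ht]
    exact ⟨Or.inl ⟨_, rfl, by simp⟩, Or.inr ⟨by simp, Or.inl ⟨init q, by simp, hi, hql⟩⟩,
      Or.inr ⟨by simp, Or.inl ⟨r, by simp, hr0, hr⟩⟩, by simp⟩

theorem exists_isSplitting_treatEquation_of_none [CharZero F] (hS : IsRegularAt pd S x)
    (ht : slot S.T x = none) (hq : leader q = x) (hi : reduce pd S.T (init q) ≠ 0) :
    ∃ L, treatEquation pd S q x = branchSystems S x L ∧
      IsSplitting pd S x (Constraint.eq q) L := by
  classical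
  have hql : leader (init q) < x := (leader_init_lt hq).trans_eq hq
  obtain ⟨hA, hr, hr0, key⟩ := hS.splitQuotient_pderiv hq hi
  refine ⟨_, treatEquation_of_none hS.triangular ht, ?_⟩
  set r := res q (pderiv x q) x (quasiFiberCard pd S.T q (pderiv x q) x)
  set A := splitQuotient pd q (pderiv x q) x (quasiFiberCard pd S.T q (pderiv x q) x)
  refine ⟨?_, ?_, ?_, ?_, ?_, ?_, ?_⟩
  · simp [Constraint.poly, hA]
  · simp [Constraint.poly, or_imp, forall_and, hq.le, hql.le, hr.le]
  · intro a ha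
    simp only [List.forall_mem_cons, ht, Branch.Holds, Option.mem_def, Option.some.injEq,
      forall_eq', Finset.forall_mem_union, forall_mem_singleton_finset,
      Constraint.Holds, reduceCtorEq, false_imp_iff,
      implies_true, true_and]
    exact ⟨fun h => (key a ha h.2.1 h.2.2).2.2.1 h.1, fun h => h.2, fun h => h.2, by simp⟩
  · intro a ha h1 h2
    simp only [List.exists_mem_cons_iff, Branch.Holds, Option.mem_def, Option.some.injEq,
      forall_eq', Finset.forall_mem_union, forall_mem_singleton_finset,
      Constraint.Holds, reduceCtorEq, false_imp_iff,
      implies_true, true_and] at h2 ⊢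
    by_cases h3 : evalAt a (init q) = 0
    · exact Or.inr (Or.inl ⟨h3, h2⟩)
    by_cases h4 : evalAt a r = 0
    · exact Or.inr (Or.inr (Or.inl ⟨⟨h3, h4⟩, h2⟩))
    · exact Or.inl ⟨(key a ha h3 h4).2.2.2 h2, h3, h4⟩
  · simp +contextual [Branch.Holds, Constraint.Holds, or_imp, forall_and]
  · intro a ha
    simp only [List.forall_mem_cons, Option.mem_def, Option.some.injEq,
      forall_eq', Finset.forall_mem_union, forall_mem_singleton_finset, Constraint.Holds,
      Constraint.poly, reduceCtorEq, false_imp_iff, implies_true, true_and]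
    exact ⟨fun h => ⟨(key a ha (h.1 hql) (h.2 hr)).1, (key a ha (h.1 hql) (h.2 hr)).2.1⟩,
      by simp⟩
  · simp only [List.forall_mem_cons, ht]
    exact ⟨Or.inl ⟨_, rfl, by simp⟩, Or.inr ⟨by simp, Or.inl ⟨init q, by simp, hi, hql⟩⟩,
      Or.inr ⟨by simp, Or.inl ⟨r, by simp, hr0, hr⟩⟩, by simp⟩

theorem exists_isSplitting_treatInequation_of_none [CharZero F] (hS : IsRegularAt pd S x)
    (ht : slot S.T x = none) (hq : leader q = x) (hi : reduce pd S.T (init q) ≠ 0) :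
    ∃ L, treatInequation pd S q x = branchSystems S x L ∧
      IsSplitting pd S x (Constraint.ne q) L := by
  classical
  have hql : leader (init q) < x := (leader_init_lt hq).trans_eq hq
  obtain ⟨hA, hr, hr0, key⟩ := hS.splitQuotient_pderiv hq hi
  refine ⟨_, treatInequation_of_none hS.triangular ht, ?_⟩
  set r := res q (pderiv x q) x (quasiFiberCard pd S.T q (pderiv x q) x)
  set A := splitQuotient pd q (pderiv x q) x (quasiFiberCard pd S.T q (pderiv x q) x)
  refine ⟨?_, ?_, ?_, ?_, ?_, ?_, ?_⟩
  · simp [Constraint.poly, hA]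
  · simp [Constraint.poly, or_imp, forall_and, hq.le, hql.le, hr.le]
  · intro a ha
    simp only [List.forall_mem_cons, ht, Branch.Holds, Option.mem_def, Option.some.injEq,
      forall_eq', Finset.forall_mem_union, forall_mem_singleton_finset,
      Constraint.Holds, reduceCtorEq, false_imp_iff,
      implies_true, true_and]
    exact ⟨fun h => mt (key a ha h.2.1 h.2.2).2.2.2 h.1, fun h => h.2, fun h => h.2, by simp⟩
  · intro a ha h1 h2
    simp only [List.exists_mem_cons_iff, Branch.Holds, Option.mem_def, Option.some.injEq,
      forall_eq', Finset.forall_mem_union, forall_mem_singleton_finset,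
      Constraint.Holds, reduceCtorEq, false_imp_iff,
      implies_true, true_and] at h2 ⊢
    by_cases h3 : evalAt a (init q) = 0
    · exact Or.inr (Or.inl ⟨h3, h2⟩)
    by_cases h4 : evalAt a r = 0
    · exact Or.inr (Or.inr (Or.inl ⟨⟨h3, h4⟩, h2⟩))
    · exact Or.inl ⟨mt (key a ha h3 h4).2.2.1 h2, h3, h4⟩
  · simp +contextual [Branch.Holds, Constraint.Holds, or_imp, forall_and]
  · intro a ha
    simp only [List.forall_mem_cons, Option.mem_def, Option.some.injEq,
      forall_eq', Finset.forall_mem_union, forall_mem_singleton_finset, Constraint.Holds,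
      Constraint.poly, reduceCtorEq, false_imp_iff, implies_true, true_and]
    exact ⟨fun h => ⟨(key a ha (h.1 hql) (h.2 hr)).1, (key a ha (h.1 hql) (h.2 hr)).2.1⟩,
      by simp⟩
  · simp only [List.forall_mem_cons, ht]
    refine ⟨Or.inr ⟨by simp, Or.inr ⟨⟨q, rfl⟩, ?_, ?_⟩⟩,
      Or.inr ⟨by simp, Or.inl ⟨init q, by simp, hi, hql⟩⟩,
      Or.inr ⟨by simp, Or.inl ⟨r, by simp, hr0, hr⟩⟩, by simp⟩
    · simp [or_imp, forall_and, hql, hr]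
    · exact (Finset.card_union_le _ _).trans (by simp)

/-- An inequation meets an equation: the roots of `q` are divided out of `t`. -/
theorem exists_isSplitting_treatInequation_of_eq (hS : IsRegularAt pd S x)
    (ht : slot S.T x = some (Constraint.eq t)) (hq : leader q = x) (hd : degX x q < degX x t)
    (hi : reduce pd S.T (init q) ≠ 0) :
    ∃ L, treatInequation pd S q x = branchSystems S x L ∧
      IsSplitting pd S x (Constraint.ne q) L := by
  classical
  have htx : leader t = x := leader_of_slot ht
  have hat : ∀ a ∈ Sol (below S.toAlgSystem x), evalAt a (init t) ≠ 0 :=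
    hS.init_ne_zero (Constraint.eq t) ht
  have hst : ∀ a ∈ Sol (below S.toAlgSystem x), Squarefree (evalBelow x a t) :=
    hS.squarefree (Constraint.eq t) ht
  refine ⟨_, treatInequation_of_eq hS.triangular ht hd, ?_⟩
  have hspec := quasiFiberCard_spec pd S.T (p := t) (q := q) (x := x)
  have hle := quasiFiberCard_le_degX pd S.T (p := t) (q := q) (x := x)
  have hleq := quasiFiberCard_le_degX_right pd S.T hq hd hi
  have hr0 := res_quasiFiberCard_ne_zero pd S.T (p := t) (q := q) (x := x)
  have hz := fun a (ha : a ∈ Sol (below S.toAlgSystem x)) =>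
    hS.evalAt_res_of_lt_quasiFiberCard htx hq.le hd ha
  set i := quasiFiberCard pd S.T t q x
  have hr := leader_res_lt htx hq.le hd hle
  obtain ⟨h1, h2, h3⟩ := splitQuotient_spec pd htx hq.le hd hle hr0
  have hA : leader (splitQuotient pd t q x i) = x := (leader_eq_iff h1).2 (by omega)
  have key : ∀ a ∈ Sol (below S.toAlgSystem x), evalAt a (res t q x i) ≠ 0 →
      evalAt a (init (splitQuotient pd t q x i)) ≠ 0 ∧
      Squarefree (evalBelow x a (splitQuotient pd t q x i)) ∧
      (evalAt a (splitQuotient pd t q x i) = 0 ↔ evalAt a t = 0 ∧ evalAt a q ≠ 0) := by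
    intro a ha hr
    obtain ⟨h4, h5, h6⟩ := splitQuotient_of_squarefree pd htx hq.le hd hle (hat a ha) (hst a ha)
      (hz a ha) hr
    refine ⟨(evalAt_init_ne_zero_iff hA a).2 h4, h5, ?_⟩
    have h7 := h6 (a x)
    rwa [eval_evalBelow, eval_evalBelow, eval_evalBelow] at h7
  refine ⟨?_, ?_, ?_, ?_, ?_, ?_, ?_⟩
  · simp [Constraint.poly, hA, htx]
  · simp [Constraint.poly, hq.le, hr.le]
  · intro a ha
    simp only [List.forall_mem_cons, ht, Branch.Holds, Option.mem_def, Option.some.injEq,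
      forall_eq', Finset.forall_mem_union, forall_mem_singleton_finset, Constraint.Holds]
    exact ⟨fun h => ((key a ha h.2).2.2).1 h.1, fun h => ⟨h.1, h.2.2⟩, by simp⟩
  · intro a ha h1 h2
    simp only [List.exists_mem_cons_iff, ht, Branch.Holds, Option.mem_def, Option.some.injEq,
      forall_eq', Finset.forall_mem_union, forall_mem_singleton_finset, Constraint.Holds] at h1 h2 ⊢
    by_cases hr : evalAt a (res t q x i) = 0
    · exact Or.inr (Or.inl ⟨h1, hr, h2⟩)
    · exact Or.inl ⟨(key a ha hr).2.2.2 ⟨h1, h2⟩, hr⟩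
  · simp +contextual [Branch.Holds, Constraint.Holds]
  · intro a ha
    simp only [List.forall_mem_cons, Option.mem_def, Option.some.injEq,
      forall_eq', Finset.forall_mem_union, forall_mem_singleton_finset,
      Constraint.Holds, Constraint.poly]
    exact ⟨fun h => ⟨(key a ha (h hr)).1, (key a ha (h hr)).2.1⟩,
      fun _ => ⟨hat a ha, hst a ha⟩, by simp⟩
  · simp only [List.forall_mem_cons]
    refine ⟨?_, Or.inr ⟨fun r => by rw [ht], Or.inl
      ⟨_, Finset.mem_union_left _ (Finset.mem_singleton_self _), hspec.2, hr⟩⟩, by simp⟩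
    rcases Nat.eq_zero_or_pos i with h | h
    -- for `i = 0` the equation is returned unchanged
    · refine Or.inr ⟨fun r => by rw [ht, splitQuotient, if_neg (by omega)],
        Or.inr ⟨⟨q, rfl⟩, ?_, by simp⟩⟩
      simp [hr]
    · refine Or.inl ⟨_, rfl, fun s hs => ?_⟩
      obtain rfl := Constraint.eq.inj (Option.some.inj (ht.symm.trans hs))
      have := degX_pos htx
      omega

/-- Two inequations are merged into one with the union of their zeros. The generic branch replaces
`q` by three inequations of smaller leader. -/
theorem exists_isSplitting_treatInequation_of_ne [CharZero F] (hS : IsRegularAt pd S x)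
    (ht : slot S.T x = some (Constraint.ne t)) (hq : leader q = x)
    (hi : reduce pd S.T (init q) ≠ 0) :
    ∃ L, treatInequation pd S q x = branchSystems S x L ∧
      IsSplitting pd S x (Constraint.ne q) L := by
  classical
  have htx : leader t = x := leader_of_slot ht
  have hat : ∀ a ∈ Sol (below S.toAlgSystem x), evalAt a (init t) ≠ 0 :=
    hS.init_ne_zero (Constraint.ne t) ht
  have hst : ∀ a ∈ Sol (below S.toAlgSystem x), Squarefree (evalBelow x a t) :=
    hS.squarefree (Constraint.ne t) ht
  have hql : leader (init q) < x := (leader_init_lt hq).trans_eq hq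
  obtain ⟨hA, hr, hr0, key⟩ := hS.splitQuotient_pderiv hq hi
  refine ⟨_, treatInequation_of_ne hS.triangular ht, ?_⟩
  set r := res q (pderiv x q) x (quasiFiberCard pd S.T q (pderiv x q) x)
  set p := splitQuotient pd q (pderiv x q) x (quasiFiberCard pd S.T q (pderiv x q) x)
  have hq' := leader_divideArgument_le pd htx hA
  have hd' := degX_divideArgument_lt pd htx hA
  have hle := quasiFiberCard_le_degX pd S.T (p := t) (q := divideArgument pd t p x) (x := x)
  have hs := leader_res_lt htx hq' hd' hle
  have hs0 := (quasiFiberCard_spec pd S.T (p := t) (q := divideArgument pd t p x) (x := x)).2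
  have hz := fun a (ha : a ∈ Sol (below S.toAlgSystem x)) =>
    hS.evalAt_res_of_lt_quasiFiberCard htx hq' hd' ha
  have hsne := res_quasiFiberCard_ne_zero pd S.T (p := t) (q := divideArgument pd t p x) (x := x)
  have hB : leader (splitQuotient pd t (divideArgument pd t p x) x
      (quasiFiberCard pd S.T t (divideArgument pd t p x) x) * p) = x := by
    obtain ⟨h1, h2, -⟩ := splitQuotient_spec pd htx hq' hd' hle hsne
    rw [leader_eq_iff (leader_mul_le h1 hA.le), degX_mul h2 (ne_zero_of_leader hA)]
    have := degX_pos hA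
    omega
  have key' := fun a (ha : a ∈ Sol (below S.toAlgSystem x)) (h1 : evalAt a (init q) ≠ 0)
      (h2 : evalAt a r ≠ 0) =>
    mul_splitQuotient_of_squarefree pd htx hA hle (hat a ha) (hst a ha)
      (key a ha h1 h2).1 (key a ha h1 h2).2.1 (hz a ha)
  set s := res t (divideArgument pd t p x) x
    (quasiFiberCard pd S.T t (divideArgument pd t p x) x)
  set B := splitQuotient pd t (divideArgument pd t p x) x
    (quasiFiberCard pd S.T t (divideArgument pd t p x) x) * p
  refine ⟨?_, ?_, ?_, ?_, ?_, ?_, ?_⟩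
  · simp [Constraint.poly, hB, htx]
  · simp [Constraint.poly, or_imp, forall_and, hq.le, hql.le, hr.le, hs.le, hA.le]
  · intro a ha
    simp only [List.forall_mem_cons, ht, Branch.Holds, Option.mem_def, Option.some.injEq,
      forall_eq', Finset.forall_mem_union, forall_mem_singleton_finset, Constraint.Holds]
    refine ⟨fun h => ?_, fun h => ⟨h.1, h.2.2⟩, fun h => ⟨h.1, h.2.2⟩,
      fun h => ⟨h.1, mt (key a ha h.2.1.1.1 h.2.1.1.2).2.2.2 h.2.2⟩, by simp⟩
    obtain ⟨h1, ⟨h2, h3⟩, h4⟩ := h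
    have h5 := mt (key' a ha h2 h3 h4).2.2.2.2 h1
    rw [not_or] at h5
    exact ⟨h5.1, mt (key a ha h2 h3).2.2.2 h5.2⟩
  · intro a ha h1 h2
    simp only [List.exists_mem_cons_iff, ht, Branch.Holds, Option.mem_def, Option.some.injEq,
      forall_eq', Finset.forall_mem_union, forall_mem_singleton_finset, Constraint.Holds] at h1 h2 ⊢
    by_cases h3 : evalAt a (init q) = 0
    · exact Or.inr (Or.inl ⟨h1, h3, h2⟩)
    by_cases h4 : evalAt a r = 0
    · exact Or.inr (Or.inr (Or.inl ⟨h1, ⟨h3, h4⟩, h2⟩))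
    have h6 := mt (key a ha h3 h4).2.2.1 h2
    by_cases h5 : evalAt a s = 0
    · exact Or.inr (Or.inr (Or.inr (Or.inl ⟨h1, ⟨⟨h3, h4⟩, h5⟩, h6⟩)))
    · refine Or.inl ⟨mt (key' a ha h3 h4 h5).2.2.2.1 ?_, ⟨h3, h4⟩, h5⟩
      exact not_or.2 ⟨h1, h6⟩
  · simp +contextual [Branch.Holds, Constraint.Holds, or_imp, forall_and]
  · intro a ha
    simp only [List.forall_mem_cons, Option.mem_def, Option.some.injEq,
      forall_eq', Finset.forall_mem_union, forall_mem_singleton_finset,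
      Constraint.Holds, Constraint.poly]
    refine ⟨fun h => ?_, fun _ => ⟨hat a ha, hst a ha⟩, fun _ => ⟨hat a ha, hst a ha⟩,
      fun _ => ⟨hat a ha, hst a ha⟩, by simp⟩
    have h1 := key' a ha (h.1.1 hql) (h.1.2 hr) (h.2 hs)
    exact ⟨h1.2.1, h1.2.2.1⟩
  · simp only [List.forall_mem_cons, ht]
    refine ⟨Or.inr ⟨by simp, Or.inr ⟨⟨q, rfl⟩, ?_, ?_⟩⟩,
      Or.inr ⟨by simp, Or.inl ⟨init q, by simp, hi, hql⟩⟩,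
      Or.inr ⟨by simp, Or.inl ⟨r, by simp, hr0, hr⟩⟩,
      Or.inr ⟨by simp, Or.inl ⟨s, by simp, hs0, hs⟩⟩, by simp⟩
    · simp [or_imp, forall_and, hql, hr, hs]
    · refine (Finset.card_union_le _ _).trans
        ((add_le_add (Finset.card_union_le _ _) le_rfl).trans ?_)
      simp

theorem exists_isSplitting_treatEquation [CharZero F] (hS : IsRegularAt pd S x)
    (hq : leader q = x) (hd : ∀ t, slot S.T x = some (Constraint.eq t) → degX x q < degX x t)
    (hi : reduce pd S.T (init q) ≠ 0) :
    ∃ L, treatEquation pd S q x = branchSystems S x L ∧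
      IsSplitting pd S x (Constraint.eq q) L := by
  rcases h : slot S.T x with _ | (t | t)
  · exact exists_isSplitting_treatEquation_of_none hS h hq hi
  · exact exists_isSplitting_treatEquation_of_eq hS h hq (hd t h) hi
  · exact exists_isSplitting_treatEquation_of_ne hS h hq hi

theorem exists_isSplitting_treatInequation [CharZero F] (hS : IsRegularAt pd S x)
    (hq : leader q = x) (hd : ∀ t, slot S.T x = some (Constraint.eq t) → degX x q < degX x t)
    (hi : reduce pd S.T (init q) ≠ 0) :
    ∃ L, treatInequation pd S q x = branchSystems S x L ∧
      IsSplitting pd S x (Constraint.ne q) L := by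
  rcases h : slot S.T x with _ | (t | t)
  · exact exists_isSplitting_treatInequation_of_none hS h hq hi
  · exact exists_isSplitting_treatInequation_of_eq hS h hq (hd t h) hi
  · exact exists_isSplitting_treatInequation_of_ne hS h hq hi

end TreatSpec

/-! ### From the local to the global case distinction -/

section Global

open MvPolynomial

variable {F : Type u} [Field F] {σ : Type v}

theorem mem_toAlgSystem {S : PairSystem F σ} {c : Constraint F σ} :
    c ∈ S.toAlgSystem ↔ c ∈ S.T ∨ c ∈ S.Q := by
  simp [PairSystem.toAlgSystem]

theorem poly_withPoly (c : Constraint F σ) (p : MvPolynomial σ F) :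
    (c.withPoly p).poly = p := by
  cases c <;> rfl

open Classical in
/-- The system `S` without the constraint `q` in the queue. -/
noncomputable def eraseQueue (S : PairSystem F σ) (q : Constraint F σ) : PairSystem F σ :=
  ⟨S.T, S.Q.erase q⟩

theorem mem_eraseQueue_Q {S : PairSystem F σ} {q c : Constraint F σ} :
    c ∈ (eraseQueue S q).Q ↔ c ≠ q ∧ c ∈ S.Q := by
  simp [eraseQueue]

variable [LinearOrder σ]

/-- The constraints of `S` whose leader satisfies `D` hold at `a`. -/
def HoldsOn (D : WithBot σ → Prop) (S : AlgSystem F σ) (a : σ → AlgebraicClosure F) : Prop :=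
  ∀ c ∈ S, D (leader c.poly) → c.Holds a

/-- `D` is closed under passing to smaller leaders. -/
def IsLowerPred (D : WithBot σ → Prop) : Prop := ∀ ⦃y z⦄, y ≤ z → D z → D y

theorem isLowerPred_lt (x : WithBot σ) : IsLowerPred (· < x) := fun _ _ h h' => h.trans_lt h'

theorem isLowerPred_true : IsLowerPred fun _ : WithBot σ => True := fun _ _ _ _ => trivial

theorem mem_sol_below {S : AlgSystem F σ} {x : σ} {a : σ → AlgebraicClosure F} :
    a ∈ Sol (below S x) ↔ HoldsOn (· < (x : WithBot σ)) S a := by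
  simp [Sol, below, HoldsOn]

theorem mem_sol_iff {S : AlgSystem F σ} {a : σ → AlgebraicClosure F} :
    a ∈ Sol S ↔ HoldsOn (fun _ => True) S a := by
  simp [Sol, HoldsOn]

/-- The loop invariant for a single system: its triangular part is triangular, and the initials
do not vanish and the square-freeness holds over the solutions of all lower-ranking constraints,
those in the queue included. -/
structure IsRegular (S : PairSystem F σ) : Prop where
  triangular : IsTriangular S.T
  init_ne_zero : ∀ (x : σ), ∀ c ∈ S.T, leader c.poly = x → ∀ a ∈ Sol (below S.toAlgSystem x),
    evalAt a (init c.poly) ≠ 0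
  squarefree : ∀ (x : σ), ∀ c ∈ S.T, leader c.poly = x → ∀ a ∈ Sol (below S.toAlgSystem x),
    Squarefree (evalBelow x a c.poly)

theorem IsRegular.isSimple {S : PairSystem F σ} (hS : IsRegular S) (hQ : S.Q = ∅) :
    IsSimple S.toAlgSystem := by
  classical
  have h : S.toAlgSystem = S.T := by
    ext c
    simp [PairSystem.toAlgSystem, hQ]
  refine ⟨h ▸ hS.triangular, fun x c hc a ha => ?_, fun x c hc a ha => ?_⟩
  all_goals
    rw [h] at hc
    have hc' := Finset.mem_filter.1 hc
  · exact hS.init_ne_zero x c hc'.1 hc'.2 a ha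
  · exact hS.squarefree x c hc'.1 hc'.2 a ha

theorem mem_replaceAt_T {S : PairSystem F σ} {x : σ} {o : Option (Constraint F σ)}
    {E : AlgSystem F σ} {c : Constraint F σ} :
    c ∈ (replaceAt S x o E).T ↔ c ∈ S.T ∧ leader c.poly ≠ x ∨ c ∈ o := by
  simp [replaceAt]

theorem mem_replaceAt_Q {S : PairSystem F σ} {x : σ} {o : Option (Constraint F σ)}
    {E : AlgSystem F σ} {c : Constraint F σ} :
    c ∈ (replaceAt S x o E).Q ↔ c ∈ S.Q ∨ c ∈ E := by
  simp [replaceAt]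

theorem isTriangular_replaceAt {S : PairSystem F σ} (hS : IsTriangular S.T) {x : σ}
    {o : Option (Constraint F σ)} (ho : ∀ c ∈ o, leader c.poly = x) (E : AlgSystem F σ) :
    IsTriangular (replaceAt S x o E).T := by
  classical
  have hC : ∀ c ∈ (replaceAt S x o E).T, (∀ k : F, c.poly = C k → c ∈ S.T) := by
    intro c hc k hk
    rcases mem_replaceAt_T.1 hc with h | h
    · exact h.1
    · have h1 := ho c h
      rw [hk, leader_C] at h1
      exact absurd h1 WithBot.bot_ne_coe
  refine ⟨fun y => Finset.card_le_one.2 fun c hc d hd => ?_,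
    fun k => ⟨fun h => (hS.2 k).1 (hC _ h k rfl), fun h => (hS.2 k).2 (hC _ h k rfl)⟩⟩
  obtain ⟨hc1, hc2⟩ := Finset.mem_filter.1 hc
  obtain ⟨hd1, hd2⟩ := Finset.mem_filter.1 hd
  rcases mem_replaceAt_T.1 hc1 with h1 | h1 <;> rcases mem_replaceAt_T.1 hd1 with h2 | h2
  · exact hS.eq_of_leader h1.1 h2.1 hc2 hd2
  · exact absurd (hc2.trans (hd2.symm.trans (ho d h2))) h1.2
  · exact absurd (hd2.trans (hc2.symm.trans (ho c h1))) h2.2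
  · exact Option.mem_unique h1 h2

theorem slot_replaceAt_self {S : PairSystem F σ} (hS : IsTriangular S.T) {x : σ}
    {o : Option (Constraint F σ)} (ho : ∀ c ∈ o, leader c.poly = x) (E : AlgSystem F σ) :
    slot (replaceAt S x o E).T x = o := by
  ext c
  rw [slot_eq_some_iff (isTriangular_replaceAt hS ho E), mem_replaceAt_T]
  have := ho c
  simp only [Option.mem_def] at this ⊢
  tauto

theorem slot_replaceAt_of_ne {S : PairSystem F σ} (hS : IsTriangular S.T) {x y : σ}
    {o : Option (Constraint F σ)} (ho : ∀ c ∈ o, leader c.poly = x) (E : AlgSystem F σ)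
    (hy : y ≠ x) : slot (replaceAt S x o E).T y = slot S.T y := by
  ext c
  rw [slot_eq_some_iff (isTriangular_replaceAt hS ho E), slot_eq_some_iff hS, mem_replaceAt_T]
  have h1 := ho c
  have h2 : (y : WithBot σ) ≠ x := fun h => hy (WithBot.coe_injective h)
  constructor
  · rintro ⟨h3 | h3, h4⟩
    · exact ⟨h3.1, h4⟩
    · exact absurd (h4.symm.trans (h1 h3)) h2
  · rintro ⟨h3, h4⟩
    exact ⟨Or.inl ⟨h3, h4 ▸ h2⟩, h4⟩

theorem holdsOn_eraseQueue {S : PairSystem F σ} {q : Constraint F σ} {D : WithBot σ → Prop}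
    {a : σ → AlgebraicClosure F} (hq : D (leader q.poly) → q.Holds a)
    (h : HoldsOn D (eraseQueue S q).toAlgSystem a) : HoldsOn D S.toAlgSystem a := by
  intro c hc hD
  by_cases hcq : c = q
  · subst hcq
    exact hq hD
  · refine h c ?_ hD
    rw [mem_toAlgSystem, mem_eraseQueue_Q]
    exact (mem_toAlgSystem.1 hc).imp id fun h => ⟨hcq, h⟩

theorem HoldsOn.eraseQueue {S : PairSystem F σ} {q : Constraint F σ} {D : WithBot σ → Prop}
    {a : σ → AlgebraicClosure F} (h : HoldsOn D S.toAlgSystem a) :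
    HoldsOn D (ThomasDecomposition.eraseQueue S q).toAlgSystem a := by
  intro c hc hD
  refine h c ?_ hD
  rw [mem_toAlgSystem, mem_eraseQueue_Q] at hc
  exact mem_toAlgSystem.2 (hc.imp id fun h => h.2)

theorem sol_below_eraseQueue {S : PairSystem F σ} {q₀ : Constraint F σ} {x : σ}
    (hx : (x : WithBot σ) ≤ leader q₀.poly) {a : σ → AlgebraicClosure F}
    (ha : a ∈ Sol (below (eraseQueue S q₀).toAlgSystem x)) :
    a ∈ Sol (below S.toAlgSystem x) :=
  mem_sol_below.2 (holdsOn_eraseQueue (fun h => absurd h (not_lt.2 hx)) (mem_sol_below.1 ha))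

theorem mem_branchSystems {S S' : PairSystem F σ} {x : σ} {L : List (Branch F σ)} :
    S' ∈ branchSystems S x L ↔ ∃ d ∈ L, replaceAt S x d.1 d.2 = S' := by
  simp [branchSystems]

variable [Finite σ] {pd : PseudoDivision F σ} {S : PairSystem F σ} {q₀ : Constraint F σ}

/-- A constraint taken from the queue may be replaced by its reduction: the initials occurring
in the pseudo division do not vanish, since only constraints of smaller leader matter for
them. -/
theorem holds_reduce_iff (hS : IsRegular S) {D : WithBot σ → Prop} (hD : IsLowerPred D)
    {a : σ → AlgebraicClosure F} (ha : HoldsOn D (eraseQueue S q₀).toAlgSystem a)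
    (hq : D (leader q₀.poly)) :
    (q₀.withPoly (reduce pd S.T q₀.poly)).Holds a ↔ q₀.Holds a := by
  have key : evalAt a (reduce pd S.T q₀.poly) = 0 ↔ evalAt a q₀.poly = 0 := by
    refine evalAt_reduce_eq_zero_iff pd S.T _ fun x t hx ht => ?_
    have h1 := mem_of_slot ht
    have h2 : leader t = x := leader_of_slot ht
    refine ⟨ha (Constraint.eq t) (mem_toAlgSystem.2 (Or.inl h1)) ?_,
      hS.init_ne_zero x (Constraint.eq t) h1 h2 a (mem_sol_below.2 fun c hc hcx => ?_)⟩
    · exact hD (h2.trans_le hx) hq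
    · refine ha c ?_ (hD (hcx.le.trans hx) hq)
      rw [mem_toAlgSystem, mem_eraseQueue_Q]
      refine (mem_toAlgSystem.1 hc).imp id fun h => ⟨?_, h⟩
      rintro rfl
      exact absurd hx (not_le.2 hcx)
  cases q₀ with
  | eq p => exact key
  | ne p => exact not_congr key

/-- The global invariant yields the local hypotheses at each `x` up to the leader of the selected
constraint: below `x`, nothing is lost by removing this constraint from the queue. -/
theorem IsRegular.isRegularAt (hS : IsRegular S) {x : σ}
    (hx : (x : WithBot σ) ≤ leader q₀.poly) : IsRegularAt pd (eraseQueue S q₀) x where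
  triangular := hS.triangular
  init_ne_zero c hc a ha :=
    hS.init_ne_zero x c (mem_of_slot hc) (leader_of_slot hc) a (sol_below_eraseQueue hx ha)
  squarefree c hc a ha :=
    hS.squarefree x c (mem_of_slot hc) (leader_of_slot hc) a (sol_below_eraseQueue hx ha)
  evalAt_eq_zero p hp h0 a ha := by
    have ha' := mem_sol_below.1 (sol_below_eraseQueue hx ha)
    change reduce pd S.T p = 0 at h0
    rw [← evalAt_reduce_eq_zero_iff pd S.T p, h0, evalAt_zero]
    intro y t hy ht
    have h1 := mem_of_slot ht
    have h2 : leader t = y := leader_of_slot ht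
    refine ⟨ha' (Constraint.eq t) (mem_toAlgSystem.2 (Or.inl h1)) (h2.trans_lt (hy.trans_lt hp)),
      hS.init_ne_zero y (Constraint.eq t) h1 h2 a (mem_sol_below.2 fun c hc hcx => ?_)⟩
    exact ha' c hc (hcx.trans_le (hy.trans hp.le))

variable {x : σ} {L : List (Branch F σ)} {d : Branch F σ}

/-- The constraints of a branch imply those of `S`. This holds for each lower set of leaders
separately, as the invariants of `S` at `y` speak of the constraints with leader below `y` only. A
lower set that contains the leader of the selected constraint contains `x`. -/
theorem holdsOn_of_replaceAt (hS : IsRegular S) (hx : (x : WithBot σ) ≤ leader q₀.poly)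
    (hL : IsSplitting pd (eraseQueue S q₀) x (q₀.withPoly (reduce pd S.T q₀.poly)) L)
    (hd : d ∈ L) {D : WithBot σ → Prop} (hD : IsLowerPred D) {a : σ → AlgebraicClosure F}
    (ha : HoldsOn D (replaceAt (eraseQueue S q₀) x d.1 d.2).toAlgSystem a) :
    HoldsOn D S.toAlgSystem a := by
  have hT : ∀ c ∈ S.T, leader c.poly ≠ x → D (leader c.poly) → c.Holds a := fun c h1 h2 h3 =>
    ha c (mem_toAlgSystem.2 (Or.inl (mem_replaceAt_T.2 (Or.inl ⟨h1, h2⟩)))) h3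
  have hQ : ∀ c ∈ (eraseQueue S q₀).Q, D (leader c.poly) → c.Holds a := fun c h1 h2 =>
    ha c (mem_toAlgSystem.2 (Or.inr (mem_replaceAt_Q.2 (Or.inl h1)))) h2
  by_cases hDx : D x
  · have hbase : a ∈ Sol (below (eraseQueue S q₀).toAlgSystem x) := by
      refine mem_sol_below.2 fun c hc hcx => ?_
      rcases mem_toAlgSystem.1 hc with h | h
      · exact hT c h hcx.ne (hD hcx.le hDx)
      · exact hQ c h (hD hcx.le hDx)
    have hda : d.Holds a :=
      ⟨fun c hc => ha c (mem_toAlgSystem.2 (Or.inl (mem_replaceAt_T.2 (Or.inr hc))))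
        ((hL.leader_slot d hd c hc).symm ▸ hDx),
      fun e he => ha e (mem_toAlgSystem.2 (Or.inr (mem_replaceAt_Q.2 (Or.inr he))))
        (hD (hL.leader_queue d hd e he) hDx)⟩
    obtain ⟨h1, h2⟩ := hL.sound a hbase d hd hda
    have h3 : HoldsOn D (eraseQueue S q₀).toAlgSystem a := by
      intro c hc hDc
      rcases mem_toAlgSystem.1 hc with h | h
      · by_cases hcx : leader c.poly = x
        · exact h1 c ((slot_eq_some_iff hS.triangular).2 ⟨h, hcx⟩)
        · exact hT c h hcx hDc
      · exact hQ c h hDc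
    exact holdsOn_eraseQueue (fun h => (holds_reduce_iff hS hD h3 h).1 h2) h3
  · refine holdsOn_eraseQueue (fun h => absurd (hD hx h) hDx) fun c hc hDc => ?_
    rcases mem_toAlgSystem.1 hc with h | h
    · exact hT c h (fun h' => hDx (h' ▸ hDc)) hDc
    · exact hQ c h hDc

/-- A case distinction at `x` preserves the loop invariant: away from `x` since the constraints of
a branch imply those of `S`, at `x` by the local analysis. -/
theorem isRegular_replaceAt (hS : IsRegular S) (hx : (x : WithBot σ) ≤ leader q₀.poly)
    (hL : IsSplitting pd (eraseQueue S q₀) x (q₀.withPoly (reduce pd S.T q₀.poly)) L)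
    (hd : d ∈ L) : IsRegular (replaceAt (eraseQueue S q₀) x d.1 d.2) := by
  have key : ∀ (y : σ), ∀ c ∈ (replaceAt (eraseQueue S q₀) x d.1 d.2).T, leader c.poly = y →
      ∀ a ∈ Sol (below (replaceAt (eraseQueue S q₀) x d.1 d.2).toAlgSystem y),
      evalAt a (init c.poly) ≠ 0 ∧ Squarefree (evalBelow y a c.poly) := by
    intro y c hc hcy a ha
    have ha' := mem_sol_below.2
      (holdsOn_of_replaceAt hS hx hL hd (isLowerPred_lt _) (mem_sol_below.1 ha))
    rcases mem_replaceAt_T.1 hc with h | h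
    · exact ⟨hS.init_ne_zero y c h.1 hcy a ha', hS.squarefree y c h.1 hcy a ha'⟩
    · obtain rfl : y = x := WithBot.coe_injective (hcy.symm.trans (hL.leader_slot d hd c h))
      refine hL.regular a (mem_sol_below.2 (mem_sol_below.1 ha').eraseQueue) d hd c h
        fun e he hey => ?_
      exact mem_sol_below.1 ha e (mem_toAlgSystem.2 (Or.inr (mem_replaceAt_Q.2 (Or.inr he)))) hey
  exact ⟨isTriangular_replaceAt (S := eraseQueue S q₀) hS.triangular (hL.leader_slot d hd) d.2,
    fun y c hc hy a ha => (key y c hc hy a ha).1, fun y c hc hy a ha => (key y c hc hy a ha).2⟩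

theorem mem_sol_iff_exists_branch (hS : IsRegular S) (hq : q₀ ∈ S.Q)
    (hx : (x : WithBot σ) ≤ leader q₀.poly)
    (hL : IsSplitting pd (eraseQueue S q₀) x (q₀.withPoly (reduce pd S.T q₀.poly)) L)
    (a : σ → AlgebraicClosure F) :
    a ∈ Sol S.toAlgSystem ↔
      ∃ S' ∈ branchSystems (eraseQueue S q₀) x L, a ∈ Sol S'.toAlgSystem := by
  constructor
  · intro ha
    have h1 := (mem_sol_iff.1 ha).eraseQueue (q := q₀)
    obtain ⟨d, hd, hda⟩ : ∃ d ∈ L, d.Holds a := by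
      refine hL.complete a (mem_sol_below.2 fun c hc _ => h1 c hc trivial) (fun c hc => ?_) ?_
      · exact h1 c (mem_toAlgSystem.2 (Or.inl (mem_of_slot hc))) trivial
      · refine (holds_reduce_iff hS isLowerPred_true h1 trivial).2 ?_
        exact ha q₀ (mem_toAlgSystem.2 (Or.inr hq))
    refine ⟨_, mem_branchSystems.2 ⟨d, hd, rfl⟩, mem_sol_iff.2 fun c hc _ => ?_⟩
    rw [mem_toAlgSystem, mem_replaceAt_T, mem_replaceAt_Q] at hc
    rcases hc with (hc | hc) | (hc | hc)
    · exact h1 c (mem_toAlgSystem.2 (Or.inl hc.1)) trivial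
    · exact hda.1 c hc
    · exact h1 c (mem_toAlgSystem.2 (Or.inr hc)) trivial
    · exact hda.2 c hc
  · rintro ⟨S', hS', ha⟩
    obtain ⟨d, hd, rfl⟩ := mem_branchSystems.1 hS'
    exact mem_sol_iff.2 (holdsOn_of_replaceAt hS hx hL hd isLowerPred_true (mem_sol_iff.1 ha))

theorem disjoint_branchSystems {S : PairSystem F σ} {q : Constraint F σ}
    (hL : IsSplitting pd S x q L) {S₁ S₂ : PairSystem F σ} (h₁ : S₁ ∈ branchSystems S x L)
    (h₂ : S₂ ∈ branchSystems S x L) (hne : S₁ ≠ S₂) (a : σ → AlgebraicClosure F)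
    (ha₁ : a ∈ Sol S₁.toAlgSystem) (ha₂ : a ∈ Sol S₂.toAlgSystem) : False := by
  obtain ⟨d₁, hd₁, rfl⟩ := mem_branchSystems.1 h₁
  obtain ⟨d₂, hd₂, rfl⟩ := mem_branchSystems.1 h₂
  have hd : d₁ ≠ d₂ := by
    rintro rfl
    exact hne rfl
  have hh : ∀ d : Branch F σ, a ∈ Sol (replaceAt S x d.1 d.2).toAlgSystem → d.Holds a :=
    fun d h => ⟨fun c hc => h c (mem_toAlgSystem.2 (Or.inl (mem_replaceAt_T.2 (Or.inr hc)))),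
      fun e he => h e (mem_toAlgSystem.2 (Or.inr (mem_replaceAt_Q.2 (Or.inr he))))⟩
  have : Std.Symm fun d d' : Branch F σ => ∀ a, d.Holds a → ¬ d'.Holds a :=
    ⟨fun _ _ h b h1 h2 => h b h2 h1⟩
  exact hL.disjoint.forall hd₁ hd₂ hd a (hh _ ha₁) (hh _ ha₂)

end Global

/-! ### The termination measure of a single system -/

section Measure

open MvPolynomial

variable {F : Type u} [Field F] {σ : Type v} [LinearOrder σ]

/-- The degree of an equation, and `⊤` for an inequation or an empty slot: a new equation counts as
a descent. -/
noncomputable def slotDegree (x : σ) : Option (Constraint F σ) → WithTop ℕ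
  | some (Constraint.eq t) => (degX x t : WithTop ℕ)
  | _ => ⊤

/-- The degrees of the equations of the triangular part of `S`. -/
noncomputable def equationDegrees (S : PairSystem F σ) (x : σ) : WithTop ℕ :=
  slotDegree x (slot S.T x)

theorem slotDegree_congr {x : σ} {o o' : Option (Constraint F σ)}
    (h : ∀ r, o = some (Constraint.eq r) ↔ o' = some (Constraint.eq r)) :
    slotDegree x o = slotDegree x o' := by
  rcases o with _ | (t | t)
  · rcases o' with _ | (t' | t')
    · rfl
    · exact absurd ((h t').2 rfl) (by simp)
    · rfl
  · rw [(h t).1 rfl]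
  · rcases o' with _ | (t' | t')
    · rfl
    · exact absurd ((h t').2 rfl) (by simp)
    · rfl

theorem slotDegree_lt {x : σ} {o : Option (Constraint F σ)} {r : MvPolynomial σ F}
    (h : ∀ t, o = some (Constraint.eq t) → degX x r < degX x t) :
    slotDegree x (some (Constraint.eq r)) < slotDegree x o := by
  rcases o with _ | (t | t)
  · exact WithTop.coe_lt_top _
  · exact WithTop.coe_lt_coe.2 (h t rfl)
  · exact WithTop.coe_lt_top _

/-- The weight of a leader in the weight of a queue. A constraint weighs more than any three
constraints of smaller leader. -/
noncomputable def leaderWeight (y : WithBot σ) : ℕ := 4 ^ (Set.Iio y).ncard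

/-- The weight of the queue. -/
noncomputable def queueWeight (S : PairSystem F σ) : ℕ :=
  ∑ c ∈ S.Q, leaderWeight (leader c.poly)

theorem leaderWeight_pos (y : WithBot σ) : 0 < leaderWeight y := by
  unfold leaderWeight
  positivity

theorem queueWeight_eraseQueue {S : PairSystem F σ} {q : Constraint F σ} (hq : q ∈ S.Q) :
    queueWeight (eraseQueue S q) + leaderWeight (leader q.poly) = queueWeight S := by
  classical
  exact Finset.sum_erase_add S.Q (fun c => leaderWeight (leader c.poly)) hq

variable [Finite σ]

open Classical in
/-- The effective equations in the queue: those that do not reduce to zero. -/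
noncomputable def effectiveEquations (pd : PseudoDivision F σ) (S : PairSystem F σ) :
    AlgSystem F σ :=
  S.Q.filter fun c => ∃ h, c = Constraint.eq h ∧ reduce pd S.T h ≠ 0

/-- The smallest leader of an effective equation in the queue, `⊤` if there is none. -/
noncomputable def minLeader (pd : PseudoDivision F σ) (S : PairSystem F σ) :
    WithTop (WithBot σ) :=
  (effectiveEquations pd S).inf fun c => ((leader c.poly : WithBot σ) : WithTop (WithBot σ))

theorem four_mul_leaderWeight_le {y z : WithBot σ} (h : y < z) :
    4 * leaderWeight y ≤ leaderWeight z := by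
  unfold leaderWeight
  rw [← pow_succ']
  refine Nat.pow_le_pow_right (by norm_num) ?_
  refine Set.ncard_lt_ncard ⟨Set.Iio_subset_Iio h.le, fun h' => ?_⟩ (Set.toFinite _)
  exact lt_irrefl y (h' h)

/-- The well-founded order on systems by which the passes of the main loop descend: first the
degrees of the equations of the triangular part, which are compared componentwise, then the
smallest leader of an effective equation in the queue, then the weight of the queue. -/
def SystemLT (pd : PseudoDivision F σ) (S' S : PairSystem F σ) : Prop :=
  Prod.Lex (· < ·) (Prod.Lex (· < ·) (· < ·))
    (equationDegrees S', minLeader pd S', queueWeight S')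
    (equationDegrees S, minLeader pd S, queueWeight S)

theorem wellFounded_systemLT (pd : PseudoDivision F σ) : WellFounded (SystemLT pd) :=
  InvImage.wf (fun S : PairSystem F σ => (equationDegrees S, minLeader pd S, queueWeight S))
    (WellFounded.prod_lex wellFounded_lt (WellFounded.prod_lex wellFounded_lt wellFounded_lt))

variable {pd : PseudoDivision F σ} {S S' : PairSystem F σ}

theorem systemLT_of_minLeader_lt (h1 : equationDegrees S' = equationDegrees S)
    (h2 : minLeader pd S' < minLeader pd S) : SystemLT pd S' S := by
  unfold SystemLT
  rw [h1]
  exact Prod.Lex.right _ (Prod.Lex.left _ _ h2)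

theorem systemLT_of_queueWeight_lt (h1 : equationDegrees S' = equationDegrees S)
    (h2 : minLeader pd S' = minLeader pd S) (h3 : queueWeight S' < queueWeight S) :
    SystemLT pd S' S := by
  unfold SystemLT
  rw [h1, h2]
  exact Prod.Lex.right _ (Prod.Lex.right _ h3)

theorem minLeader_le {h : MvPolynomial σ F} (hQ : Constraint.eq h ∈ S.Q)
    (hr : reduce pd S.T h ≠ 0) :
    minLeader pd S ≤ ((leader h : WithBot σ) : WithTop (WithBot σ)) := by
  classical
  have hmem : Constraint.eq h ∈ effectiveEquations pd S :=
    Finset.mem_filter.2 ⟨hQ, h, rfl, hr⟩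
  have h1 := Finset.inf_le
    (f := fun c : Constraint F σ => ((leader c.poly : WithBot σ) : WithTop (WithBot σ))) hmem
  exact h1

theorem minLeader_congr (hT : ∀ p, reduce pd S'.T p = reduce pd S.T p)
    (hQ : ∀ h, reduce pd S.T h ≠ 0 → (Constraint.eq h ∈ S'.Q ↔ Constraint.eq h ∈ S.Q)) :
    minLeader pd S' = minLeader pd S := by
  classical
  have : effectiveEquations pd S' = effectiveEquations pd S := by
    ext c
    simp only [effectiveEquations, Finset.mem_filter, hT]
    constructor
    · rintro ⟨h1, h, rfl, h2⟩
      exact ⟨(hQ h h2).1 h1, h, rfl, h2⟩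
    · rintro ⟨h1, h, rfl, h2⟩
      exact ⟨(hQ h h2).2 h1, h, rfl, h2⟩
  rw [minLeader, minLeader, this]

/-- The selected constraint has a leader that is minimal among the equations of the queue. -/
theorem leader_select_le_minLeader {sel : AlgSystem F σ → Constraint F σ}
    (hsel : IsSelectionStrategy sel) (hQ : S.Q ≠ ∅) :
    ((leader (sel S.Q).poly : WithBot σ) : WithTop (WithBot σ)) ≤ minLeader pd S := by
  classical
  obtain ⟨-, h1, h2⟩ := hsel S.Q (Finset.nonempty_iff_ne_empty.2 hQ)
  refine Finset.le_inf fun c hc => ?_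
  obtain ⟨hc1, h, rfl, -⟩ := Finset.mem_filter.1 hc
  refine WithTop.coe_le_coe.2 ?_
  rcases hs : sel S.Q with p | p
  · exact not_lt.1 (h1 p hs h hc1)
  · exact (not_le.1 (h2 p hs h hc1)).le

/-- Every branch of a case distinction at the selected constraint descends. -/
theorem systemLT_replaceAt {sel : AlgSystem F σ → Constraint F σ}
    (hsel : IsSelectionStrategy sel) (hS : IsRegular S) (hQ : S.Q ≠ ∅) {x : σ}
    (hx : (x : WithBot σ) ≤ leader (sel S.Q).poly) {L : List (Branch F σ)} {d : Branch F σ}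
    (hL : IsSplitting pd (eraseQueue S (sel S.Q)) x
      ((sel S.Q).withPoly (reduce pd S.T (sel S.Q).poly)) L) (hd : d ∈ L) :
    SystemLT pd (replaceAt (eraseQueue S (sel S.Q)) x d.1 d.2) S := by
  classical
  have hT : IsTriangular (eraseQueue S (sel S.Q)).T := hS.triangular
  have hself := slot_replaceAt_self hT (hL.leader_slot d hd) d.2
  have hne := fun y => slot_replaceAt_of_ne (y := y) hT (hL.leader_slot d hd) d.2
  have hmem := (hsel S.Q (Finset.nonempty_iff_ne_empty.2 hQ)).1
  rcases hL.progress d hd with ⟨r, hr, hlt⟩ | ⟨hslot, h⟩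
  · refine Prod.Lex.left _ _ (Pi.lt_def.2 ⟨fun y => ?_, x, ?_⟩)
    · unfold equationDegrees
      by_cases hy : y = x
      · subst hy
        rw [hself, hr]
        exact (slotDegree_lt hlt).le
      · rw [hne y hy]
        rfl
    · unfold equationDegrees
      rw [hself, hr]
      exact slotDegree_lt hlt
  · have hslots : ∀ y t,
        slot (replaceAt (eraseQueue S (sel S.Q)) x d.1 d.2).T y = some (Constraint.eq t) ↔
          slot S.T y = some (Constraint.eq t) := by
      intro y t
      by_cases hy : y = x
      · subst hy
        rw [hself]
        exact hslot t
      · rw [hne y hy]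
        rfl
    have hdeg : equationDegrees (replaceAt (eraseQueue S (sel S.Q)) x d.1 d.2) =
        equationDegrees S := funext fun y => slotDegree_congr (hslots y)
    have hred := reduce_congr pd _ hslots
    rcases h with ⟨h, hh, hr, hhx⟩ | ⟨⟨p, hp⟩, hE, hcard⟩
    · refine systemLT_of_minLeader_lt hdeg ?_
      have h1 : minLeader pd (replaceAt (eraseQueue S (sel S.Q)) x d.1 d.2) ≤
          ((leader h : WithBot σ) : WithTop (WithBot σ)) := by
        refine minLeader_le (mem_replaceAt_Q.2 (Or.inr hh)) ?_
        rw [hred]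
        exact hr
      refine h1.trans_lt (lt_of_lt_of_le ?_ (leader_select_le_minLeader hsel hQ))
      exact WithTop.coe_lt_coe.2 (hhx.trans_le hx)
    · have hsne : ∀ h, Constraint.eq h ≠ sel S.Q := by
        intro h h'
        rw [← h'] at hp
        cases hp
      refine systemLT_of_queueWeight_lt hdeg (minLeader_congr hred fun h _ => ?_) ?_
      · rw [mem_replaceAt_Q, mem_eraseQueue_Q]
        constructor
        · rintro (h1 | h1)
          · exact h1.2
          · obtain ⟨h', h2, -⟩ := hE _ h1
            cases h2
        · exact fun h1 => Or.inl ⟨hsne h, h1⟩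
      · have h1 : queueWeight (replaceAt (eraseQueue S (sel S.Q)) x d.1 d.2) ≤
            queueWeight (eraseQueue S (sel S.Q)) + ∑ c ∈ d.2, leaderWeight (leader c.poly) := by
          have h2 := Finset.sum_union_inter (s₁ := (eraseQueue S (sel S.Q)).Q) (s₂ := d.2)
            (f := fun c : Constraint F σ => leaderWeight (leader c.poly))
          exact (Nat.le_add_right _ _).trans_eq h2
        have h3 : ∑ c ∈ d.2, 4 * leaderWeight (leader c.poly) ≤
            d.2.card • leaderWeight (leader (sel S.Q).poly) := by
          refine Finset.sum_le_card_nsmul _ _ _ fun c hc => ?_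
          obtain ⟨h, rfl, h4⟩ := hE c hc
          exact four_mul_leaderWeight_le (h4.trans_le hx)
        rw [← Finset.mul_sum, smul_eq_mul] at h3
        have h5 := Nat.mul_le_mul_right (leaderWeight (leader (sel S.Q).poly)) hcard
        have h6 := queueWeight_eraseQueue hmem
        have h7 := leaderWeight_pos (leader (sel S.Q).poly)
        omega

end Measure

/-! ### One pass through the main loop -/

section MainLoopPass

open MvPolynomial

variable {F : Type u} [Field F] {σ : Type v} [LinearOrder σ] [Finite σ]

/-- The correctness of one pass through the main loop, for a system `S` that is replaced by the
systems in `C`. -/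
structure IsRefinement (pd : PseudoDivision F σ) (S : PairSystem F σ)
    (C : Finset (PairSystem F σ)) : Prop where
  regular : ∀ S' ∈ C, IsRegular S'
  mem_sol_iff : ∀ a, a ∈ Sol S.toAlgSystem ↔ ∃ S' ∈ C, a ∈ Sol S'.toAlgSystem
  disjoint : ∀ S₁ ∈ C, ∀ S₂ ∈ C, S₁ ≠ S₂ → ∀ a, a ∈ Sol S₁.toAlgSystem →
    a ∈ Sol S₂.toAlgSystem → False
  descends : ∀ S' ∈ C, SystemLT pd S' S

variable {pd : PseudoDivision F σ} {S : PairSystem F σ} {sel : AlgSystem F σ → Constraint F σ}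

theorem isRefinement_branchSystems (hsel : IsSelectionStrategy sel) (hS : IsRegular S)
    (hQ : S.Q ≠ ∅) {x : σ} (hx : (x : WithBot σ) ≤ leader (sel S.Q).poly)
    {L : List (Branch F σ)}
    (hL : IsSplitting pd (eraseQueue S (sel S.Q)) x
      ((sel S.Q).withPoly (reduce pd S.T (sel S.Q).poly)) L) :
    IsRefinement pd S (branchSystems (eraseQueue S (sel S.Q)) x L) where
  regular S' hS' := by
    obtain ⟨d, hd, rfl⟩ := mem_branchSystems.1 hS'
    exact isRegular_replaceAt hS hx hL hd
  mem_sol_iff a := mem_sol_iff_exists_branch hS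
    (hsel S.Q (Finset.nonempty_iff_ne_empty.2 hQ)).1 hx hL a
  disjoint _ h₁ _ h₂ hne a := disjoint_branchSystems hL h₁ h₂ hne a
  descends S' hS' := by
    obtain ⟨d, hd, rfl⟩ := mem_branchSystems.1 hS'
    exact systemLT_replaceAt hsel hS hQ hx hL hd

/-- A selected constraint that reduces to a valid constant constraint is dropped. -/
theorem isRefinement_eraseQueue (hsel : IsSelectionStrategy sel) (hS : IsRegular S)
    (hQ : S.Q ≠ ∅)
    (hq : ∀ a, ((sel S.Q).withPoly (reduce pd S.T (sel S.Q).poly)).Holds a)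
    (hr : ∀ h, sel S.Q = Constraint.eq h → reduce pd S.T h = 0) :
    IsRefinement pd S {eraseQueue S (sel S.Q)} := by
  have hmem := (hsel S.Q (Finset.nonempty_iff_ne_empty.2 hQ)).1
  have key : ∀ {D : WithBot σ → Prop}, IsLowerPred D → ∀ a,
      HoldsOn D (eraseQueue S (sel S.Q)).toAlgSystem a → HoldsOn D S.toAlgSystem a :=
    fun hD a ha => holdsOn_eraseQueue (fun h => (holds_reduce_iff hS hD ha h).1 (hq a)) ha
  have hsub : ∀ (y : σ) a, a ∈ Sol (below (eraseQueue S (sel S.Q)).toAlgSystem y) →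
      a ∈ Sol (below S.toAlgSystem y) := fun y a ha =>
    mem_sol_below.2 (key (isLowerPred_lt _) a (mem_sol_below.1 ha))
  refine ⟨?_, ?_, ?_, ?_⟩
  · rintro S' hS'
    obtain rfl := Finset.mem_singleton.1 hS'
    exact ⟨hS.triangular, fun y c hc hy a ha => hS.init_ne_zero y c hc hy a (hsub y a ha),
      fun y c hc hy a ha => hS.squarefree y c hc hy a (hsub y a ha)⟩
  · intro a
    simp only [Finset.mem_singleton, exists_eq_left, ThomasDecomposition.mem_sol_iff]
    exact ⟨HoldsOn.eraseQueue, key isLowerPred_true a⟩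
  · rintro S₁ h₁ S₂ h₂ hne
    exact absurd ((Finset.mem_singleton.1 h₁).trans (Finset.mem_singleton.1 h₂).symm) hne
  · rintro S' hS'
    obtain rfl := Finset.mem_singleton.1 hS'
    refine systemLT_of_queueWeight_lt rfl (minLeader_congr (fun _ => rfl) fun h hh => ?_) ?_
    · rw [mem_eraseQueue_Q]
      exact and_iff_right fun h' => hh (hr h h'.symm)
    · have h1 := queueWeight_eraseQueue hmem
      have h2 := leaderWeight_pos (leader (sel S.Q).poly)
      omega

/-- One pass through the main loop is correct and descends. After reduction, the polynomial has
an initial that does not reduce to zero and a smaller degree than the equation with the same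
leader, as the case distinctions require. -/
theorem isRefinement_processSystem [CharZero F] (hsel : IsSelectionStrategy sel)
    (hS : IsRegular S) (hQ : S.Q ≠ ∅) : IsRefinement pd S (processSystem pd sel S) := by
  classical
  have hmem := (hsel S.Q (Finset.nonempty_iff_ne_empty.2 hQ)).1
  have hle := leader_reduce_le pd S.T (sel S.Q).poly
  unfold processSystem
  extract_lets q₀ S₀ q
  have hqp : q.poly = reduce pd S.T q₀.poly := poly_withPoly _ _
  split_ifs with hc
  -- an inconsistent constant constraint
  · refine ⟨by simp, fun a => ?_, by simp, by simp⟩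
    simp only [Finset.notMem_empty, false_and, exists_false, iff_false]
    intro ha
    have h1 := (holds_reduce_iff (pd := pd) hS isLowerPred_true
      (mem_sol_iff.1 ha).eraseQueue trivial).2 (ha q₀ (mem_toAlgSystem.2 (Or.inr hmem)))
    change q.Holds a at h1
    rcases hc with h | ⟨c, hc0, h⟩
    · rw [h] at h1
      exact h1 (evalAt_zero a)
    · rw [h] at h1
      simp only [Constraint.Holds, evalAt_C] at h1
      exact hc0 (by simpa using h1)
  · rw [not_or] at hc
    split
    -- a valid constant constraint
    · next hl =>
      obtain ⟨c, hc'⟩ := eq_C_of_leader_eq_bot hl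
      refine isRefinement_eraseQueue hsel hS hQ (fun a => ?_) fun h hh => ?_
      · change q.Holds a
        rcases hq : q with p | p
        · rw [hq] at hc'
          have h0 : c = 0 := by
            by_contra hne
            exact hc.2 ⟨c, hne, hq.trans (congrArg Constraint.eq hc')⟩
          change p = C c at hc'
          simp [Constraint.Holds, hc', h0, evalAt_zero]
        · rw [hq] at hc'
          change p = C c at hc'
          have h0 : c ≠ 0 := by
            rintro rfl
            rw [C_0] at hc'
            exact hc.1 (hq.trans (congrArg Constraint.ne hc'))
          simpa [Constraint.Holds, hc', evalAt_C] using h0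
      · have hq : q = Constraint.eq (reduce pd S.T h) := by
          change (sel S.Q).withPoly (reduce pd S.T (sel S.Q).poly) = _
          rw [hh]
          rfl
        rw [hq] at hc'
        change reduce pd S.T h = C c at hc'
        by_contra hne
        refine hc.2 ⟨c, ?_, hq.trans (congrArg Constraint.eq hc')⟩
        rintro rfl
        exact hne (hc'.trans C_0)
    · next x hx =>
      have hxle : (x : WithBot σ) ≤ leader (sel S.Q).poly := by
        change leader q.poly = x at hx
        rw [← hx, hqp]
        exact hle
      have hS₀ : IsRegularAt pd S₀ x := hS.isRegularAt hxle
      obtain ⟨h1, h2⟩ := reduce_reduced pd S.T hqp.symm hx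
      have h3 : ∀ t, slot S₀.T x = some (Constraint.eq t) → degX x q.poly < degX x t := by
        intro t ht
        have := h1 t ht
        rwa [mdeg_eq hx, mdeg_eq (show leader t = x from leader_of_slot ht)] at this
      rcases hq : q with p | p
      · rw [hq] at hx h2 h3
        obtain ⟨L, hL1, hL2⟩ := exists_isSplitting_treatEquation (q := p) hS₀ hx h3 h2
        change IsRefinement pd S (treatEquation pd S₀ p x)
        rw [hL1]
        refine isRefinement_branchSystems hsel hS hQ hxle ?_
        change IsSplitting pd S₀ x q L
        rw [hq]
        exact hL2
      · rw [hq] at hx h2 h3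
        obtain ⟨L, hL1, hL2⟩ := exists_isSplitting_treatInequation (q := p) hS₀ hx h3 h2
        change IsRefinement pd S (treatInequation pd S₀ p x)
        rw [hL1]
        refine isRefinement_branchSystems hsel hS hQ hxle ?_
        change IsSplitting pd S₀ x q L
        rw [hq]
        exact hL2

end MainLoopPass

/-! ### The main loop -/

section Loop

open MvPolynomial

variable {F : Type u} [Field F] {σ : Type v} [LinearOrder σ]

/-- A system that occurs in the loop, finished or not. -/
def LoopState.Contains (st : LoopState F σ) (S : PairSystem F σ) : Prop :=
  S ∈ st.P ∨ S ∈ st.Result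

/-- The invariant of the main loop for the input `S`. -/
structure LoopInvariant (S : AlgSystem F σ) (st : LoopState F σ) : Prop where
  regular : ∀ S₁, st.Contains S₁ → IsRegular S₁
  queue_eq_empty : ∀ S₁ ∈ st.Result, S₁.Q = ∅
  mem_sol_iff : ∀ a, a ∈ Sol S ↔ ∃ S₁, st.Contains S₁ ∧ a ∈ Sol S₁.toAlgSystem
  disjoint : ∀ S₁ S₂, st.Contains S₁ → st.Contains S₂ → S₁ ≠ S₂ → ∀ a,
    a ∈ Sol S₁.toAlgSystem → a ∈ Sol S₂.toAlgSystem → False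

theorem loopInvariant_initialState (S : AlgSystem F σ) : LoopInvariant S (initialState S) := by
  have hmem : ∀ S₁, (initialState S).Contains S₁ ↔ S₁ = ⟨∅, S⟩ := fun S₁ => by
    simp [initialState, LoopState.Contains]
  refine ⟨fun S₁ h => ?_, by simp [initialState], fun a => ?_, fun S₁ S₂ h₁ h₂ hne => ?_⟩
  · obtain rfl := (hmem S₁).1 h
    refine ⟨⟨fun x => ?_, fun k => ⟨?_, ?_⟩⟩, ?_, ?_⟩ <;> simp [atLeader]
  · have h : (⟨∅, S⟩ : PairSystem F σ).toAlgSystem = S := by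
      ext c
      simp [mem_toAlgSystem]
    simp [hmem, h]
  · exact absurd (((hmem S₁).1 h₁).trans ((hmem S₂).1 h₂).symm) hne

theorem LoopInvariant.isThomasDecomposition {S : AlgSystem F σ} {st : LoopState F σ}
    (h : LoopInvariant S st) (hP : st.P = ∅) :
    IsThomasDecomposition (fun S' : {S' // S' ∈ st.Result} => S'.1.toAlgSystem) S := by
  have hC : ∀ S₁, st.Contains S₁ ↔ S₁ ∈ st.Result := fun S₁ => by
    simp [LoopState.Contains, hP]
  refine ⟨inferInstance, fun S' => ?_, ?_, fun S₁ S₂ hne => ?_⟩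
  · exact (h.regular _ ((hC _).2 S'.2)).isSimple (h.queue_eq_empty _ S'.2)
  · ext a
    rw [h.mem_sol_iff]
    simp [hC]
  · rw [Set.eq_empty_iff_forall_notMem]
    rintro a ⟨h₁, h₂⟩
    exact h.disjoint _ _ ((hC _).2 S₁.2) ((hC _).2 S₂.2) (fun h => hne (Subtype.ext h)) a h₁ h₂

variable [Finite σ] {pd : PseudoDivision F σ} {sel : AlgSystem F σ → Constraint F σ}
  {S : AlgSystem F σ} {st st' : LoopState F σ}

theorem LoopInvariant.step [CharZero F] (hsel : IsSelectionStrategy sel)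
    (h : LoopInvariant S st) (hst : Step pd sel st st') : LoopInvariant S st' := by
  classical
  cases hst with
  | finish S₀ hS₀ hQ =>
    have hC : ∀ S₁, (⟨st.P.erase S₀, st.Result ∪ {S₀}⟩ : LoopState F σ).Contains S₁ ↔
        st.Contains S₁ := fun S₁ => by
      by_cases h1 : S₁ = S₀
      · subst h1
        simp [LoopState.Contains, hS₀]
      · simp [LoopState.Contains, h1]
    refine ⟨fun S₁ h₁ => h.regular _ ((hC _).1 h₁), fun S₁ h₁ => ?_, fun a => ?_,
      fun S₁ S₂ h₁ h₂ => h.disjoint _ _ ((hC _).1 h₁) ((hC _).1 h₂)⟩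
    · rcases Finset.mem_union.1 h₁ with h₁ | h₁
      · exact h.queue_eq_empty _ h₁
      · rwa [Finset.mem_singleton.1 h₁]
    · rw [h.mem_sol_iff]
      simp only [hC]
  | process S₀ hS₀ hQ =>
    have hR := isRefinement_processSystem (pd := pd) hsel (h.regular _ (Or.inl hS₀)) hQ
    have hC : ∀ S₁, (⟨st.P.erase S₀ ∪ processSystem pd sel S₀, st.Result⟩ :
        LoopState F σ).Contains S₁ ↔
        S₁ ∈ processSystem pd sel S₀ ∨ S₁ ≠ S₀ ∧ st.Contains S₁ := fun S₁ => by
      have h1 : S₁ ∈ st.Result → S₁ ≠ S₀ := by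
        rintro h2 rfl
        exact hQ (h.queue_eq_empty _ h2)
      simp only [LoopState.Contains, Finset.mem_union, Finset.mem_erase]
      tauto
    refine ⟨fun S₁ h₁ => ?_, h.queue_eq_empty, fun a => ?_, fun S₁ S₂ h₁ h₂ hne a ha₁ ha₂ => ?_⟩
    · rcases (hC _).1 h₁ with h₁ | h₁
      · exact hR.regular _ h₁
      · exact h.regular _ h₁.2
    · rw [h.mem_sol_iff]
      constructor
      · rintro ⟨S₁, h₁, ha⟩
        by_cases hS : S₁ = S₀
        · subst hS
          obtain ⟨S₂, h₂, ha₂⟩ := (hR.mem_sol_iff a).1 ha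
          exact ⟨S₂, (hC _).2 (Or.inl h₂), ha₂⟩
        · exact ⟨S₁, (hC _).2 (Or.inr ⟨hS, h₁⟩), ha⟩
      · rintro ⟨S₁, h₁, ha⟩
        rcases (hC _).1 h₁ with h₁ | h₁
        · exact ⟨S₀, Or.inl hS₀, (hR.mem_sol_iff a).2 ⟨S₁, h₁, ha⟩⟩
        · exact ⟨S₁, h₁.2, ha⟩
    · have hsub : ∀ S₃ ∈ processSystem pd sel S₀, a ∈ Sol S₃.toAlgSystem →
          a ∈ Sol S₀.toAlgSystem := fun S₃ h₃ ha => (hR.mem_sol_iff a).2 ⟨S₃, h₃, ha⟩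
      rcases (hC _).1 h₁ with h₁ | h₁ <;> rcases (hC _).1 h₂ with h₂ | h₂
      · exact hR.disjoint _ h₁ _ h₂ hne a ha₁ ha₂
      · exact h.disjoint _ _ (Or.inl hS₀) h₂.2 h₂.1.symm a (hsub _ h₁ ha₁) ha₂
      · exact h.disjoint _ _ (Or.inl hS₀) h₁.2 h₁.1.symm a (hsub _ h₂ ha₂) ha₁
      · exact h.disjoint _ _ h₁.2 h₂.2 hne a ha₁ ha₂

theorem LoopInvariant.reflTransGen [CharZero F] (hsel : IsSelectionStrategy sel)
    (h : LoopInvariant S st) (hst : Relation.ReflTransGen (Step pd sel) st st') :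
    LoopInvariant S st' := by
  induction hst with
  | refl => exact h
  | tail _ hstep ih => exact ih.step hsel hstep

/-- A step replaces a member of `P` by finitely many smaller ones, hence decreases the multiset
order. Merging equal systems in the finite set `P` is harmless. -/
theorem LoopInvariant.cutExpand [CharZero F] (hsel : IsSelectionStrategy sel)
    (h : LoopInvariant S st) (hst : Step pd sel st st') :
    Relation.CutExpand (SystemLT pd) st'.P.val st.P.val := by
  classical
  have hsum : ∀ S₀ ∈ st.P, (st.P.erase S₀).val + {S₀} = st.P.val := fun S₀ hS₀ => by
    rw [Finset.erase_val, add_comm, Multiset.singleton_add, Multiset.cons_erase hS₀]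
  cases hst with
  | finish S₀ hS₀ hQ => exact ⟨0, S₀, by simp, by rw [add_zero]; convert hsum S₀ hS₀⟩
  | process S₀ hS₀ hQ =>
    have hR := isRefinement_processSystem (pd := pd) hsel (h.regular _ (Or.inl hS₀)) hQ
    refine ⟨(processSystem pd sel S₀ \ st.P.erase S₀).val, S₀, fun S₁ h₁ => ?_, ?_⟩
    · exact hR.descends _ (Finset.mem_sdiff.1 (Finset.mem_def.2 h₁)).1
    · have h1 : st.P.erase S₀ ∪ processSystem pd sel S₀ =
          (st.P.erase S₀).disjUnion (processSystem pd sel S₀ \ st.P.erase S₀)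
            Finset.disjoint_sdiff := by
        rw [Finset.disjUnion_eq_union, Finset.union_sdiff_self_eq_union]
      have h2 : (st.P.erase S₀ ∪ processSystem pd sel S₀).val =
          (st.P.erase S₀).val + (processSystem pd sel S₀ \ st.P.erase S₀).val :=
        congrArg Finset.val h1
      have h3 : (st.P.erase S₀ ∪ processSystem pd sel S₀).val + {S₀} =
          st.P.val + (processSystem pd sel S₀ \ st.P.erase S₀).val := by
        rw [h2, add_right_comm, hsum S₀ hS₀]
      convert h3

theorem LoopInvariant.exists_terminal [CharZero F] (hsel : IsSelectionStrategy sel)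
    (h : LoopInvariant S st) :
    ∃ st', Relation.ReflTransGen (Step pd sel) st st' ∧ st'.P = ∅ := by
  have wf := (wellFounded_systemLT pd).cutExpand
  suffices H : ∀ (m : Multiset (PairSystem F σ)) (st : LoopState F σ), st.P.val = m →
      LoopInvariant S st → ∃ st', Relation.ReflTransGen (Step pd sel) st st' ∧ st'.P = ∅ from
    H _ st rfl h
  intro m
  induction m using wf.induction with
  | _ m ih =>
    rintro st rfl h
    by_cases hP : st.P = ∅
    · exact ⟨st, Relation.ReflTransGen.refl, hP⟩
    · obtain ⟨st₁, h₁⟩ := (exists_step_iff pd sel st).2 hP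
      obtain ⟨st₂, h₂, h₃⟩ := ih _ (h.cutExpand hsel h₁) st₁ rfl (h.step hsel h₁)
      exact ⟨st₂, Relation.ReflTransGen.head h₁ h₂, h₃⟩

theorem not_exists_infinite_run [CharZero F] (hsel : IsSelectionStrategy sel) :
    ¬ ∃ run : ℕ → LoopState F σ, run 0 = initialState S ∧
      ∀ k, Step pd sel (run k) (run (k + 1)) := by
  rintro ⟨run, h0, hrun⟩
  have hinv : ∀ k, LoopInvariant S (run k) := fun k => by
    induction k with
    | zero => exact h0 ▸ loopInvariant_initialState S
    | succ k ih => exact ih.step hsel (hrun k)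
  exact (wellFounded_iff_isEmpty_descending_chain.1 (wellFounded_systemLT pd).cutExpand).false
    ⟨fun k => (run k).P.val, fun k => (hinv k).cutExpand hsel (hrun k)⟩

end Loop

/-! ### A pseudo division and a selection strategy -/

section Existence

open MvPolynomial

variable {F : Type u} [Field F] {σ : Type v} [LinearOrder σ]

theorem exists_pseudo_division {q : MvPolynomial σ F} {x : σ} (hq : leader q = x) (k : ℕ)
    (p : MvPolynomial σ F) (hp : leader p ≤ x) (hpk : degX x p < degX x q + k) :
    ∃ A B : MvPolynomial σ F, init q ^ k * p = A * q + B ∧ degX x B < degX x q := by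
  induction k generalizing p with
  | zero => exact ⟨0, p, by ring, hpk⟩
  | succ k ih =>
    have hn := degX_pos hq
    have hiq : init q ∈ supported F (Set.Iio x) :=
      (leader_lt_iff x _).1 ((leader_init_lt hq).trans_eq hq)
    have hcp := coeff_uni_mem x p ((leader_le_iff x p).1 hp) (degX x q + k)
    set c := (uni x p).coeff (degX x q + k) with hc
    have hle : ∀ {f : MvPolynomial σ F}, f ∈ supported F (Set.Iio x) →
        f ∈ supported F (Set.Iic x) := fun hf =>
      (leader_le_iff x _).1 ((leader_lt_iff x _).2 hf).le
    have hX : (X x : MvPolynomial σ F) ∈ supported F (Set.Iic x) :=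
      X_mem_supported.2 (Set.mem_Iic.2 (le_refl x))
    have hp1 : leader (init q * p - c * X x ^ k * q) ≤ x := by
      rw [leader_le_iff]
      exact Subalgebra.sub_mem _ (Subalgebra.mul_mem _ (hle hiq) ((leader_le_iff x p).1 hp))
        (Subalgebra.mul_mem _ (Subalgebra.mul_mem _ (hle hcp) (Subalgebra.pow_mem _ hX k))
          ((leader_le_iff x q).1 hq.le))
    have hd1 : degX x (init q * p - c * X x ^ k * q) < degX x q + k := by
      unfold degX at hpk hn ⊢
      have hu : uni x (init q * p - c * X x ^ k * q) = Polynomial.C (init q) * uni x p -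
          Polynomial.C c * (Polynomial.X ^ k * uni x q) := by
        rw [map_sub, map_mul, map_mul, map_mul, map_pow, uni_X_self, uni_of_mem_Iio x _ hiq,
          uni_of_mem_Iio x _ hcp, mul_assoc]
      have hcoeff : ∀ m, (uni x q).natDegree + k ≤ m →
          (uni x (init q * p - c * X x ^ k * q)).coeff m = 0 := by
        intro m hm
        rw [hu, Polynomial.coeff_sub, Polynomial.coeff_C_mul, Polynomial.coeff_C_mul]
        rcases hm.eq_or_lt with rfl | hm
        · rw [Polynomial.coeff_X_pow_mul, Polynomial.coeff_natDegree, init_eq hq, hc]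
          unfold degX
          ring
        · rw [Polynomial.coeff_eq_zero_of_natDegree_lt (by omega), Polynomial.coeff_X_pow_mul',
            if_pos (by omega), Polynomial.coeff_eq_zero_of_natDegree_lt (p := uni x q) (by omega)]
          ring
      by_contra hcon
      have h0 : uni x (init q * p - c * X x ^ k * q) = 0 :=
        Polynomial.leadingCoeff_eq_zero.1 (hcoeff _ (not_lt.1 hcon))
      rw [h0, Polynomial.natDegree_zero] at hcon
      omega
    obtain ⟨A, B, hAB, hB⟩ := ih _ hp1 hd1
    exact ⟨A + init q ^ k * c * X x ^ k, B, by linear_combination hAB, hB⟩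

/-- Quotient and remainder are determined by the degree bound, since the degree in `x` is additive
on products. -/
theorem pseudo_remainder_unique {q A B A' B' : MvPolynomial σ F} {x : σ}
    (h : A * q + B = A' * q + B') (hB : degX x B < degX x q) (hB' : degX x B' < degX x q) :
    A = A' ∧ B = B' := by
  have hA : A = A' := by
    by_contra hne
    have hq : q ≠ 0 := by
      rintro rfl
      simp [degX] at hB
    have h1 : (A - A') * q = B' - B := by linear_combination h
    have h2 := degX_mul (x := x) (sub_ne_zero.2 hne) hq
    rw [h1] at h2
    unfold degX at h2 hB hB'
    rw [map_sub] at h2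
    have := Polynomial.natDegree_sub_le (uni x B') (uni x B)
    have := max_lt hB' hB
    omega
  subst hA
  exact ⟨rfl, add_left_cancel h⟩

/-- The classical pseudo division, with the multiplier `init q ^ (deg p - deg q + 1)`. As this
multiplier is not changed by rescaling `p`, uniqueness yields the compatibility of the
remainder with rescaling. -/
theorem nonempty_pseudoDivision : Nonempty (PseudoDivision F σ) := by
  classical
  have key : ∀ (p q : MvPolynomial σ F) (x : σ), ∃ AB : MvPolynomial σ F × MvPolynomial σ F,
      leader p = x → leader q = x →
        init q ^ (degX x p + 1 - degX x q) * p = AB.1 * q + AB.2 ∧ degX x AB.2 < degX x q := by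
    intro p q x
    by_cases h : leader p = x ∧ leader q = x
    · obtain ⟨A, B, hAB⟩ := exists_pseudo_division h.2 (degX x p + 1 - degX x q) p h.1.le (by omega)
      exact ⟨(A, B), fun _ _ => hAB⟩
    · exact ⟨(0, 0), fun h1 h2 => absurd ⟨h1, h2⟩ h⟩
  choose f hf using key
  refine ⟨⟨fun p q x => (f p q x).2, fun p q x => (f p q x).1, fun p q x hp hq => ?_,
    fun c p q x hc hp hq => ⟨c, hc, ?_⟩⟩⟩
  · obtain ⟨h1, h2⟩ := hf p q x hp hq
    refine ⟨_, degX x p + 1 - degX x q, dvd_rfl, ?_, h1, h2⟩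
    rw [leader_lt_iff]
    exact Subalgebra.pow_mem _ ((leader_lt_iff x _).1 ((leader_init_lt hq).trans_eq hq)) _
  · obtain ⟨h1, h2⟩ := hf p q x hp hq
    obtain ⟨h3, h4⟩ := hf (C c * p) q x ((leader_C_mul hc p).trans hp) hq
    rw [degX_C_mul hc] at h3
    refine (pseudo_remainder_unique (A' := C c * (f p q x).1) (h3.symm.trans ?_) h4 ?_).2
    · linear_combination C c * h1
    · rwa [degX_C_mul hc]

/-- Selecting a constraint of minimal leader, equations first. -/
theorem exists_isSelectionStrategy :
    ∃ sel : AlgSystem F σ → Constraint F σ, IsSelectionStrategy sel := by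
  classical
  let key : Constraint F σ → WithBot σ ×ₗ ℕ := fun c =>
    toLex (leader c.poly, match c with
      | Constraint.eq _ => 0
      | Constraint.ne _ => 1)
  have h : ∀ Q : AlgSystem F σ, ∃ c : Constraint F σ, Q.Nonempty →
      c ∈ Q ∧ ∀ d ∈ Q, key c ≤ key d := fun Q => by
    by_cases hQ : Q.Nonempty
    · obtain ⟨c, hc⟩ := Q.exists_min_image key hQ
      exact ⟨c, fun _ => hc⟩
    · exact ⟨Constraint.eq 0, fun h => absurd h hQ⟩
  choose sel hsel using h
  refine ⟨sel, fun Q hQ => ⟨(hsel Q hQ).1, fun p hp r hr hlt => ?_, fun p hp r hr hle => ?_⟩⟩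
  · have h1 := (hsel Q hQ).2 _ hr
    rw [hp] at h1
    refine absurd h1 (not_le.2 ?_)
    exact Prod.Lex.toLex_lt_toLex.2 (Or.inl hlt)
  · have h1 := (hsel Q hQ).2 _ hr
    rw [hp] at h1
    refine absurd h1 (not_le.2 (Prod.Lex.toLex_lt_toLex.2 ?_))
    rcases hle.lt_or_eq with h2 | h2
    · exact Or.inl h2
    · exact Or.inr ⟨h2, Nat.zero_lt_one⟩

end Existence

end ThomasDecomposition

theorem mainTheorem1 {F : Type*} [Field F] [CharZero F] {σ : Type*} [LinearOrder σ] [Finite σ]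
    (S : ThomasDecomposition.AlgSystem F σ) :
    (∀ (pd : ThomasDecomposition.PseudoDivision F σ)
      (sel : ThomasDecomposition.AlgSystem F σ → ThomasDecomposition.Constraint F σ),
      ThomasDecomposition.IsSelectionStrategy sel →
      (¬ ∃ run : ℕ → ThomasDecomposition.LoopState F σ,
        run 0 = ThomasDecomposition.initialState S ∧
          ∀ k, ThomasDecomposition.Step pd sel (run k) (run (k + 1))) ∧
      (∀ st : ThomasDecomposition.LoopState F σ,
        Relation.ReflTransGen (ThomasDecomposition.Step pd sel)
          (ThomasDecomposition.initialState S) st →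
        st.P = ∅ →
        (∀ S' ∈ st.Result, S'.Q = ∅) ∧
        ThomasDecomposition.IsThomasDecomposition
          (fun S' : {S' // S' ∈ st.Result} => S'.1.toAlgSystem) S)) ∧
    (∃ (m : ℕ) (D : Fin m → ThomasDecomposition.AlgSystem F σ),
      ThomasDecomposition.IsThomasDecomposition D S) := by
  have h0 := ThomasDecomposition.loopInvariant_initialState S
  refine ⟨fun pd sel hsel => ⟨ThomasDecomposition.not_exists_infinite_run hsel,
    fun st hst hP => ?_⟩, ?_⟩
  · have h := h0.reflTransGen hsel hst
    exact ⟨h.queue_eq_empty, h.isThomasDecomposition hP⟩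
  · obtain ⟨pd⟩ := ThomasDecomposition.nonempty_pseudoDivision (F := F) (σ := σ)
    obtain ⟨sel, hsel⟩ := ThomasDecomposition.exists_isSelectionStrategy (F := F) (σ := σ)
    obtain ⟨st, hst, hP⟩ := h0.exists_terminal (pd := pd) hsel
    obtain ⟨-, h2, h3, h4⟩ := (h0.reflTransGen hsel hst).isThomasDecomposition hP
    refine ⟨st.Result.card, fun i => (st.Result.equivFin.symm i).1.toAlgSystem,
      inferInstance, fun i => h2 _, ?_, fun i j hij => h4 _ _ fun h => hij ?_⟩
    · rw [h3]
      exact (st.Result.equivFin.symm.surjective.iUnion_comp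
        fun S' : {S' // S' ∈ st.Result} => ThomasDecomposition.Sol S'.1.toAlgSystem).symm
    · exact st.Result.equivFin.symm.injective h
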